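/- Let $n\ge 1$, let $\mathbb H^{n+1}=\{x\in\mathbb R^{n+1}:x_{n+1}>0\}$ carry the half-space metric $\langle\cdot,\cdot\rangle=x_{n+1}^{-2}\langle\cdot,\cdot\rangle_\delta$ ($\delta$ Euclidean), let $E_1,\dots,E_{n+1}$ be the coordinate basis, and let $\mathbb S^n_+=\{z\in\mathbb S^n: z_1>0\}$ with the round metric $\sigma$. Let $\theta\in[0,\pi]$, $c\in\mathbb R$, $R>0$, and let $$K_0=K_0(c,R,\theta)=\begin{cases}c-R\sin\theta,&\theta\le\pi/2,\\ c-R,&\theta>\pi/2.\end{cases}$$ For $a\in\mathbb R^{n+1}$ perpendicular to $E_1$ and $E_{n+1}$ put $\mathcal C_{c,R,\theta}(a)=\{x\in\mathbb H^{n+1}: |x+R\cos\theta\,E_1-a-cE_{n+1}|_\delta\le R,\ x_1\ge 0\}$. **The flow.** For a function $u$ on $\overline{\mathbb S^n_+}$ write $\rho=e^u$, $v=\sqrt{1+|\nabla u|^2}$ ($\nabla$, $\nabla^2$ with respect to $\sigma$). Where $c+\rho z_{n+1}>0$, the radial graph $x=cE_{n+1}+\rho(z)z$ in $\mathbb H^{n+1}$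 has outer unit normal $\nu=x_{n+1}(z-\nabla u)/v$ and mean curvature $$H=\frac{x_{n+1}}{\rho v}\Big(n-\big(\sigma^{ij}-\tfrac{u^iu^j}{v^2}\big)u_{ij}\Big)-\frac nv\,\langle E_{n+1},z-\nabla u\rangle_\delta .$$ Put $q_c=\frac{nc}{x_{n+1}}-nc\cos\theta\,\langle E_1,\nu\rangle-H\,\langle x-cE_{n+1},\nu\rangle$ and $Q_c=\frac{v\,x_{n+1}}{\rho}\,q_c$. A solution of the scalar capillary flow on $[0,T^*)$, $0<T^*\le\infty$, with initial value $u_0$ is a function $u$ on $\overline{\mathbb S^n_+}\times[0,T^*)$ whose radial graphs lie in $\mathbb H^{n+1}$, which is smooth (up to $\partial\mathbb S^n_+$) for $t>0$, with $u,\nabla u,\nabla^2u$ continuous up to $t=0$, such that $$u_t=Q_c\ \text{ in }\mathbb S^n_+\times[0,T^*),\qquad u_\beta=\sqrt{1+|\nabla u|^2}\,\cos\theta\ \text{ on }\partial\mathbb S^n_+\times[0,T^*),\qquad u(\cdot,0)=u_0,$$ where $\beta$ is the angle from $E_1$ (so $\partial_\beta=-E_1$ on $\partial\mathbb S^n_+$).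 **Proposition ($C^1$-estimate).** Suppose that $K_0>\frac{c(n-1)}{4n}$ and $$|\cos\theta|<\frac{4nK_0-c(n-1)}{4nK_0+c(n-1)} .$$ Then for every $M$ there is a constant $C$, depending only on $n,c,R,\theta,M$, with the following property. Let $u_0$ be such that the initial hypersurface $\Sigma_0=\{cE_{n+1}+e^{u_0(z)}z:z\in\overline{\mathbb S^n_+}\}$ is contained in $\mathcal C_{c,R,\theta}(a)$ for some $a$ perpendicular to $E_1$ and $E_{n+1}$, and $|u_0|,|\nabla u_0|,|\nabla^2u_0|\le M$ on $\overline{\mathbb S^n_+}$. If $u$ is a solution of the scalar capillary flow on $[0,T^*)$ with initial value $u_0$, then $$|\nabla u|(z,t)\le C\qquad\text{for all }(z,t)\in\overline{\mathbb S^n_+}\times[0,T]\text{ and all }T<T^* .$$ -/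

import Mathlib

open scoped ContDiff

noncomputable section

namespace CapillaryFlow

/-- The ambient coordinate space `ℝ^{n+1}` with its Euclidean metric `δ`. The coordinate `x_1` has
index `0`, the coordinate `x_{n+1}` has index `Fin.last n`. -/
abbrev Space (n : ℕ) : Type := EuclideanSpace ℝ (Fin (n + 1))

/-- The coordinate vector `E_1`. -/
def eFirst (n : ℕ) : Space n := EuclideanSpace.single 0 1

/-- The coordinate vector `E_{n+1}`. -/
def eLast (n : ℕ) : Space n := EuclideanSpace.single (Fin.last n) 1

/-! ### Calculus on the closed hemisphere -/

/-- The closed hemisphere `{z : |z| = 1, z_1 ≥ 0}`. -/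
def closedHemisphere (n : ℕ) : Set (Space n) := {z | ‖z‖ = 1 ∧ 0 ≤ z 0}

/-- The open hemisphere `{z : |z| = 1, z_1 > 0}`. -/
def openHemisphere (n : ℕ) : Set (Space n) := {z | ‖z‖ = 1 ∧ 0 < z 0}

/-- The boundary `{z : |z| = 1, z_1 = 0}` of the hemisphere. -/
def hemisphereBoundary (n : ℕ) : Set (Space n) := {z | ‖z‖ = 1 ∧ z 0 = 0}

/-- The cone over the closed hemisphere: the closed half space `{y_1 ≥ 0}` without the origin. -/
def cone (n : ℕ) : Set (Space n) := {y | 0 ≤ y 0 ∧ y ≠ 0}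

variable {n : ℕ}

/-- The extension `y ↦ f (y / |y|)`, homogeneous of degree zero, of a function on the hemisphere. On
the cone it only uses the values of `f` on the closed hemisphere. -/
def radialExt (f : Space n → ℝ) (y : Space n) : ℝ := f (‖y‖⁻¹ • y)

/-- First derivative of the degree zero extension (one-sided at the boundary of the cone). -/
def extDeriv (f : Space n → ℝ) (y : Space n) : Space n →L[ℝ] ℝ :=
  fderivWithin ℝ (radialExt f) (cone n) y

/-- Second derivative of the degree zero extension (one-sided at the boundary of the cone). -/
def extDeriv2 (f : Space n → ℝ) (y : Space n) : Space n →L[ℝ] Space n →L[ℝ] ℝ :=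
  fderivWithin ℝ (extDeriv f) (cone n) y

/-- The gradient `∇f(z)` with respect to the round metric `σ`, as a vector of `ℝ^{n+1}` tangent to
the sphere at `z`. The degree zero extension has no radial derivative, so that its Euclidean
gradient at a point of the sphere is the gradient on the sphere. -/
def sphereGrad (f : Space n → ℝ) (z : Space n) : Space n :=
  (InnerProductSpace.toDual ℝ (Space n)).symm (extDeriv f z)

/-- The orthogonal projection onto the tangent space of the unit sphere at `z`. -/
def tangentProj (z X : Space n) : Space n := X - (inner ℝ z X) • z

/-- The Hessian `∇²f(z)` with respect to the round metric `σ`, extended by zero in the direction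
normal to the sphere. For tangent vectors `X, Y` one has
`∇²f(X, Y) = D²F(X, Y) - ⟨X, Y⟩ DF(z) = D²F(X, Y)`, where `F` is the degree zero extension. -/
def sphereHess (f : Space n → ℝ) (z X Y : Space n) : ℝ :=
  extDeriv2 f z (tangentProj z X) (tangentProj z Y)

/-! ### Radial graphs in the half space model of hyperbolic space

In the following definitions `z` is a point of the hemisphere, and `r`, `p`, `A` stand for the value
`u(z)`, the gradient `∇u(z)` and the Hessian `∇²u(z)` of the function `u = log ρ`. -/

/-- The hyperbolic inner product `⟨X, Y⟩` at the point `x` in the half space model. -/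
def hypInner (x X Y : Space n) : ℝ := inner ℝ X Y / (x (Fin.last n)) ^ 2

/-- The position vector `x = c E_{n+1} + ρ z`, with `ρ = exp u`. -/
def position (c : ℝ) (z : Space n) (r : ℝ) : Space n := c • eLast n + Real.exp r • z

/-- `x_{n+1} = e^{-w}` at the point `x = c E_{n+1} + ρ z`. -/
def height (c : ℝ) (z : Space n) (r : ℝ) : ℝ := position c z r (Fin.last n)

/-- `v = √(1 + |∇u|²)`. -/
def slope (p : Space n) : ℝ := Real.sqrt (1 + ‖p‖ ^ 2)

/-- The outer Euclidean unit normal of the radial graph: `(z - ∇u) / v`. -/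
def euclNormal (z p : Space n) : Space n := (slope p)⁻¹ • (z - p)

/-- The outer hyperbolic unit normal `ν` of the radial graph. -/
def hypNormal (c : ℝ) (z : Space n) (r : ℝ) (p : Space n) : Space n :=
  height c z r • euclNormal z p

/-- `(σ^{ij} - u^i u^j / v²) u_{ij}`: the trace of the Hessian minus `∇²u(∇u, ∇u) / v²`. -/
def contractedHess (p : Space n) (A : Space n → Space n → ℝ) : ℝ :=
  (∑ i : Fin (n + 1), A (EuclideanSpace.single i 1) (EuclideanSpace.single i 1))
    - A p p / slope p ^ 2

/-- The Euclidean mean curvature of the radial graph (the sum of the principal curvatures, with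
respect to the outer normal). -/
def euclMeanCurvature (r : ℝ) (p : Space n) (A : Space n → Space n → ℝ) : ℝ :=
  ((n : ℝ) - contractedHess p A) / (Real.exp r * slope p)

/-- The hyperbolic mean curvature `H` of the radial graph, by the conformal change
`H = e^{-w} (H_δ + n D w)`, with `D` the derivative along the Euclidean normal. -/
def hypMeanCurvature (c : ℝ) (z : Space n) (r : ℝ) (p : Space n)
    (A : Space n → Space n → ℝ) : ℝ :=
  height c z r * euclMeanCurvature r p A - n * inner ℝ (eLast n) (euclNormal z p)

/-- The normal velocity
`q_c = n c / x_{n+1} - n c cos θ ⟨E_1, ν⟩ - H ⟨x - c E_{n+1}, ν⟩`. -/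
def normalSpeed (c θ : ℝ) (z : Space n) (r : ℝ) (p : Space n)
    (A : Space n → Space n → ℝ) : ℝ :=
  n * c / height c z r
    - n * c * Real.cos θ * hypInner (position c z r) (eFirst n) (hypNormal c z r p)
    - hypMeanCurvature c z r p A
      * hypInner (position c z r) (position c z r - c • eLast n) (hypNormal c z r p)

/-- The right-hand side `Q_c = v / (ρ e^w) q_c` of the scalar flow equation. -/
def scalarSpeed (c θ : ℝ) (z : Space n) (r : ℝ) (p : Space n)
    (A : Space n → Space n → ℝ) : ℝ :=
  slope p * height c z r / Real.exp r * normalSpeed c θ z r p A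

/-! ### The scalar flow -/

/-- The time interval `[0, Tstar)`, where `Tstar` may be infinite. -/
def timeInterval (Tstar : EReal) : Set ℝ := {t | 0 ≤ t ∧ (t : EReal) < Tstar}

/-- `u` (at time `t` the function `u t` on the closed hemisphere) is a solution on `[0, Tstar)` of
the scalar capillary flow with initial value `u₀`. It is smooth, up to the boundary of the
hemisphere, for positive times; `u`, `∇u`, `∇²u` are continuous up to time zero. -/
structure IsScalarFlow (c θ : ℝ) (u₀ : Space n → ℝ) (Tstar : EReal)
    (u : ℝ → Space n → ℝ) : Prop where
  smooth : ContDiffOn ℝ ∞ (fun q : ℝ × Space n => radialExt (u q.1) q.2)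
    ({t : ℝ | 0 < t ∧ (t : EReal) < Tstar} ×ˢ cone n)
  contDiff_two : ∀ t ∈ timeInterval Tstar, ContDiffOn ℝ 2 (radialExt (u t)) (cone n)
  continuousOn_value : ContinuousOn (fun q : ℝ × Space n => radialExt (u q.1) q.2)
    (timeInterval Tstar ×ˢ cone n)
  continuousOn_deriv : ContinuousOn (fun q : ℝ × Space n => extDeriv (u q.1) q.2)
    (timeInterval Tstar ×ˢ cone n)
  continuousOn_deriv2 : ContinuousOn (fun q : ℝ × Space n => extDeriv2 (u q.1) q.2)
    (timeInterval Tstar ×ˢ cone n)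
  /-- The hypersurfaces lie in the half space `x_{n+1} > 0`. -/
  height_pos : ∀ t ∈ timeInterval Tstar, ∀ z ∈ closedHemisphere n, 0 < height c z (u t z)
  /-- The evolution equation `u_t = Q_c`. -/
  evolution : ∀ t ∈ timeInterval Tstar, ∀ z ∈ openHemisphere n,
    HasDerivWithinAt (fun s => u s z)
      (scalarSpeed c θ z (u t z) (sphereGrad (u t) z) (sphereHess (u t) z))
      (timeInterval Tstar) t
  /-- The boundary condition `u_β = √(1 + |∇u|²) cos θ`, where `β` is the angle from `E_1`, so that
  `∂_β = -E_1` along the boundary. -/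
  boundary : ∀ t ∈ timeInterval Tstar, ∀ z ∈ hemisphereBoundary n,
    inner ℝ (sphereGrad (u t) z) (-eFirst n) = slope (sphereGrad (u t) z) * Real.cos θ
  initial : ∀ z ∈ closedHemisphere n, u 0 z = u₀ z

/-! ### Umbilical caps -/

/-- The cap `{x : |x + R cos θ E_1 - a - c E_{n+1}| ≤ R, x_1 ≥ 0}` in the half space
`x_{n+1} > 0`. -/
def cap (c R θ : ℝ) (a : Space n) : Set (Space n) :=
  {x | 0 < x (Fin.last n) ∧ 0 ≤ x 0 ∧ ‖x + (R * Real.cos θ) • eFirst n - a - c • eLast n‖ ≤ R}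

/-- The constant `K_0(c, R, θ)`. -/
def capConst (c R θ : ℝ) : ℝ :=
  if θ ≤ Real.pi / 2 then c - R * Real.sin θ else c - R

/-! ### The explicit form of the scalar speed -/

/-- For a tangent vector `p` at `z`, with `ρ = exp r`, `x_{n+1} = c + ρ z_{n+1}`:
`Q_c = (n c / ρ) |p|² / v - (n c cos θ / ρ) (z_1 - p_1)
  + x_{n+1} / (ρ v) (σ^{ij} - p^i p^j / v²) A_{ij} - (n / v) p_{n+1}`.
Here `z_1 = cos β` and `p_1 = - sin β u_β`. -/
theorem scalarSpeed_eq (c θ : ℝ) (z : Space n) (r : ℝ) (p : Space n) (A : Space n → Space n → ℝ)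
    (hz : ‖z‖ = 1) (hp : inner ℝ z p = 0) (hh : 0 < height c z r) :
    scalarSpeed c θ z r p A
      = n * c / Real.exp r * (‖p‖ ^ 2 / slope p)
        - n * c * Real.cos θ / Real.exp r * (z 0 - p 0)
        + height c z r / (Real.exp r * slope p) * contractedHess p A
        - n / slope p * p (Fin.last n) := by
  have hv : 0 < slope p := Real.sqrt_pos.2 (by positivity)
  have hv2 : slope p ^ 2 = 1 + ‖p‖ ^ 2 := Real.sq_sqrt (by positivity)
  have hρ : 0 < Real.exp r := Real.exp_pos r
  have hpn : ‖p‖ ^ 2 = slope p ^ 2 - 1 := by linarith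
  have hx : (position c z r) (Fin.last n) = height c z r := rfl
  have hht : height c z r = c + Real.exp r * z (Fin.last n) := by
    simp [height, position, eLast]
  have h1 : inner ℝ (eFirst n) (euclNormal z p) = (slope p)⁻¹ * (z 0 - p 0) := by
    simp [eFirst, euclNormal, inner_smul_right, EuclideanSpace.inner_single_left]
  have h2 : inner ℝ (eLast n) (euclNormal z p)
      = (slope p)⁻¹ * (z (Fin.last n) - p (Fin.last n)) := by
    simp [eLast, euclNormal, inner_smul_right, EuclideanSpace.inner_single_left]
  have h3 : inner ℝ (Real.exp r • z) (euclNormal z p) = Real.exp r * (slope p)⁻¹ := by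
    simp [euclNormal, inner_smul_right, inner_smul_left, inner_sub_right, hp, hz]
    ring
  have h4 : position c z r - c • eLast n = Real.exp r • z := by
    simp [position]
  rw [scalarSpeed, normalSpeed, hypInner, hypInner, hypNormal, hypMeanCurvature,
    euclMeanCurvature, h4, inner_smul_right, inner_smul_right, h1, h2, h3, hx, hpn]
  have hzl : z (Fin.last n) = (height c z r - c) / Real.exp r := by
    rw [hht]; field_simp; ring
  rw [hzl]
  field_simp
  ring

end CapillaryFlow

end

open CapillaryFlow

/-! Write k = cos θ and pass from u to W(y) = log|y| - u(y/|y|) on the cone {y_1 ≥ 0}, with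
coordinates centred at c E_{n+1}. The level sets of W are dilates of the evolving graph. Its
gradient q has degree -1, satisfies ⟨q, y⟩ = 1, and equals z - ∇u on the sphere, so |q| = v there.
The flow becomes W_t = -nc e^W (|q| - k q_1) + (c e^W + y_{n+1}) H - n q_{n+1}/|q|, where H is the
Euclidean mean curvature of the level set (`gaugeSpeed`), and the boundary condition becomes q_1 =
k|q|. The estimate is a maximum principle for the degree zero function (|y| + y_1) φ with φ = |q| -
k q_1, which is comparable to |q| because |k| < 1.

Confinement (`IsScalarFlow.norm_le_of_cap`, `capConst_le_of_norm_le`): a cap whose horizontal centre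
a shrinks like exp(-nct/R) formally solves the flow. Slightly larger caps with a smaller contact
angle are strict barriers, so the flow stays in the moving cap. This gives ρ ≤ 3R and x_{n+1} ≥ K_0.

Boundary maximum (`norm_coneGrad_le_of_boundary_max`): differentiating q_1 = k|q| along the boundary
shows that φ has zero derivative in a certain inward direction. The weight |y| + y_1 would increase
in that direction if |q| were large, so |q| is bounded.

Interior maximum (`exists_gauge_decay`): let A be the second fundamental form of the level set and ξ
= q/|q| - k E_1 the derivative of φ in q. Then φ_t is the ξ-derivative of the speed. Since W_ξ = φ,
the factor e^W contributes -nc e^W φ² + c e^W φ H, and the second order condition at the maximum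
turns the third derivatives into -|A|². The critical point equation makes one tangential direction
nearly flat, so H ≤ √(n-1)|A| + 4 (`levelCurv_le`). After multiplication by ρ the leading part is at
most -ncφ² + c√(n-1) φ|A| - K_0|A|². It is negative definite precisely when c(n-1) < 4nK_0, so φ_t <
0 once φ is large. -/

noncomputable section

namespace CapillaryFlow

/-! ### Traces and Hilbert–Schmidt estimates. -/

section Trace

variable {E ι : Type*} [NormedAddCommGroup E] [InnerProductSpace ℝ E] [Fintype ι]

/-- Compressing a bilinear form to `w^⊥` removes `D(w, w)` from its trace. -/
theorem sum_compress (e : OrthonormalBasis ι ℝ E) (D : E →L[ℝ] E →L[ℝ] ℝ) {w : E}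
    (hw : ‖w‖ = 1) :
    ∑ i, D (e i - inner ℝ w (e i) • w) (e i - inner ℝ w (e i) • w)
      = ∑ i, D (e i) (e i) - D w w := by
  have h1 : ∑ i, inner ℝ w (e i) * D w (e i) = D w w := by
    have : D w w = D w (∑ i, inner ℝ (e i) w • e i) := by rw [e.sum_repr' w]
    rw [this, map_sum]
    simp [real_inner_comm]
  have h2 : ∑ i, inner ℝ w (e i) * D (e i) w = D w w := by
    have : D w w = D (∑ i, inner ℝ (e i) w • e i) w := by rw [e.sum_repr' w]
    rw [this, map_sum]
    simp [real_inner_comm]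
  have h3 : ∑ i, inner ℝ w (e i) * inner ℝ w (e i) = (1 : ℝ) := by
    have := e.sum_inner_mul_inner w w
    rw [real_inner_self_eq_norm_sq, hw] at this
    rw [← one_pow 2, ← this]
    exact Finset.sum_congr rfl fun i _ => by rw [real_inner_comm w (e i)]
  have h4 : ∀ i, D (e i - inner ℝ w (e i) • w) (e i - inner ℝ w (e i) • w)
      = D (e i) (e i) - inner ℝ w (e i) * D w (e i) - inner ℝ w (e i) * D (e i) w
        + inner ℝ w (e i) * inner ℝ w (e i) * D w w := by
    intro i
    simp only [map_sub, map_smul, sub_apply, smul_apply, smul_eq_mul]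
    ring
  simp only [h4, Finset.sum_add_distrib, Finset.sum_sub_distrib, ← Finset.sum_mul, h1, h2, h3]
  ring

theorem sum_inner_mul (e : OrthonormalBasis ι ℝ E) (A : E →ₗ[ℝ] E) (x z : E) :
    ∑ i, inner ℝ x (e i) * inner ℝ (A (e i)) z = inner ℝ (A x) z := by
  have : A x = A (∑ i, inner ℝ (e i) x • e i) := by rw [e.sum_repr' x]
  rw [this, map_sum, sum_inner]
  exact Finset.sum_congr rfl fun i _ => by
    rw [map_smul, real_inner_smul_left, real_inner_comm]

theorem sum_inner_sq_eq (e : OrthonormalBasis ι ℝ E) (x : E) :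
    ∑ i, inner ℝ x (e i) ^ 2 = ‖x‖ ^ 2 := by
  have := e.sum_inner_mul_inner x x
  rw [real_inner_self_eq_norm_sq] at this
  rw [← this]
  exact Finset.sum_congr rfl fun i _ => by rw [real_inner_comm x (e i)]; ring

/-- Cauchy–Schwarz for the Hilbert–Schmidt product. The choice of `Q` yields the trace bound, the
trace over a subspace and the operator bound below. -/
theorem sum_inner_sq_le (e : OrthonormalBasis ι ℝ E) (A : E →ₗ[ℝ] E) (Q : ι → E) :
    (∑ i, inner ℝ (A (e i)) (Q i)) ^ 2 ≤ (∑ i, ‖A (e i)‖ ^ 2) * ∑ i, ‖Q i‖ ^ 2 := by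
  refine le_trans ?_ (Finset.sum_mul_sq_le_sq_mul_sq _ _ _)
  rw [← sq_abs]
  gcongr
  refine (Finset.abs_sum_le_sum_abs _ _).trans (Finset.sum_le_sum fun i _ => ?_)
  exact abs_real_inner_le_norm _ _

theorem sq_trace_le (e : OrthonormalBasis ι ℝ E) (A : E →ₗ[ℝ] E) :
    (∑ i, inner ℝ (A (e i)) (e i)) ^ 2 ≤ (∑ i, ‖A (e i)‖ ^ 2) * Fintype.card ι := by
  simpa using sum_inner_sq_le e A (fun i => e i)

/-- The trace over the complement of two orthonormal directions. -/
theorem sq_trace_sub_le (e : OrthonormalBasis ι ℝ E) (A : E →ₗ[ℝ] E) {w τ : E}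
    (hw : ‖w‖ = 1) (hτ : ‖τ‖ = 1) (hwτ : inner ℝ w τ = 0) :
    (∑ i, inner ℝ (A (e i)) (e i) - inner ℝ (A w) w - inner ℝ (A τ) τ) ^ 2
      ≤ (∑ i, ‖A (e i)‖ ^ 2) * (Fintype.card ι - 2) := by
  -- `Q` is the projection onto the complement of `w` and `τ`; its squared Hilbert–Schmidt norm is
  -- the dimension minus 2.
  have h := sum_inner_sq_le e A (fun i => e i - inner ℝ w (e i) • w - inner ℝ τ (e i) • τ)
  have h1 : ∀ i, inner ℝ (A (e i)) (e i - inner ℝ w (e i) • w - inner ℝ τ (e i) • τ)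
      = inner ℝ (A (e i)) (e i) - inner ℝ w (e i) * inner ℝ (A (e i)) w
        - inner ℝ τ (e i) * inner ℝ (A (e i)) τ := by
    intro i
    simp only [inner_sub_right, real_inner_smul_right]
  have h2 : ∀ i, ‖e i - inner ℝ w (e i) • w - inner ℝ τ (e i) • τ‖ ^ 2
      = 1 - inner ℝ w (e i) ^ 2 - inner ℝ τ (e i) ^ 2 := by
    intro i
    have hτw : inner ℝ τ w = (0 : ℝ) := by rw [real_inner_comm]; exact hwτ
    rw [← real_inner_self_eq_norm_sq]
    simp only [inner_sub_right, inner_sub_left, real_inner_smul_right, real_inner_smul_left,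
      real_inner_self_eq_norm_sq, norm_smul, hw, hτ, hwτ, hτw, e.norm_eq_one, mul_pow,
      Real.norm_eq_abs, sq_abs, real_inner_comm w (e i), real_inner_comm τ (e i)]
    ring
  simp only [h1, h2, Finset.sum_sub_distrib, sum_inner_mul, sum_inner_sq_eq, hw, hτ] at h
  refine h.trans_eq ?_
  simp
  left; ring

theorem norm_sq_apply_le (e : OrthonormalBasis ι ℝ E) (A : E →ₗ[ℝ] E) (x : E) :
    ‖A x‖ ^ 2 ≤ ‖x‖ ^ 2 * ∑ i, ‖A (e i)‖ ^ 2 := by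
  have h := sum_inner_sq_le e A (fun i => inner ℝ x (e i) • A x)
  simp only [real_inner_smul_right, sum_inner_mul, norm_smul, mul_pow, Real.norm_eq_abs, sq_abs,
    ← Finset.sum_mul, sum_inner_sq_eq, real_inner_self_eq_norm_sq] at h
  rcases eq_or_ne (A x) 0 with h0 | h0
  · rw [h0]; simp; positivity
  · have : 0 < ‖A x‖ ^ 2 := by positivity
    nlinarith

end Trace

/-- A negative definite quadratic form dominates affine perturbations for large arguments. -/
theorem exists_quadratic_threshold {p r K : ℝ} (hp : 0 < p) (hK : 0 < K) (h : r ^ 2 < 4 * p * K)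
    (D : ℝ) : ∃ Φ : ℝ, ∀ φ ≥ Φ, ∀ α : ℝ, 0 ≤ α →
      -p * φ ^ 2 + r * φ * α - K * α ^ 2 + D * (φ + α + 1) < 0 := by
  -- With this δ the linear terms in 4(p - δ)(K - δ) - r² cancel and leave 4δ² ≥ 0, so the form is
  -- at most -δ(φ² + α²).
  set δ := (4 * p * K - r ^ 2) / (4 * (p + K)) with hδ
  have hδ0 : 0 < δ := by rw [hδ]; apply div_pos <;> nlinarith
  have hδe : δ * (4 * (p + K)) = 4 * p * K - r ^ 2 := by rw [hδ]; field_simp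
  have key : ∀ φ α : ℝ, -p * φ ^ 2 + r * φ * α - K * α ^ 2 ≤ - δ * (φ ^ 2 + α ^ 2) := by
    intro φ α
    have hpd : 0 < p - δ := by
      rw [hδ, sub_pos, div_lt_iff₀ (by positivity)]; nlinarith [sq_nonneg r]
    have h1 : 0 ≤ 4 * (p - δ) * (K - δ) - r ^ 2 := by nlinarith
    have h2 : 0 ≤ 4 * (p - δ) * ((p - δ) * φ ^ 2 - r * φ * α + (K - δ) * α ^ 2) := by
      nlinarith [sq_nonneg (2 * (p - δ) * φ - r * α), mul_nonneg h1 (sq_nonneg α)]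
    nlinarith
  refine ⟨1 + (2 * |D| + |D| ^ 2 / δ) / δ, fun φ hφ α hα => ?_⟩
  have hD : D * (φ + α + 1) ≤ |D| * (2 * φ + α) := by
    have hφ1 : 1 ≤ φ := by
      have : 0 ≤ (2 * |D| + |D| ^ 2 / δ) / δ := by positivity
      linarith
    have := le_abs_self D
    have h0 := abs_nonneg D
    nlinarith
  have hφ1 : (2 * |D| + |D| ^ 2 / δ) < δ * φ := by
    have : (2 * |D| + |D| ^ 2 / δ) / δ < φ := by linarith
    rw [div_lt_iff₀ hδ0] at this; linarith
  have hφ2 : 1 ≤ φ := by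
    have : 0 ≤ (2 * |D| + |D| ^ 2 / δ) / δ := by positivity
    linarith
  have h4 : |D| * α ≤ δ * α ^ 2 + |D| ^ 2 / δ := by
    have : |D| ^ 2 / δ * δ = |D| ^ 2 := by field_simp
    have h5 : 0 ≤ |D| ^ 2 / δ := by positivity
    nlinarith [sq_nonneg (δ * α - |D|), mul_nonneg hδ0.le (abs_nonneg D), mul_nonneg (abs_nonneg D) hα,
      mul_pos hδ0 hδ0]
  have h5 : 0 ≤ |D| ^ 2 / δ := by positivity
  nlinarith [key φ α, mul_lt_mul_of_pos_right hφ1 (by linarith : 0 < φ)]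

/-! ### The capillary gauge and the second fundamental form of level sets. -/

variable {n : ℕ}

/-- The capillary gauge `|q| - k q_1` of a covector. -/
def aniso (k : ℝ) (q : Space n) : ℝ := ‖q‖ - k * q 0

/-- The derivative `q / |q| - k E_1` of the capillary gauge. -/
def anisoGrad (k : ℝ) (q : Space n) : Space n := ‖q‖⁻¹ • q - k • eFirst n

/-- The orthogonal projection onto the complement of the direction `w`. -/
def perp (w X : Space n) : Space n := X - inner ℝ w X • w

/-- The mean curvature of a level set of a function with gradient `q` and Hessian `b`. -/
def levelCurv (q : Space n) (b : Space n →L[ℝ] Space n →L[ℝ] ℝ) : ℝ :=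
  ‖q‖⁻¹ * (∑ i : Fin (n + 1), b (EuclideanSpace.single i 1) (EuclideanSpace.single i 1)
    - b q q / ‖q‖ ^ 2)

/-- The time derivative of `log |y| - u`, expressed by its value `r`, gradient `q`, Hessian `b`. -/
def gaugeSpeed (c k : ℝ) (y : Space n) (r : ℝ) (q : Space n)
    (b : Space n →L[ℝ] Space n →L[ℝ] ℝ) : ℝ :=
  -(n * c * Real.exp r * aniso k q) + (c * Real.exp r + y (Fin.last n)) * levelCurv q b
    - n * (q (Fin.last n) / ‖q‖)

theorem inner_eFirst (X : Space n) : inner ℝ (eFirst n) X = X 0 := by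
  simp [eFirst, EuclideanSpace.inner_single_left]

theorem inner_eLast (X : Space n) : inner ℝ (eLast n) X = X (Fin.last n) := by
  simp [eLast, EuclideanSpace.inner_single_left]

theorem norm_eFirst : ‖eFirst n‖ = 1 := by simp [eFirst]

theorem norm_eLast : ‖eLast n‖ = 1 := by simp [eLast]

theorem abs_apply_le_norm (X : Space n) (i : Fin (n + 1)) : |X i| ≤ ‖X‖ := by
  simpa using PiLp.norm_apply_le X i

theorem norm_smul_inv_self {q : Space n} (hq : q ≠ 0) : ‖‖q‖⁻¹ • q‖ = 1 := by
  rw [norm_smul, norm_inv, norm_norm, inv_mul_cancel₀ (norm_ne_zero_iff.2 hq)]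

theorem inner_anisoGrad (k : ℝ) (q X : Space n) :
    inner ℝ (anisoGrad k q) X = ‖q‖⁻¹ * inner ℝ q X - k * X 0 := by
  rw [anisoGrad, inner_sub_left, real_inner_smul_left, real_inner_smul_left, inner_eFirst]

theorem inner_anisoGrad_self (k : ℝ) {q : Space n} (hq : q ≠ 0) :
    inner ℝ (anisoGrad k q) q = aniso k q := by
  have := norm_ne_zero_iff.2 hq
  rw [inner_anisoGrad, aniso, real_inner_self_eq_norm_sq]
  field_simp

theorem norm_anisoGrad_le {k : ℝ} (hk : |k| ≤ 1) (q : Space n) : ‖anisoGrad k q‖ ≤ 2 := by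
  have h1 : ‖‖q‖⁻¹ • q‖ ≤ 1 := by
    rw [norm_smul, norm_inv, norm_norm]
    exact inv_mul_le_one
  have h2 : ‖k • eFirst n‖ ≤ 1 := by rwa [norm_smul, norm_eFirst, mul_one]
  exact (norm_sub_le _ _).trans (by linarith)

theorem aniso_ge (k : ℝ) (q : Space n) : (1 - |k|) * ‖q‖ ≤ aniso k q := by
  have h := abs_apply_le_norm q 0
  have h1 : k * q 0 ≤ |k| * ‖q‖ := (le_abs_self _).trans (by rw [abs_mul]; gcongr)
  rw [aniso]; linarith

theorem aniso_le {k : ℝ} (hk : |k| ≤ 1) (q : Space n) : aniso k q ≤ 2 * ‖q‖ := by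
  have h := abs_apply_le_norm q 0
  have h1 : |k * q 0| ≤ 1 * ‖q‖ := by rw [abs_mul]; gcongr
  rw [aniso]; linarith [neg_abs_le (k * q 0)]

theorem inner_perp_self {w : Space n} (hw : ‖w‖ = 1) (X : Space n) : inner ℝ w (perp w X) = 0 := by
  rw [perp, inner_sub_right, real_inner_smul_right, real_inner_self_eq_norm_sq, hw]; ring

theorem inner_perp_comm (w X Y : Space n) : inner ℝ (perp w X) Y = inner ℝ X (perp w Y) := by
  simp only [perp, inner_sub_right, inner_sub_left, real_inner_smul_right, real_inner_smul_left]
  rw [real_inner_comm w X]; ring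

theorem norm_perp_le {w : Space n} (hw : ‖w‖ = 1) (X : Space n) : ‖perp w X‖ ≤ ‖X‖ := by
  have h : ‖perp w X‖ ^ 2 = inner ℝ (perp w X) X := by
    rw [← real_inner_self_eq_norm_sq, ← inner_perp_comm]
    congr 1
    conv_lhs => rw [perp, inner_perp_self hw, zero_smul, sub_zero]
  have h2 := real_inner_le_norm (perp w X) X
  rcases (norm_nonneg (perp w X)).eq_or_lt with h0 | h0
  · rw [← h0]; positivity
  · nlinarith

theorem perp_eq_self {w X : Space n} (h : inner ℝ w X = 0) : perp w X = X := by simp [perp, h]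

theorem sum_perp (D : Space n →L[ℝ] Space n →L[ℝ] ℝ) {w : Space n} (hw : ‖w‖ = 1) :
    ∑ i : Fin (n + 1), D (perp w (EuclideanSpace.single i 1)) (perp w (EuclideanSpace.single i 1))
      = ∑ i : Fin (n + 1), D (EuclideanSpace.single i 1) (EuclideanSpace.single i 1) - D w w := by
  simpa [perp] using sum_compress (EuclideanSpace.basisFun (Fin (n + 1)) ℝ) D hw

/-- The curvature sees only the tangential block of the Hessian; this form is the one compatible
with second order conditions in tangential directions. -/
theorem levelCurv_eq_sum_perp {q : Space n} (hq : q ≠ 0)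
    (b : Space n →L[ℝ] Space n →L[ℝ] ℝ) :
    levelCurv q b = ‖q‖⁻¹ * ∑ i : Fin (n + 1),
      b (perp (‖q‖⁻¹ • q) (EuclideanSpace.single i 1))
        (perp (‖q‖⁻¹ • q) (EuclideanSpace.single i 1)) := by
  rw [sum_perp b (norm_smul_inv_self hq), levelCurv]
  simp only [map_smul, smul_apply, smul_eq_mul]
  congr 2
  field_simp

theorem sum_norm_sq_perp {w : Space n} (hw : ‖w‖ = 1) :
    ∑ i : Fin (n + 1), ‖perp w (EuclideanSpace.single i 1)‖ ^ 2 = n := by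
  have : ∑ i : Fin (n + 1), inner ℝ (perp w (EuclideanSpace.single i 1))
      (perp w (EuclideanSpace.single i 1)) = ∑ i : Fin (n + 1),
        inner ℝ (EuclideanSpace.single i 1 : Space n) (EuclideanSpace.single i 1) - inner ℝ w w :=
    sum_perp (innerSL ℝ) hw
  simp only [real_inner_self_eq_norm_sq, hw] at this
  rw [this]; simp

/-- The shape operator of a level set of a function with gradient `q` and Hessian `B`. -/
def shapeOp (q : Space n) (B : Space n →L[ℝ] Space n) : Space n →ₗ[ℝ] Space n where
  toFun X := ‖q‖⁻¹ • perp (‖q‖⁻¹ • q) (B (perp (‖q‖⁻¹ • q) X))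
  map_add' X Y := by
    simp only [perp, inner_add_right, map_add, map_sub, map_smul, inner_sub_right,
      real_inner_smul_right]; module
  map_smul' a X := by
    simp only [perp, RingHom.id_apply, map_sub, map_smul, inner_sub_right,
      real_inner_smul_right]; module

/-- The norm of the second fundamental form. -/
def shapeNorm (q : Space n) (B : Space n →L[ℝ] Space n) : ℝ :=
  Real.sqrt (∑ i : Fin (n + 1), ‖shapeOp q B (EuclideanSpace.single i 1)‖ ^ 2)

theorem shapeNorm_sq (q : Space n) (B : Space n →L[ℝ] Space n) :
    shapeNorm q B ^ 2 = ∑ i : Fin (n + 1), ‖shapeOp q B (EuclideanSpace.single i 1)‖ ^ 2 :=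
  Real.sq_sqrt (by positivity)

theorem shapeNorm_nonneg (q : Space n) (B : Space n →L[ℝ] Space n) : 0 ≤ shapeNorm q B :=
  Real.sqrt_nonneg _

theorem norm_shapeOp_le (q : Space n) (B : Space n →L[ℝ] Space n) (X : Space n) :
    ‖shapeOp q B X‖ ≤ ‖X‖ * shapeNorm q B := by
  have h := norm_sq_apply_le (EuclideanSpace.basisFun (Fin (n + 1)) ℝ) (shapeOp q B) X
  simp only [EuclideanSpace.basisFun_apply, ← shapeNorm_sq, ← mul_pow] at h
  exact le_of_sq_le_sq h (mul_nonneg (norm_nonneg _) (shapeNorm_nonneg q B))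
where
  le_of_sq_le_sq {a b : ℝ} (h : a ^ 2 ≤ b ^ 2) (hb : 0 ≤ b) : a ≤ b := by
    nlinarith [abs_le_of_sq_le_sq h hb, le_abs_self a]

theorem levelCurv_eq_trace {q : Space n} (hq : q ≠ 0) {b : Space n →L[ℝ] Space n →L[ℝ] ℝ}
    {B : Space n →L[ℝ] Space n} (hb : ∀ X Y, b X Y = inner ℝ (B X) Y) :
    levelCurv q b = ∑ i : Fin (n + 1),
      inner ℝ (shapeOp q B (EuclideanSpace.single i 1)) (EuclideanSpace.single i 1) := by
  rw [levelCurv_eq_sum_perp hq, Finset.mul_sum]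
  refine Finset.sum_congr rfl fun i _ => ?_
  rw [hb, shapeOp, LinearMap.coe_mk, AddHom.coe_mk, real_inner_smul_left, inner_perp_comm]

theorem abs_levelCurv_le {q : Space n} (hq : q ≠ 0) {b : Space n →L[ℝ] Space n →L[ℝ] ℝ}
    {B : Space n →L[ℝ] Space n} (hb : ∀ X Y, b X Y = inner ℝ (B X) Y) :
    |levelCurv q b| ≤ Real.sqrt (n + 1) * shapeNorm q B := by
  have h := sq_trace_le (EuclideanSpace.basisFun (Fin (n + 1)) ℝ) (shapeOp q B)
  simp only [EuclideanSpace.basisFun_apply, ← shapeNorm_sq, ← levelCurv_eq_trace hq hb] at h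
  apply abs_le_of_sq_le_sq
  · rw [mul_pow, Real.sq_sqrt (by positivity)]
    simpa [mul_comm] using h
  · exact mul_nonneg (Real.sqrt_nonneg _) (shapeNorm_nonneg q B)

/-- At a critical point of the weighted gauge, one tangential direction is almost a null direction
of the second fundamental form, so that the mean curvature is controlled by `√(n - 1) |A|`. -/
theorem levelCurv_le (hn : 1 ≤ n) {y q s : Space n} {k : ℝ} {b : Space n →L[ℝ] Space n →L[ℝ] ℝ}
    {B : Space n →L[ℝ] Space n} (hb : ∀ X Y, b X Y = inner ℝ (B X) Y) (hy : ‖y‖ = 1)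
    (hqy : inner ℝ q y = 1) (hBy : B y = -q) (hk : |k| ≤ 1)
    (hBξ : B (anisoGrad k q) = -aniso k q • s) (hs : ‖s‖ ≤ 2) (hφ : 4 ≤ aniso k q) :
    levelCurv q b ≤ Real.sqrt (n - 1) * shapeNorm q B + 4 := by
  have hq : q ≠ 0 := by rintro rfl; simp at hqy
  have hq1 : 1 ≤ ‖q‖ := by
    have := real_inner_le_norm q y
    rwa [hqy, hy, mul_one] at this
  set w := ‖q‖⁻¹ • q with hw
  have hw1 : ‖w‖ = 1 := norm_smul_inv_self hq
  set φ := aniso k q with hφd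
  have hφ0 : 0 < φ := by linarith
  -- Both `y` and ξ/φ pair to 1 with `q`, so τ is tangent to the level set. Homogeneity and
  -- criticality give Bτ = s - q, whose tangential part is that of the bounded vector `s`. The bound
  -- φ ≥ 4 keeps |τ| ≥ 1/2.
  set τ := y - φ⁻¹ • anisoGrad k q with hτ
  have hqτ : inner ℝ q τ = 0 := by
    rw [hτ, inner_sub_right, real_inner_smul_right, hqy, real_inner_comm, inner_anisoGrad_self k hq,
      ← hφd, inv_mul_cancel₀ hφ0.ne', sub_self]
  have hwτ : inner ℝ w τ = 0 := by rw [hw, real_inner_smul_left, hqτ, mul_zero]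
  have hτn : 1 / 2 ≤ ‖τ‖ := by
    have h1 := norm_sub_norm_le y (φ⁻¹ • anisoGrad k q)
    rw [hy, norm_smul, norm_inv, Real.norm_of_nonneg hφ0.le, ← hτ] at h1
    have h2 : φ⁻¹ * ‖anisoGrad k q‖ ≤ 4⁻¹ * 2 := by
      gcongr
      exact norm_anisoGrad_le hk q
    linarith
  have hτ0 : 0 < ‖τ‖ := by linarith
  have hBτ : B τ = s - q := by
    rw [hτ, map_sub, map_smul, hBy, hBξ, neg_smul, smul_neg, inv_smul_smul₀ hφ0.ne']
    abel
  have hAτ : inner ℝ (shapeOp q B τ) τ = ‖q‖⁻¹ * inner ℝ s τ := by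
    rw [shapeOp, LinearMap.coe_mk, AddHom.coe_mk, real_inner_smul_left, inner_perp_comm, ← hw,
      perp_eq_self hwτ, hBτ, inner_sub_left, hqτ, sub_zero]
  have hAw : inner ℝ (shapeOp q B w) w = 0 := by
    rw [shapeOp, LinearMap.coe_mk, AddHom.coe_mk, real_inner_smul_left, ← hw, real_inner_comm,
      inner_perp_self hw1, mul_zero]
  set σ := ‖τ‖⁻¹ • τ with hσ
  have hσ1 : ‖σ‖ = 1 := norm_smul_inv_self (norm_pos_iff.1 hτ0)
  have hwσ : inner ℝ w σ = 0 := by rw [hσ, real_inner_smul_right, hwτ, mul_zero]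
  have hAσ : inner ℝ (shapeOp q B σ) σ ≤ 4 := by
    rw [hσ, map_smul, real_inner_smul_left, real_inner_smul_right, hAτ]
    have h1 : inner ℝ s τ ≤ 2 * ‖τ‖ := (real_inner_le_norm s τ).trans (by gcongr)
    have h2 : ‖q‖⁻¹ ≤ 1 := inv_le_one_of_one_le₀ hq1
    calc ‖τ‖⁻¹ * (‖τ‖⁻¹ * (‖q‖⁻¹ * inner ℝ s τ)) ≤ ‖τ‖⁻¹ * (‖τ‖⁻¹ * (‖q‖⁻¹ * (2 * ‖τ‖))) := by
          gcongr
      _ = 2 * (‖q‖⁻¹ * ‖τ‖⁻¹) := by field_simp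
      _ ≤ 2 * (1 * 2) := by
          gcongr
          rw [inv_le_comm₀ hτ0 (by norm_num)]; linarith
      _ = 4 := by norm_num
  -- Removing the normal and the nearly flat direction leaves a trace over n - 1 dimensions.
  have h := sq_trace_sub_le (EuclideanSpace.basisFun (Fin (n + 1)) ℝ) (shapeOp q B) hw1 hσ1 hwσ
  simp only [EuclideanSpace.basisFun_apply, ← shapeNorm_sq, ← levelCurv_eq_trace hq hb, hAw,
    Fintype.card_fin] at h
  have hn' : (1 : ℝ) ≤ n := by exact_mod_cast hn
  have h2 : levelCurv q b - 0 - inner ℝ (shapeOp q B σ) σ ≤ Real.sqrt (n - 1) * shapeNorm q B := by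
    refine (le_abs_self _).trans (abs_le_of_sq_le_sq ?_
      (mul_nonneg (Real.sqrt_nonneg _) (shapeNorm_nonneg q B)))
    rw [mul_pow, Real.sq_sqrt (by linarith)]
    refine h.trans_eq ?_
    push_cast; ring
  linarith

/-- The part of the derivative of the mean curvature, in the direction `anisoGrad k q`, that comes
from the change of the normal. -/
theorem normal_variation_le {q s : Space n} {k : ℝ} {b : Space n →L[ℝ] Space n →L[ℝ] ℝ}
    {B : Space n →L[ℝ] Space n} (hb : ∀ X Y, b X Y = inner ℝ (B X) Y)
    (hsymm : ∀ X Y, b X Y = b Y X) (hq : q ≠ 0) (hk : |k| < 1)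
    (hBξ : B (anisoGrad k q) = -aniso k q • s) (hs : ‖s‖ ≤ 2) :
    -(‖q‖⁻¹ * inner ℝ (‖q‖⁻¹ • q) (B (anisoGrad k q)) * levelCurv q b)
      - 2 * ‖q‖⁻¹ ^ 2 * (b (B (anisoGrad k q)) (‖q‖⁻¹ • q)
        - inner ℝ (‖q‖⁻¹ • q) (B (anisoGrad k q)) * b (‖q‖⁻¹ • q) (‖q‖⁻¹ • q))
      ≤ 4 * |levelCurv q b| + 8 * shapeNorm q B := by
  have hv : 0 < ‖q‖ := norm_pos_iff.2 hq
  set w := ‖q‖⁻¹ • q with hw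
  have hw1 : ‖w‖ = 1 := norm_smul_inv_self hq
  have hqw : q = ‖q‖ • w := by rw [hw, smul_inv_smul₀ hv.ne']
  set φ := aniso k q with hφd
  set m := ‖q‖⁻¹ * φ with hm
  have hm0 : 0 ≤ m := mul_nonneg (by positivity)
    (le_trans (by have := norm_nonneg q; nlinarith) (aniso_ge k q))
  have hm2 : m ≤ 2 := by
    rw [hm, inv_mul_le_iff₀ hv]; linarith [aniso_le hk.le q]
  set ξ := anisoGrad k q with hξ
  have hξw : inner ℝ w ξ = m := by
    rw [hw, real_inner_smul_left, real_inner_comm, inner_anisoGrad_self k hq]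
  have hA : perp w (B (perp w ξ)) = ‖q‖ • shapeOp q B ξ := by
    rw [shapeOp, LinearMap.coe_mk, AddHom.coe_mk, ← hw, smul_inv_smul₀ hv.ne']
  have hξd : ξ = m • w + perp w ξ := by rw [perp, hξw]; abel
  -- The mixed part of `B w` is not controlled by the second fundamental form alone. Splitting ξ = m
  -- w + ξ^⊥ in Bξ = -φ s expresses it through the shape operator, plus a term of favourable sign.
  have hBw : m * (inner ℝ (B w) (perp w s)) =
      -φ * ‖perp w s‖ ^ 2 - ‖q‖ * inner ℝ (shapeOp q B ξ) s := by
    have h1 : m • B w = -φ • s - B (perp w ξ) := by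
      rw [← hBξ, ← map_smul, ← map_sub]; congr 1
      rw [perp, hξw]; abel
    rw [← real_inner_smul_left, h1, inner_sub_left, real_inner_smul_left, ← inner_perp_comm,
      ← inner_perp_comm, hA, real_inner_smul_left, ← real_inner_self_eq_norm_sq, inner_perp_comm,
      inner_perp_comm]
    congr 3
    rw [perp_eq_self (inner_perp_self hw1 s)]
  have hmain : b (B ξ) w - inner ℝ w (B ξ) * b w w = -φ * inner ℝ (B w) (perp w s) := by
    rw [hsymm (B ξ) w, hb, hb, hBξ]
    simp only [perp, real_inner_smul_right, inner_sub_right]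
    ring
  have e1 : inner ℝ w (B ξ) = -φ * inner ℝ w s := by rw [hBξ, real_inner_smul_right]
  rw [hmain, e1]
  have e2 : -(‖q‖⁻¹ * (-φ * inner ℝ w s) * levelCurv q b)
      - 2 * ‖q‖⁻¹ ^ 2 * (-φ * inner ℝ (B w) (perp w s))
      = m * inner ℝ w s * levelCurv q b + 2 * ‖q‖⁻¹ * (m * inner ℝ (B w) (perp w s)) := by
    rw [hm]; field_simp; ring
  rw [e2, hBw]
  have e3 : 2 * ‖q‖⁻¹ * (-φ * ‖perp w s‖ ^ 2 - ‖q‖ * inner ℝ (shapeOp q B ξ) s)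
      = -(2 * m * ‖perp w s‖ ^ 2) - 2 * inner ℝ (shapeOp q B ξ) s := by
    rw [hm]; field_simp
  rw [e3]
  have e4 : |inner ℝ w s| ≤ 2 := by
    refine (abs_real_inner_le_norm w s).trans ?_
    rw [hw1, one_mul]; exact hs
  have e5 : m * inner ℝ w s * levelCurv q b ≤ 2 * 2 * |levelCurv q b| := by
    refine (le_abs_self _).trans ?_
    rw [abs_mul, abs_mul, abs_of_nonneg hm0]
    gcongr
  have e6 : |inner ℝ (shapeOp q B ξ) s| ≤ 2 * shapeNorm q B * 2 := by
    refine (abs_real_inner_le_norm _ _).trans ?_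
    gcongr
    · exact mul_nonneg zero_le_two (shapeNorm_nonneg q B)
    · refine (norm_shapeOp_le q B ξ).trans ?_
      gcongr
      · exact shapeNorm_nonneg q B
      · exact norm_anisoGrad_le hk.le q
  have e7 : 0 ≤ 2 * m * ‖perp w s‖ ^ 2 := by positivity
  linarith [neg_abs_le (inner ℝ (shapeOp q B ξ) s)]

/-- Threshold for the capillary gauge beyond which the evolution equation forces decay. -/
theorem exists_decay_threshold (hn : 1 ≤ n) {c K : ℝ} (hc : 0 < c) (hK : 0 < K)
    (hcK : c * ((n : ℝ) - 1) < 4 * n * K) (ρm hm : ℝ) :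
    ∃ Φ : ℝ, ∀ φ ≥ Φ, ∀ α ρ h H DH x₁ x₂ x₃ : ℝ, 0 ≤ α → 0 < ρ → ρ ≤ ρm → K ≤ h → h ≤ hm →
      H ≤ Real.sqrt (n - 1) * α + 4 → |H| ≤ Real.sqrt (n + 1) * α →
      DH ≤ 16 * n - α ^ 2 + 4 * |H| + 8 * α → |x₁| ≤ 4 * φ → |x₂| ≤ 2 → |x₃| ≤ 4 →
      -(n * c * ρ⁻¹ * φ ^ 2) - n * c * ρ⁻¹ * x₁ + (c * ρ⁻¹ * φ + x₂) * H + ρ⁻¹ * h * DH - n * x₃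
        < 0 := by
  have hn' : (1 : ℝ) ≤ n := by exact_mod_cast hn
  -- The discriminant condition of the leading form; it is equivalent to c(n - 1) < 4nK because c >
  -- 0.
  have hr : (c * Real.sqrt (n - 1)) ^ 2 < 4 * (n * c) * K := by
    rw [mul_pow, Real.sq_sqrt (by linarith)]; nlinarith
  set g := Real.sqrt (n + 1) with hg
  have hg0 : 0 ≤ g := Real.sqrt_nonneg _
  -- The last argument collects the coefficients of all terms that are at most affine in φ and α,
  -- after multiplication by ρ.
  obtain ⟨Φ, hΦ⟩ := exists_quadratic_threshold (p := n * c) (by positivity) hK hr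
    (4 * n * c + 4 * c + 2 * ρm * g + hm * (16 * n + 4 * g + 8) + 4 * n * ρm)
  refine ⟨max Φ 0, fun φ hφ α ρ h H DH x₁ x₂ x₃ hα hρ hρm hKh hhm hH hHa hDH hx₁ hx₂ hx₃ => ?_⟩
  have hφ0 : 0 ≤ φ := (le_max_right _ _).trans hφ
  have key := hΦ φ ((le_max_left _ _).trans hφ) α hα
  have hh0 : 0 < h := by linarith
  have t1 : -(n * c * x₁) ≤ n * c * (4 * φ) := by
    have := neg_abs_le x₁
    have : 0 ≤ n * c := by positivity
    nlinarith
  have t2 : c * φ * H ≤ c * φ * (Real.sqrt (n - 1) * α + 4) := by gcongr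
  have t3 : ρ * (x₂ * H) ≤ ρm * (2 * (g * α)) := by
    have : x₂ * H ≤ 2 * (g * α) := by
      refine (le_abs_self _).trans ?_
      rw [abs_mul]; gcongr
    calc ρ * (x₂ * H) ≤ ρ * (2 * (g * α)) := by gcongr
      _ ≤ _ := by gcongr
  have t4 : h * DH ≤ -(K * α ^ 2) + hm * (16 * n + 4 * (g * α) + 8 * α) := by
    calc h * DH ≤ h * (16 * n - α ^ 2 + 4 * (g * α) + 8 * α) := by gcongr; linarith
      _ = h * (16 * n + 4 * (g * α) + 8 * α) - h * α ^ 2 := by ring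
      _ ≤ hm * (16 * n + 4 * (g * α) + 8 * α) - K * α ^ 2 := by gcongr
      _ = _ := by ring
  have t5 : -(ρ * (n * x₃)) ≤ ρm * (n * 4) := by
    have h1 : -(n * x₃) ≤ n * 4 := by
      have := neg_abs_le x₃
      nlinarith
    calc -(ρ * (n * x₃)) = ρ * (-(n * x₃)) := by ring
      _ ≤ ρ * (n * 4) := by gcongr
      _ ≤ _ := by gcongr
  have hρm0 : 0 < ρm := by linarith
  have hhm0 : 0 < hm := by linarith
  have e : -(n * c * ρ⁻¹ * φ ^ 2) - n * c * ρ⁻¹ * x₁ + (c * ρ⁻¹ * φ + x₂) * H + ρ⁻¹ * h * DH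
      - n * x₃ = ρ⁻¹ * (-(n * c) * φ ^ 2 - n * c * x₁ + c * φ * H + ρ * (x₂ * H) + h * DH
        - ρ * (n * x₃)) := by field_simp; ring
  rw [e]
  apply mul_neg_of_pos_of_neg (by positivity)
  have p1 : 0 ≤ 4 * n * c * α := by positivity
  have p2 : 0 ≤ 4 * c * α := by positivity
  have p3 : 0 ≤ 2 * ρm * g * (φ + 1) := by positivity
  have p4 : 0 ≤ hm * (16 * n) * (φ + α) := by positivity
  have p5 : 0 ≤ hm * (4 * g + 8) * (φ + 1) := by positivity
  have p6 : 0 ≤ 4 * n * ρm * (φ + α) := by positivity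
  have p7 : 0 ≤ 4 * n * c + 4 * c := by positivity
  nlinarith

/-! ### Variation formulas and the conditions at an interior maximum. -/

open Filter Topology

/-- The second derivative test at a local maximum. -/
theorem second_deriv_nonpos_of_isLocalMax {g g₁ : ℝ → ℝ} {g₂ x : ℝ} (hmax : IsLocalMax g x)
    (h₁ : ∀ᶠ s in 𝓝 x, HasDerivAt g (g₁ s) s) (h₂ : HasDerivAt g₁ g₂ x) : g₂ ≤ 0 := by
  by_contra! hpos
  have e1 : deriv g =ᶠ[𝓝 x] g₁ := h₁.mono fun s hs => hs.deriv
  have e2 : deriv (deriv g) x = g₂ := by rw [e1.deriv_eq, h₂.deriv]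
  -- A positive second derivative would make x a local minimum as well, hence g locally constant,
  -- which contradicts positivity.
  have hmin : IsLocalMin g x := isLocalMin_of_deriv_deriv_pos (by rw [e2]; exact hpos)
    hmax.deriv_eq_zero h₁.self_of_nhds.continuousAt
  have hconst : g =ᶠ[𝓝 x] fun _ => g x := by
    filter_upwards [hmin, hmax] with s h3 h4 using le_antisymm h4 h3
  have e3 : deriv g =ᶠ[𝓝 x] fun _ => 0 := by
    simpa using hconst.deriv
  rw [e3.deriv_eq, deriv_const] at e2
  exact hpos.ne e2

theorem hasDerivAt_norm {q : ℝ → Space n} {q' : Space n} {s : ℝ} (h : HasDerivAt q q' s)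
    (h0 : q s ≠ 0) : HasDerivAt (fun s => ‖q s‖) (‖q s‖⁻¹ * inner ℝ (q s) q') s := by
  have h1 := h.norm_sq.sqrt (by simpa using h0)
  simp only [Real.sqrt_sq (norm_nonneg _)] at h1
  refine h1.congr_deriv ?_
  field_simp

theorem hasDerivAt_normalize {q : ℝ → Space n} {q' : Space n} {s : ℝ} (h : HasDerivAt q q' s)
    (h0 : q s ≠ 0) :
    HasDerivAt (fun s => ‖q s‖⁻¹ • q s) (‖q s‖⁻¹ • perp (‖q s‖⁻¹ • q s) q') s := by
  have h1 := ((hasDerivAt_norm h h0).inv (norm_ne_zero_iff.2 h0)).smul h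
  refine h1.congr_deriv ?_
  rw [perp, smul_sub, real_inner_smul_left, Pi.inv_apply, smul_smul, smul_smul, sub_eq_add_neg,
    ← neg_smul]
  congr 2
  field_simp

theorem hasDerivAt_aniso (k : ℝ) {q : ℝ → Space n} {q' : Space n} {s : ℝ} (h : HasDerivAt q q' s)
    (h0 : q s ≠ 0) :
    HasDerivAt (fun s => aniso k (q s)) (inner ℝ (anisoGrad k (q s)) q') s := by
  have h1 : HasDerivAt (fun s => q s 0) (q' 0) s := by
    have := (hasDerivAt_const s (eFirst n)).inner ℝ h
    simpa [inner_eFirst] using this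
  rw [inner_anisoGrad]
  exact (hasDerivAt_norm h h0).sub (h1.const_mul k)

theorem hasDerivAt_anisoGrad (k : ℝ) {q : ℝ → Space n} {q' : Space n} {s : ℝ}
    (h : HasDerivAt q q' s) (h0 : q s ≠ 0) :
    HasDerivAt (fun s => anisoGrad k (q s)) (‖q s‖⁻¹ • perp (‖q s‖⁻¹ • q s) q') s :=
  (hasDerivAt_normalize h h0).sub_const _

/-- The bilinear form `(X, Y) ↦ ⟨B X, Y⟩`. -/
def opForm (B : Space n →L[ℝ] Space n) : Space n →L[ℝ] Space n →L[ℝ] ℝ :=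
  ((innerSL ℝ : Space n →L[ℝ] Space n →L[ℝ] ℝ)).comp B

theorem opForm_apply (B : Space n →L[ℝ] Space n) (X Y : Space n) :
    opForm B X Y = inner ℝ (B X) Y := rfl

theorem hasDerivAt_opForm {B : ℝ → Space n →L[ℝ] Space n} {B' : Space n →L[ℝ] Space n} {s : ℝ}
    (h : HasDerivAt B B' s) : HasDerivAt (fun s => opForm (B s)) (opForm B') s := by
  have h1 := (hasDerivAt_const s (innerSL ℝ : Space n →L[ℝ] Space n →L[ℝ] ℝ)).clm_comp h
  refine h1.congr_deriv ?_
  rw [ContinuousLinearMap.zero_comp, zero_add]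
  rfl

/-- The derivative is split into the tangential trace of the varied Hessian, estimated by
`third_deriv_trace_le`, and the contribution of the turning normal, estimated by
`normal_variation_le`. Symmetry of `b s` merges the two cross terms. -/
theorem hasDerivAt_levelCurv {q : ℝ → Space n} {q' : Space n}
    {b : ℝ → Space n →L[ℝ] Space n →L[ℝ] ℝ} {b' : Space n →L[ℝ] Space n →L[ℝ] ℝ} {s : ℝ}
    (hq : HasDerivAt q q' s) (hb : HasDerivAt b b' s) (h0 : q s ≠ 0)
    (hsymm : ∀ X Y, b s X Y = b s Y X) :
    HasDerivAt (fun s => levelCurv (q s) (b s))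
      (‖q s‖⁻¹ * ∑ i : Fin (n + 1), b' (perp (‖q s‖⁻¹ • q s) (EuclideanSpace.single i 1))
          (perp (‖q s‖⁻¹ • q s) (EuclideanSpace.single i 1))
        + (-(‖q s‖⁻¹ * inner ℝ (‖q s‖⁻¹ • q s) q' * levelCurv (q s) (b s))
        - 2 * ‖q s‖⁻¹ ^ 2 * (b s q' (‖q s‖⁻¹ • q s)
          - inner ℝ (‖q s‖⁻¹ • q s) q' * b s (‖q s‖⁻¹ • q s) (‖q s‖⁻¹ • q s)))) s := by
  have hv : ‖q s‖ ≠ 0 := norm_ne_zero_iff.2 h0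
  have h1 : HasDerivAt (fun s => ∑ i : Fin (n + 1),
      b s (EuclideanSpace.single i 1) (EuclideanSpace.single i 1))
      (∑ i : Fin (n + 1), b' (EuclideanSpace.single i 1) (EuclideanSpace.single i 1)) s := by
    refine HasDerivAt.fun_sum fun i _ => ?_
    have := (hb.clm_apply (hasDerivAt_const s (EuclideanSpace.single i 1 : Space n))).clm_apply
      (hasDerivAt_const s (EuclideanSpace.single i 1 : Space n))
    simpa using this
  have h2 : HasDerivAt (fun s => b s (q s) (q s)) (b' (q s) (q s) + 2 * b s q' (q s)) s := by
    have := (hb.clm_apply hq).clm_apply hq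
    refine this.congr_deriv ?_
    rw [add_apply, hsymm (q s) q']; ring
  have hn := hasDerivAt_norm hq h0
  have h3 := (hn.inv hv).mul (h1.sub (h2.div (hn.pow 2) (pow_ne_zero 2 hv)))
  refine (h3.congr_deriv ?_).congr_of_eventuallyEq (Eventually.of_forall fun s => ?_)
  · rw [sum_perp b' (norm_smul_inv_self h0), levelCurv]
    simp only [map_smul, smul_apply, smul_eq_mul, real_inner_smul_left, Pi.inv_apply, Pi.sub_apply,
      Pi.div_apply, Pi.pow_apply]
    generalize (∑ i : Fin (n + 1), b' (EuclideanSpace.single i 1) (EuclideanSpace.single i 1)) = x1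
    generalize (∑ i : Fin (n + 1), b s (EuclideanSpace.single i 1) (EuclideanSpace.single i 1)) = x2
    field_simp
    ring
  · simp [levelCurv]

/-- Along the direction ξ one has r' = φ, so the first term becomes the damping -nc e^W φ², and the
third contains the competing c e^W φ H. -/
theorem hasDerivAt_gaugeSpeed (c k : ℝ) {y q : ℝ → Space n} {y' q' : Space n} {r : ℝ → ℝ} {r' : ℝ}
    {b : ℝ → Space n →L[ℝ] Space n →L[ℝ] ℝ} {H' : ℝ} {s : ℝ}
    (hy : HasDerivAt y y' s) (hr : HasDerivAt r r' s) (hq : HasDerivAt q q' s) (h0 : q s ≠ 0)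
    (hH : HasDerivAt (fun s => levelCurv (q s) (b s)) H' s) :
    HasDerivAt (fun s => gaugeSpeed c k (y s) (r s) (q s) (b s))
      (-(n * c * Real.exp (r s) * r' * aniso k (q s))
        - n * c * Real.exp (r s) * inner ℝ (anisoGrad k (q s)) q'
        + (c * Real.exp (r s) * r' + y' (Fin.last n)) * levelCurv (q s) (b s)
        + (c * Real.exp (r s) + y s (Fin.last n)) * H'
        - n * (‖q s‖⁻¹ • perp (‖q s‖⁻¹ • q s) q') (Fin.last n)) s := by
  have coord : ∀ {x : ℝ → Space n} {x' : Space n}, HasDerivAt x x' s →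
      HasDerivAt (fun s => x s (Fin.last n)) (x' (Fin.last n)) s := by
    intro x x' h
    have := (hasDerivAt_const s (eLast n)).inner ℝ h
    simpa [inner_eLast] using this
  have h1 := (hr.exp.const_mul (n * c : ℝ)).mul (hasDerivAt_aniso k hq h0)
  have h2 := ((hr.exp.const_mul c).add (coord hy)).mul hH
  have h3 := (coord (hasDerivAt_normalize hq h0)).const_mul (n : ℝ)
  refine (((h1.neg).add h2).sub h3).congr_deriv ?_ |>.congr_of_eventuallyEq
    (Eventually.of_forall fun s => ?_)
  · simp only [Pi.add_apply]; ring
  · simp [gaugeSpeed, div_eq_inv_mul]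

theorem hasDerivAt_line {G : Type*} [NormedAddCommGroup G] [NormedSpace ℝ G] {F : Space n → G}
    {y X : Space n} {s : ℝ} (hF : DifferentiableAt ℝ F (y + s • X)) :
    HasDerivAt (fun s : ℝ => F (y + s • X)) (fderiv ℝ F (y + s • X) X) s := by
  have h : HasDerivAt (fun s : ℝ => y + s • X) X s := by
    simpa using ((hasDerivAt_id s).smul_const X).const_add y
  exact hF.hasFDerivAt.comp_hasDerivAt s h

theorem tendsto_line (y X : Space n) : Tendsto (fun s : ℝ => y + s • X) (𝓝 0) (𝓝 y) := by
  have : Continuous fun s : ℝ => y + s • X := by fun_prop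
  simpa using this.tendsto 0

/-- First and second order conditions at a maximum of the weighted capillary gauge
`(|y| + y_1) (|q| - k q_1)`. -/
theorem conditions_of_isLocalMax {q : Space n → Space n} {y : Space n} {k : ℝ}
    (hq : ContDiffAt ℝ 2 q y) (hq0 : q y ≠ 0) (hk : |k| < 1) (hy : ‖y‖ = 1) (hy0 : 0 ≤ y 0)
    (hself : ∀ X Y, inner ℝ (fderiv ℝ q y X) Y = inner ℝ X (fderiv ℝ q y Y))
    (hmax : IsLocalMax (fun z => aniso (-1) z * aniso k (q z)) y) :
    (∃ s : Space n, ‖s‖ ≤ 2 ∧ fderiv ℝ q y (anisoGrad k (q y)) = -aniso k (q y) • s) ∧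
    ∀ X, inner ℝ (anisoGrad k (q y)) (fderiv ℝ (fderiv ℝ q) y X X) ≤ 8 * aniso k (q y) * ‖X‖ ^ 2
      - ‖q y‖⁻¹ * ‖perp (‖q y‖⁻¹ • q y) (fderiv ℝ q y X)‖ ^ 2 := by
  have hyne : y ≠ 0 := by rintro rfl; simp at hy
  have hS : 1 ≤ aniso (-1) y := by rw [aniso, hy]; linarith
  have hφ : 0 < aniso k (q y) :=
    lt_of_lt_of_le (mul_pos (by linarith) (norm_pos_iff.2 hq0)) (aniso_ge k (q y))
  have hg : ‖anisoGrad (-1) y‖ ≤ 2 := norm_anisoGrad_le (by simp) y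
  have hdiff : ∀ᶠ z in 𝓝 y, DifferentiableAt ℝ q z ∧ q z ≠ 0 ∧ z ≠ 0 := by
    filter_upwards [hq.eventually (by simp), hq.continuousAt.eventually_ne hq0,
      eventually_ne_nhds hyne] with z h1 h2 h3
    exact ⟨h1.differentiableAt (by simp), h2, h3⟩
  have hDq : DifferentiableAt ℝ (fderiv ℝ q) y :=
    (hq.fderiv_right (m := 1) (by norm_num)).differentiableAt (by simp)
  have hloc : ∀ X, IsLocalMax (fun s : ℝ => aniso (-1) (y + s • X) * aniso k (q (y + s • X))) 0 := by
    intro X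
    have := (tendsto_line y X).eventually hmax
    simpa [IsLocalMax, IsMaxFilter] using this
  have hfirst : ∀ X, ∀ᶠ s in 𝓝 (0 : ℝ), HasDerivAt
      (fun s : ℝ => aniso (-1) (y + s • X) * aniso k (q (y + s • X)))
      (inner ℝ (anisoGrad (-1) (y + s • X)) X * aniso k (q (y + s • X))
        + aniso (-1) (y + s • X)
          * inner ℝ (anisoGrad k (q (y + s • X))) (fderiv ℝ q (y + s • X) X)) s := by
    intro X
    filter_upwards [(tendsto_line y X).eventually hdiff] with s hs
    have h1 := hasDerivAt_line (X := X) (s := s) (y := y) hs.1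
    have h2 := hasDerivAt_line (F := fun z => z) (X := X) (s := s) (y := y) differentiableAt_id
    have h2' : HasDerivAt (fun s : ℝ => y + s • X) X s := by simpa using h2
    exact (hasDerivAt_aniso (-1) h2' hs.2.2).mul (hasDerivAt_aniso k h1 hs.2.1)
  have hcrit : ∀ X, inner ℝ (anisoGrad (-1) y) X * aniso k (q y)
        + aniso (-1) y * inner ℝ (anisoGrad k (q y)) (fderiv ℝ q y X) = 0 := by
    intro X
    simpa using (hloc X).hasDerivAt_eq_zero (hfirst X).self_of_nhds
  constructor
  · refine ⟨(aniso (-1) y)⁻¹ • anisoGrad (-1) y, ?_, ?_⟩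
    · rw [norm_smul, norm_inv, Real.norm_of_nonneg (by linarith)]
      calc (aniso (-1) y)⁻¹ * ‖anisoGrad (-1) y‖ ≤ 1 * 2 := by
            gcongr; exact inv_le_one_of_one_le₀ hS
        _ = 2 := one_mul 2
    · refine ext_inner_right ℝ fun X => ?_
      -- Self-adjointness moves the Hessian onto ξ, so the scalar critical point equations in all
      -- directions X become one vector equation for Bξ.
      rw [hself, real_inner_smul_left, real_inner_smul_left]
      have := hcrit X
      field_simp
      linarith
  · intro X
    have h1 : HasDerivAt (fun s : ℝ => q (y + s • X)) (fderiv ℝ q y X) 0 := by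
      have := hasDerivAt_line (X := X) (s := 0) (y := y) (F := q)
        (by simpa using hdiff.self_of_nhds.1)
      simpa using this
    have h2 : HasDerivAt (fun s : ℝ => fderiv ℝ q (y + s • X) X)
        (fderiv ℝ (fderiv ℝ q) y X X) 0 := by
      have := (hasDerivAt_line (X := X) (s := 0) (y := y) (F := fderiv ℝ q)
        (by simpa using hDq)).clm_apply (hasDerivAt_const (0 : ℝ) X)
      simpa using this
    have h3 : HasDerivAt (fun s : ℝ => y + s • X) X 0 := by
      have := hasDerivAt_line (F := fun z => z) (X := X) (s := 0) (y := y) differentiableAt_id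
      simpa using this
    have hq0' : q (y + (0 : ℝ) • X) ≠ 0 := by simpa using hq0
    have hy0' : y + (0 : ℝ) • X ≠ 0 := by simpa using hyne
    have hsecond := (((hasDerivAt_anisoGrad (-1) h3 hy0').inner ℝ (hasDerivAt_const (0 : ℝ) X)).mul
      (hasDerivAt_aniso k h1 hq0')).add ((hasDerivAt_aniso (-1) h3 hy0').mul
        ((hasDerivAt_anisoGrad k h1 hq0').inner ℝ h2))
    have hle := second_deriv_nonpos_of_isLocalMax (hloc X) (hfirst X) hsecond
    simp only [zero_smul, add_zero, inner_zero_right, zero_add, real_inner_smul_left] at hle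
    have hsq : ∀ {w : Space n} (Y : Space n), ‖w‖ = 1 →
        inner ℝ (perp w Y) Y = ‖perp w Y‖ ^ 2 := by
      intro w Y hw
      rw [← real_inner_self_eq_norm_sq, inner_perp_comm, inner_perp_comm,
        perp_eq_self (inner_perp_self hw Y), ← inner_perp_comm]
    rw [hsq _ (norm_smul_inv_self hq0), hsq _ (norm_smul_inv_self hyne)] at hle
    have hc := hcrit X
    set S := aniso (-1) y
    set φ := aniso k (q y)
    set a := inner ℝ (anisoGrad (-1) y) X
    set d := inner ℝ (anisoGrad k (q y)) (fderiv ℝ q y X)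
    set T := inner ℝ (anisoGrad k (q y)) (fderiv ℝ (fderiv ℝ q) y X X)
    set N := ‖q y‖⁻¹ * ‖perp (‖q y‖⁻¹ • q y) (fderiv ℝ q y X)‖ ^ 2
    have ha : a ^ 2 ≤ 4 * ‖X‖ ^ 2 := by
      have h5 : |a| ≤ 2 * ‖X‖ := (abs_real_inner_le_norm _ _).trans (by gcongr)
      nlinarith [sq_abs a, abs_nonneg a]
    have hpos : 0 ≤ ‖y‖⁻¹ * ‖perp (‖y‖⁻¹ • y) X‖ ^ 2 * φ := by positivity
    -- The first order condition eliminates the mixed derivative; the term 2a²φ that remains gives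
    -- the constant 8, since |a| ≤ 2|X| and S ≥ 1.
    have h7 : S * (a * d) = -(a ^ 2 * φ) := by
      have : S * d = -(a * φ) := by linarith
      linear_combination a * this
    have h9 : S ^ 2 * (N + T) ≤ S ^ 2 * (8 * φ * ‖X‖ ^ 2) := by
      have h11 : 0 ≤ 8 * φ * ‖X‖ ^ 2 := by positivity
      have h12 : 1 ≤ S ^ 2 := by nlinarith
      nlinarith
    have := le_of_mul_le_mul_left h9 (by positivity)
    linarith

/-- The trace of the third derivatives at a maximum of the weighted capillary gauge. -/
theorem third_deriv_trace_le {q : Space n → Space n} {y : Space n} {k : ℝ}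
    (hq : ContDiffAt ℝ 2 q y) (hq0 : q y ≠ 0) (hk : |k| < 1)
    (hself : ∀ᶠ z in 𝓝 y, ∀ X Y, inner ℝ (fderiv ℝ q z X) Y = inner ℝ X (fderiv ℝ q z Y))
    (hT : ∀ X, inner ℝ (anisoGrad k (q y)) (fderiv ℝ (fderiv ℝ q) y X X)
      ≤ 8 * aniso k (q y) * ‖X‖ ^ 2
        - ‖q y‖⁻¹ * ‖perp (‖q y‖⁻¹ • q y) (fderiv ℝ q y X)‖ ^ 2) :
    ‖q y‖⁻¹ * ∑ i : Fin (n + 1), opForm (fderiv ℝ (fderiv ℝ q) y (anisoGrad k (q y)))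
      (perp (‖q y‖⁻¹ • q y) (EuclideanSpace.single i 1))
      (perp (‖q y‖⁻¹ • q y) (EuclideanSpace.single i 1))
      ≤ 16 * n - shapeNorm (q y) (fderiv ℝ q y) ^ 2 := by
  have hv : 0 < ‖q y‖ := norm_pos_iff.2 hq0
  have hsym : ∀ X Y, fderiv ℝ (fderiv ℝ q) y X Y = fderiv ℝ (fderiv ℝ q) y Y X := by
    have := hq.isSymmSndFDerivAt (by simp)
    exact fun X Y => this.eq X Y
  have hDq : DifferentiableAt ℝ (fderiv ℝ q) y :=
    (hq.fderiv_right (m := 1) (by norm_num)).differentiableAt (by simp)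
  -- Together with `hsym` this makes ⟨D²q(X, Y), Z⟩ totally symmetric, so the ξ-derivative of the
  -- Hessian on (X, X) equals ⟨ξ, D²q(X, X)⟩.
  have hself' : ∀ Z X Y, inner ℝ (fderiv ℝ (fderiv ℝ q) y Z X) Y
      = inner ℝ X (fderiv ℝ (fderiv ℝ q) y Z Y) := by
    intro Z X Y
    have hline : ∀ X, HasDerivAt (fun s : ℝ => fderiv ℝ q (y + s • Z) X)
        (fderiv ℝ (fderiv ℝ q) y Z X) 0 := by
      intro X
      have := (hasDerivAt_line (X := Z) (s := 0) (y := y) (F := fderiv ℝ q)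
        (by simpa using hDq)).clm_apply (hasDerivAt_const (0 : ℝ) X)
      simpa using this
    have h1 := (hline X).inner ℝ (hasDerivAt_const (0 : ℝ) Y)
    have h2 := (hasDerivAt_const (0 : ℝ) X).inner ℝ (hline Y)
    have h3 := h1.unique (h2.congr_of_eventuallyEq
      (((tendsto_line y Z).eventually hself).mono fun s hs => hs X Y))
    simpa using h3
  set w := ‖q y‖⁻¹ • q y with hw
  have hw1 : ‖w‖ = 1 := norm_smul_inv_self hq0
  set ξ := anisoGrad k (q y)
  have hterm : ∀ i : Fin (n + 1), opForm (fderiv ℝ (fderiv ℝ q) y ξ)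
      (perp w (EuclideanSpace.single i 1)) (perp w (EuclideanSpace.single i 1))
      ≤ 8 * aniso k (q y) * ‖perp w (EuclideanSpace.single i 1)‖ ^ 2
        - ‖q y‖ * ‖shapeOp (q y) (fderiv ℝ q y) (EuclideanSpace.single i 1)‖ ^ 2 := by
    intro i
    refine le_trans (le_of_eq ?_) ((hT (perp w (EuclideanSpace.single i 1))).trans_eq ?_)
    · rw [opForm_apply, hsym, hself', hsym, real_inner_comm, hself', real_inner_comm,
        hsym, hsym]
    · rw [shapeOp, LinearMap.coe_mk, AddHom.coe_mk, norm_smul, mul_pow, norm_inv, norm_norm, ← hw]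
      field_simp
  calc _ ≤ ‖q y‖⁻¹ * ∑ i : Fin (n + 1),
        (8 * aniso k (q y) * ‖perp w (EuclideanSpace.single i 1)‖ ^ 2
        - ‖q y‖ * ‖shapeOp (q y) (fderiv ℝ q y) (EuclideanSpace.single i 1)‖ ^ 2) := by
        gcongr with i; exact hterm i
    _ = 8 * n * (‖q y‖⁻¹ * aniso k (q y)) - shapeNorm (q y) (fderiv ℝ q y) ^ 2 := by
        rw [Finset.sum_sub_distrib, ← Finset.mul_sum, ← Finset.mul_sum, sum_norm_sq_perp hw1,
          shapeNorm_sq]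
        field_simp
    _ ≤ 8 * n * 2 - shapeNorm (q y) (fderiv ℝ q y) ^ 2 := by
        gcongr
        rw [inv_mul_le_iff₀ hv]; linarith [aniso_le hk.le (q y)]
    _ = _ := by ring

/-! ### Gradients, Hessians and the evolution of the gauge. -/

theorem inner_gradient (f : Space n → ℝ) (y X : Space n) :
    inner ℝ (gradient f y) X = fderiv ℝ f y X := by
  rw [gradient, InnerProductSpace.toDual_symm_apply]

theorem gradient_eq_comp (f : Space n → ℝ) :
    gradient f = (InnerProductSpace.toDual ℝ (Space n)).symm ∘ fderiv ℝ f := rfl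

theorem contDiffAt_gradient {f : Space n → ℝ} {y : Space n} {m : ℕ}
    (h : ContDiffAt ℝ (m + 1 : ℕ) f y) : ContDiffAt ℝ m (gradient f) y := by
  rw [gradient_eq_comp]
  exact (InnerProductSpace.toDual ℝ (Space n)).symm.contDiff.contDiffAt.comp y
    (h.fderiv_right (m := m) (by norm_cast))

theorem inner_fderiv_gradient {f : Space n → ℝ} {y : Space n} (h : ContDiffAt ℝ 2 f y)
    (X Y : Space n) :
    inner ℝ (fderiv ℝ (gradient f) y X) Y = fderiv ℝ (fderiv ℝ f) y X Y := by
  have hd : DifferentiableAt ℝ (fderiv ℝ f) y :=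
    (h.fderiv_right (m := 1) (by norm_num)).differentiableAt (by simp)
  have h1 : HasFDerivAt (gradient f) _ y :=
    ((InnerProductSpace.toDual ℝ (Space n)).symm.toContinuousLinearEquiv.toContinuousLinearMap
      |>.hasFDerivAt).comp y hd.hasFDerivAt
  rw [h1.fderiv]
  simp

theorem fderiv_gradient_selfAdjoint {f : Space n → ℝ} {y : Space n} (h : ContDiffAt ℝ 2 f y)
    (X Y : Space n) :
    inner ℝ (fderiv ℝ (gradient f) y X) Y = inner ℝ X (fderiv ℝ (gradient f) y Y) := by
  rw [real_inner_comm _ X, inner_fderiv_gradient h, inner_fderiv_gradient h]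
  exact (h.isSymmSndFDerivAt (by simp)).eq X Y

/-- The time derivative of the gradient is the gradient of the time derivative. -/
theorem exists_hasDerivAt_gradient {W : ℝ → Space n → ℝ} {t : ℝ} {y : Space n} {G : Space n → ℝ}
    (hW : ContDiffAt ℝ 2 (fun p : ℝ × Space n => W p.1 p.2) (t, y))
    (hG : ∀ᶠ z in 𝓝 y, HasDerivAt (fun s => W s z) (G z) t) :
    ∃ g : Space n, HasDerivAt (fun s => gradient (W s) y) g t ∧
      ∀ X, HasDerivAt (fun s : ℝ => G (y + s • X)) (inner ℝ g X) 0 := by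
  set F := fun p : ℝ × Space n => W p.1 p.2 with hF
  have hFd : ∀ᶠ p in 𝓝 (t, y), DifferentiableAt ℝ F p :=
    (hW.eventually (by simp)).mono fun p hp => hp.differentiableAt (by simp)
  have hD : DifferentiableAt ℝ (fderiv ℝ F) (t, y) :=
    (hW.fderiv_right (m := 1) (by norm_num)).differentiableAt (by simp)
  have hsymm := (hW.isSymmSndFDerivAt (by simp)).eq
  set D2 := fderiv ℝ (fderiv ℝ F) (t, y) with hD2
  set inr := ContinuousLinearMap.inr ℝ ℝ (Space n)
  set J := (InnerProductSpace.toDual ℝ (Space n)).symm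
  have hct : Tendsto (fun s : ℝ => (s, y)) (𝓝 t) (𝓝 (t, y)) :=
    (Continuous.prodMk continuous_id continuous_const).tendsto t
  have hcy : Tendsto (fun z : Space n => (t, z)) (𝓝 y) (𝓝 (t, y)) :=
    (Continuous.prodMk continuous_const continuous_id).tendsto y
  have hgrad : (fun s => gradient (W s) y) =ᶠ[𝓝 t] fun s => J ((fderiv ℝ F (s, y)).comp inr) := by
    filter_upwards [hct.eventually hFd] with s hs
    have h1 : HasFDerivAt (W s) ((fderiv ℝ F (s, y)).comp inr) y :=
      hs.hasFDerivAt.comp y (hasFDerivAt_prodMk_right s y)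
    rw [gradient, h1.fderiv]
  have hGe : G =ᶠ[𝓝 y] fun z => fderiv ℝ F (t, z) (1, 0) := by
    filter_upwards [hcy.eventually hFd, hG] with z hz hz2
    have h1 : HasDerivAt (fun s : ℝ => (s, z)) (1, 0) t :=
      (hasDerivAt_id t).prodMk (hasDerivAt_const t z)
    have h2 : HasDerivAt (fun s => F (s, z)) (fderiv ℝ F (t, z) (1, 0)) t :=
      HasFDerivAt.comp_hasDerivAt (f := fun s : ℝ => (s, z)) t hz.hasFDerivAt h1
    exact hz2.unique h2
  refine ⟨J ((D2 (1, 0)).comp inr), ?_, fun X => ?_⟩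
  · have h1 : HasDerivAt (fun s : ℝ => (s, y)) (1, 0) t :=
      (hasDerivAt_id t).prodMk (hasDerivAt_const t y)
    have h2 : HasDerivAt (fun s => fderiv ℝ F (s, y)) (D2 (1, 0)) t :=
      hD.hasFDerivAt.comp_hasDerivAt t h1
    have h3 := h2.clm_comp (hasDerivAt_const t inr)
    simp only [ContinuousLinearMap.comp_zero, add_zero] at h3
    have h4 := J.toContinuousLinearEquiv.toContinuousLinearMap.hasFDerivAt.comp_hasDerivAt t h3
    exact h4.congr_of_eventuallyEq hgrad
  · have h1 : HasDerivAt (fun s : ℝ => (t, y + s • X)) (0, X) 0 := by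
      have := hasDerivAt_line (F := fun z => z) (X := X) (s := 0) (y := y) differentiableAt_id
      exact (hasDerivAt_const 0 t).prodMk (by simpa using this)
    have h2 : HasDerivAt (fun s : ℝ => fderiv ℝ F (t, y + s • X)) (D2 (0, X)) 0 :=
      HasFDerivAt.comp_hasDerivAt (f := fun s : ℝ => (t, y + s • X)) 0
        (by simpa using hD.hasFDerivAt) h1
    have h3 := h2.clm_apply (hasDerivAt_const (0 : ℝ) ((1, 0) : ℝ × Space n))
    have h4 := h3.congr_of_eventuallyEq ((tendsto_line y X).eventually hGe)
    refine h4.congr_deriv ?_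
    simp only [map_zero, add_zero]
    rw [hsymm, InnerProductSpace.toDual_symm_apply]
    rfl

/-- Where the capillary gauge is large, it decreases at an interior maximum of the weighted
capillary gauge. -/
theorem exists_gauge_decay (hn : 1 ≤ n) {c k K : ℝ} (hc : 0 < c) (hK : 0 < K)
    (hcK : c * ((n : ℝ) - 1) < 4 * n * K) (hk : |k| < 1) (ρm hm : ℝ) :
    ∃ Φ : ℝ, ∀ (W : ℝ → Space n → ℝ) (t : ℝ) (y : Space n),
      ContDiffAt ℝ 3 (fun p : ℝ × Space n => W p.1 p.2) (t, y) →
      (∀ᶠ z in 𝓝 y, HasDerivAt (fun s => W s z)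
        (gaugeSpeed c k z (W t z) (gradient (W t) z)
          (opForm (fderiv ℝ (gradient (W t)) z))) t) →
      ‖y‖ = 1 → 0 ≤ y 0 → inner ℝ (gradient (W t) y) y = 1 →
      fderiv ℝ (gradient (W t)) y y = -gradient (W t) y →
      Real.exp (-W t y) ≤ ρm → K ≤ c + Real.exp (-W t y) * y (Fin.last n) →
      c + Real.exp (-W t y) * y (Fin.last n) ≤ hm →
      IsLocalMax (fun z => aniso (-1) z * aniso k (gradient (W t) z)) y →
      Φ ≤ aniso k (gradient (W t) y) →
      ∃ d < 0, HasDerivAt (fun s => aniso k (gradient (W s) y)) d t := by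
  obtain ⟨Φ, hΦ⟩ := exists_decay_threshold hn hc hK hcK ρm hm
  -- The value 4 is the lower bound for φ required by `levelCurv_le`.
  refine ⟨max Φ 4, fun W t y hW hpde hy hy0 hqy hBy hρ hKh hhm hmax hΦy => ?_⟩
  obtain ⟨g, hg, hgX⟩ := exists_hasDerivAt_gradient (hW.of_le (by norm_num)) hpde
  have hWt : ContDiffAt ℝ 3 (W t) y :=
    hW.comp y (contDiffAt_const.prodMk contDiffAt_id)
  set q := gradient (W t) with hq
  have hq0 : q y ≠ 0 := by intro h; rw [h] at hqy; simp at hqy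
  have hv : 0 < ‖q y‖ := norm_pos_iff.2 hq0
  have hqC : ContDiffAt ℝ 2 q y := contDiffAt_gradient (m := 2) hWt
  have hself : ∀ᶠ z in 𝓝 y, ∀ X Y,
      inner ℝ (fderiv ℝ q z X) Y = inner ℝ X (fderiv ℝ q z Y) := by
    filter_upwards [hWt.eventually (by simp)] with z hz
    exact fderiv_gradient_selfAdjoint (hz.of_le (by norm_num))
  have hDq : DifferentiableAt ℝ (fderiv ℝ q) y :=
    (hqC.fderiv_right (m := 1) (by norm_num)).differentiableAt (by simp)
  obtain ⟨⟨s, hs, hBξ⟩, hT⟩ := conditions_of_isLocalMax hqC hq0 hk hy hy0 hself.self_of_nhds hmax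
  have htr := third_deriv_trace_le hqC hq0 hk hself hT
  set B := fderiv ℝ q y with hB
  set ξ := anisoGrad k (q y) with hξ
  set φ := aniso k (q y) with hφ
  have hφ4 : 4 ≤ φ := (le_max_right _ _).trans hΦy
  have hsymm : ∀ X Y, opForm B X Y = opForm B Y X := by
    intro X Y
    rw [opForm_apply, opForm_apply, hself.self_of_nhds, real_inner_comm]
  have lq : HasDerivAt (fun s : ℝ => q (y + s • ξ)) (B ξ) 0 := by
    have := hasDerivAt_line (X := ξ) (s := 0) (y := y) (F := q)
      (by simpa using hqC.differentiableAt (by simp))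
    simpa using this
  have lB : HasDerivAt (fun s : ℝ => fderiv ℝ q (y + s • ξ)) (fderiv ℝ (fderiv ℝ q) y ξ) 0 := by
    have := hasDerivAt_line (X := ξ) (s := 0) (y := y) (F := fderiv ℝ q) (by simpa using hDq)
    simpa using this
  have lr : HasDerivAt (fun s : ℝ => W t (y + s • ξ)) φ 0 := by
    have := hasDerivAt_line (X := ξ) (s := 0) (y := y) (F := W t)
      (by simpa using hWt.differentiableAt (by simp))
    rw [zero_smul, add_zero, ← inner_gradient, ← hq, real_inner_comm,
      inner_anisoGrad_self k hq0] at this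
    exact this
  have ly : HasDerivAt (fun s : ℝ => y + s • ξ) ξ 0 := by
    have := hasDerivAt_line (F := fun z => z) (X := ξ) (s := 0) (y := y) differentiableAt_id
    simpa using this
  have hq0' : q (y + (0 : ℝ) • ξ) ≠ 0 := by simpa using hq0
  have lH := hasDerivAt_levelCurv lq (hasDerivAt_opForm lB) hq0' (by simpa using hsymm)
  have lS := hasDerivAt_gaugeSpeed c k ly lr lq hq0' lH
  -- ⟨ξ, q_t⟩, which is φ_t, equals the derivative of the speed in the direction ξ.
  have hval := (hgX ξ).unique lS
  simp only [zero_smul, add_zero] at hval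
  have hnv := normal_variation_le (b := opForm B) (fun X Y => rfl) hsymm hq0 hk hBξ hs
  have hH := levelCurv_le hn (b := opForm B) (fun X Y => rfl) hy hqy hBy hk.le hBξ hs hφ4
  have hHa := abs_levelCurv_le hq0 (b := opForm B) (B := B) (fun X Y => rfl)
  refine ⟨inner ℝ ξ g, ?_, ?_⟩
  · rw [real_inner_comm, hval]
    have hξ2 : ‖ξ‖ ≤ 2 := norm_anisoGrad_le hk.le (q y)
    have hw1 : ‖‖q y‖⁻¹ • q y‖ = 1 := norm_smul_inv_self hq0
    have hφv : φ ≤ 2 * ‖q y‖ := aniso_le hk.le (q y)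
    have x₁ : |inner ℝ ξ (B ξ)| ≤ 4 * φ := by
      rw [hBξ, real_inner_smul_right, abs_mul, abs_neg, abs_of_pos (by linarith)]
      have : |inner ℝ ξ s| ≤ 2 * 2 := (abs_real_inner_le_norm _ _).trans (by gcongr)
      nlinarith
    have x₂ : |ξ (Fin.last n)| ≤ 2 := (abs_apply_le_norm _ _).trans hξ2
    have x₃ : |(‖q y‖⁻¹ • perp (‖q y‖⁻¹ • q y) (B ξ)) (Fin.last n)| ≤ 4 := by
      refine (abs_apply_le_norm _ _).trans ?_
      rw [norm_smul, norm_inv, norm_norm, inv_mul_le_iff₀ hv]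
      refine (norm_perp_le hw1 _).trans ?_
      rw [hBξ, norm_smul, norm_neg, Real.norm_of_nonneg (by linarith)]
      nlinarith
    have hDH := add_le_add htr hnv
    have key := hΦ φ ((le_max_left _ _).trans hΦy) (shapeNorm (q y) B) (Real.exp (-W t y))
      (c + Real.exp (-W t y) * y (Fin.last n)) (levelCurv (q y) (opForm B)) _ _ _ _
      (shapeNorm_nonneg _ _) (Real.exp_pos _) hρ hKh hhm hH hHa
      (hDH.trans_eq (by ring)) x₁ x₂ x₃
    have hexp : (Real.exp (-W t y))⁻¹ = Real.exp (W t y) := by rw [Real.exp_neg, inv_inv]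
    have hexp2 : Real.exp (W t y) * (c + Real.exp (-W t y) * y (Fin.last n))
        = c * Real.exp (W t y) + y (Fin.last n) := by
      rw [mul_add, ← mul_assoc, ← Real.exp_add]; simp; ring
    rw [hexp, hexp2] at key
    refine lt_of_eq_of_lt ?_ key
    ring
  · exact hasDerivAt_aniso k hg hq0

/-! ### The homogeneous extension and its evolution in the cone. -/

/-- The homogeneous function `log |y| - f(y / |y|)`, which vanishes on the radial graph of `e^f`. -/
def logGauge (f : Space n → ℝ) (y : Space n) : ℝ := Real.log ‖y‖ - radialExt f y

theorem isOpen_pos_first : IsOpen {y : Space n | 0 < y 0} :=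
  isOpen_lt continuous_const (by fun_prop)

theorem ne_zero_of_pos_first {y : Space n} (hy : 0 < y 0) : y ≠ 0 := by
  rintro rfl; simp at hy

theorem mem_cone_of_pos {y : Space n} (hy : 0 < y 0) : y ∈ cone n :=
  ⟨hy.le, ne_zero_of_pos_first hy⟩

theorem mem_cone_of_mem_closedHemisphere {z : Space n} (hz : z ∈ closedHemisphere n) :
    z ∈ cone n := ⟨hz.2, by rintro rfl; simpa using hz.1⟩

theorem cone_mem_nhds {y : Space n} (hy : 0 < y 0) : cone n ∈ 𝓝 y :=
  Filter.mem_of_superset (isOpen_pos_first.mem_nhds hy) fun _ hz => mem_cone_of_pos hz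

theorem radialExt_smul (f : Space n → ℝ) {a : ℝ} (ha : 0 < a) (y : Space n) :
    radialExt f (a • y) = radialExt f y := by
  rw [radialExt, radialExt, norm_smul, Real.norm_of_nonneg ha.le, smul_smul, mul_inv]
  congr 2
  field_simp

theorem radialExt_of_norm_eq_one (f : Space n → ℝ) {z : Space n} (hz : ‖z‖ = 1) :
    radialExt f z = f z := by simp [radialExt, hz]

theorem logGauge_of_norm_eq_one (f : Space n → ℝ) {z : Space n} (hz : ‖z‖ = 1) :
    logGauge f z = -f z := by simp [logGauge, radialExt_of_norm_eq_one f hz, hz]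

theorem logGauge_smul (f : Space n → ℝ) {a : ℝ} (ha : 0 < a) {y : Space n} (hy : y ≠ 0) :
    logGauge f (a • y) = Real.log a + logGauge f y := by
  rw [logGauge, logGauge, radialExt_smul f ha, norm_smul, Real.norm_of_nonneg ha.le,
    Real.log_mul ha.ne' (norm_ne_zero_iff.2 hy)]
  ring

theorem contDiffAt_log_norm {m : WithTop ℕ∞} {y : Space n} (hy : y ≠ 0) :
    ContDiffAt ℝ m (fun z : Space n => Real.log ‖z‖) y :=
  (contDiffAt_norm ℝ hy).log (norm_ne_zero_iff.2 hy)

theorem contDiffAt_logGauge {f : Space n → ℝ} {m : WithTop ℕ∞}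
    (hf : ContDiffOn ℝ m (radialExt f) (cone n)) {y : Space n} (hy : 0 < y 0) :
    ContDiffAt ℝ m (logGauge f) y :=
  (contDiffAt_log_norm (ne_zero_of_pos_first hy)).sub (hf.contDiffAt (cone_mem_nhds hy))

theorem hasFDerivAt_log_norm {y : Space n} (hy : y ≠ 0) :
    HasFDerivAt (fun z : Space n => Real.log ‖z‖) (innerSL ℝ ((‖y‖ ^ 2)⁻¹ • y)) y := by
  have h1 : HasFDerivAt (fun z : Space n => ‖z‖ ^ 2) (2 • innerSL ℝ y) y :=
    (hasStrictFDerivAt_norm_sq y).hasFDerivAt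
  have h2 := (h1.log (by simpa using hy)).const_mul (1 / 2 : ℝ)
  have e : (fun z : Space n => Real.log ‖z‖) = fun z => 1 / 2 * Real.log (‖z‖ ^ 2) := by
    funext z; rw [Real.log_pow]; push_cast; ring
  rw [e]
  refine h2.congr_fderiv ?_
  ext X
  simp
  ring

theorem gradient_logGauge {f : Space n → ℝ} {y : Space n} (hy : y ≠ 0)
    (hf : DifferentiableAt ℝ (radialExt f) y) :
    gradient (logGauge f) y = (‖y‖ ^ 2)⁻¹ • y - gradient (radialExt f) y := by
  refine ext_inner_right ℝ fun X => ?_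
  have h : HasFDerivAt (logGauge f) _ y := (hasFDerivAt_log_norm hy).sub hf.hasFDerivAt
  rw [inner_gradient, h.fderiv, inner_sub_left, inner_gradient,
    real_inner_smul_left]
  simp

theorem extDeriv_eq {f : Space n → ℝ} {y : Space n} (hy : 0 < y 0) :
    extDeriv f y = fderiv ℝ (radialExt f) y :=
  fderivWithin_of_mem_nhds (cone_mem_nhds hy)

theorem extDeriv2_eq {f : Space n → ℝ} {y : Space n} (hy : 0 < y 0) :
    extDeriv2 f y = fderiv ℝ (fderiv ℝ (radialExt f)) y := by
  rw [extDeriv2, fderivWithin_of_mem_nhds (cone_mem_nhds hy)]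
  apply Filter.EventuallyEq.fderiv_eq
  filter_upwards [isOpen_pos_first.mem_nhds hy] with z hz using extDeriv_eq hz

theorem sphereGrad_eq {f : Space n → ℝ} {z : Space n} (hz : ‖z‖ = 1) (hz0 : 0 < z 0)
    (hf : DifferentiableAt ℝ (radialExt f) z) :
    sphereGrad f z = z - gradient (logGauge f) z := by
  rw [gradient_logGauge (ne_zero_of_pos_first hz0) hf, hz, sphereGrad, extDeriv_eq hz0]
  simp [gradient]

/-- Euler's identity: dilation by a adds log a to the function. -/
theorem inner_gradient_logGauge_self {f : Space n → ℝ} {y : Space n} (hy : 0 < y 0)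
    (hf : DifferentiableAt ℝ (logGauge f) y) : inner ℝ (gradient (logGauge f) y) y = 1 := by
  have h1 := hasDerivAt_line (X := y) (s := 0) (y := y) (F := logGauge f) (by simpa using hf)
  have h2 : HasDerivAt (fun s : ℝ => Real.log (1 + s) + logGauge f y) 1 0 := by
    have := (((hasDerivAt_id (0 : ℝ)).const_add 1).log (by simp)).add_const (logGauge f y)
    simpa using this
  have h3 : (fun s : ℝ => logGauge f (y + s • y)) =ᶠ[𝓝 0]
      fun s : ℝ => Real.log (1 + s) + logGauge f y := by
    filter_upwards [eventually_gt_nhds (show (-1 : ℝ) < 0 by norm_num)] with s hs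
    rw [← logGauge_smul f (by linarith) (ne_zero_of_pos_first hy), add_smul, one_smul]
  rw [inner_gradient]
  simpa using h1.unique (h2.congr_of_eventuallyEq h3)

/-- Differentiate the Euler identity ⟨∇W, y⟩ = 1 and use the symmetry of the Hessian. -/
theorem fderiv_gradient_logGauge_self {f : Space n → ℝ} {y : Space n} (hy : 0 < y 0)
    (hf : ContDiffOn ℝ 2 (radialExt f) (cone n)) :
    fderiv ℝ (gradient (logGauge f)) y y = -gradient (logGauge f) y := by
  have hC := contDiffAt_logGauge hf hy
  have hd : DifferentiableAt ℝ (gradient (logGauge f)) y :=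
    (contDiffAt_gradient (m := 1) hC).differentiableAt (by simp)
  refine ext_inner_right ℝ fun X => ?_
  have h1 := hasDerivAt_line (X := X) (s := 0) (y := y) (F := gradient (logGauge f))
    (by simpa using hd)
  have h2 := hasDerivAt_line (F := fun z => z) (X := X) (s := 0) (y := y) differentiableAt_id
  have h3 := h1.inner ℝ h2
  have h4 : (fun s : ℝ => inner ℝ (gradient (logGauge f) (y + s • X)) (y + s • X)) =ᶠ[𝓝 0]
      fun _ => (1 : ℝ) := by
    filter_upwards [(tendsto_line y X).eventually (isOpen_pos_first.mem_nhds hy)] with s hs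
    exact inner_gradient_logGauge_self hs
      ((contDiffAt_logGauge hf hs).differentiableAt (by simp))
  have h5 := h3.unique ((hasDerivAt_const 0 (1 : ℝ)).congr_of_eventuallyEq h4)
  simp only [zero_smul, add_zero, fderiv_fun_id, ContinuousLinearMap.id_apply] at h5
  rw [fderiv_gradient_selfAdjoint hC, inner_neg_left, real_inner_comm]
  linarith

theorem gradient_logGauge_smul (f : Space n → ℝ) {a : ℝ} (ha : 0 < a) {y : Space n}
    (hy : 0 < y 0) (hf : ContDiffOn ℝ 2 (radialExt f) (cone n)) :
    gradient (logGauge f) (a • y) = a⁻¹ • gradient (logGauge f) y := by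
  have hay : 0 < (a • y) 0 := by simpa using mul_pos ha hy
  refine ext_inner_right ℝ fun X => ?_
  rw [real_inner_smul_left, inner_gradient, inner_gradient]
  have h1 : HasFDerivAt (fun z : Space n => a • z) (a • ContinuousLinearMap.id ℝ (Space n)) y :=
    (hasFDerivAt_id y).const_smul a
  have h2 := (((contDiffAt_logGauge hf hay).differentiableAt (by simp)).hasFDerivAt).comp y h1
  have h3 : logGauge f ∘ (fun z : Space n => a • z) =ᶠ[𝓝 y] fun z => Real.log a + logGauge f z := by
    filter_upwards [isOpen_pos_first.mem_nhds hy] with z hz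
    exact logGauge_smul f ha (ne_zero_of_pos_first hz)
  have h4 := (((contDiffAt_logGauge hf hy).differentiableAt (by simp)).hasFDerivAt).const_add
    (Real.log a)
  have h5 := h2.unique (h4.congr_of_eventuallyEq h3)
  rw [← h5]
  simp [ha.ne']

theorem fderiv_gradient_logGauge_smul (f : Space n → ℝ) {a : ℝ} (ha : 0 < a) {y : Space n}
    (hy : 0 < y 0) (hf : ContDiffOn ℝ 2 (radialExt f) (cone n)) :
    fderiv ℝ (gradient (logGauge f)) (a • y)
      = (a⁻¹ * a⁻¹) • fderiv ℝ (gradient (logGauge f)) y := by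
  have hay : 0 < (a • y) 0 := by simpa using mul_pos ha hy
  have hd : ∀ {z : Space n}, 0 < z 0 → DifferentiableAt ℝ (gradient (logGauge f)) z := fun hz =>
    (contDiffAt_gradient (m := 1) (contDiffAt_logGauge hf hz)).differentiableAt (by simp)
  have h1 : HasFDerivAt (fun z : Space n => a • z) (a • ContinuousLinearMap.id ℝ (Space n)) y :=
    (hasFDerivAt_id y).const_smul a
  have h2 := (hd hay).hasFDerivAt.comp y h1
  have h3 : gradient (logGauge f) ∘ (fun z : Space n => a • z) =ᶠ[𝓝 y]
      fun z => a⁻¹ • gradient (logGauge f) z := by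
    filter_upwards [isOpen_pos_first.mem_nhds hy] with z hz
    exact gradient_logGauge_smul f ha hz hf
  have h5 := h2.unique (((hd hy).hasFDerivAt.const_smul a⁻¹).congr_of_eventuallyEq h3)
  rw [mul_smul, ← h5]
  ext1 X
  simp only [smul_apply, ContinuousLinearMap.comp_apply, ContinuousLinearMap.id_apply, map_smul]
  rw [inv_smul_smul₀ ha.ne']

/-- The speed has degree zero, so the evolution equation on the sphere extends to the open cone,
where it can be differentiated in every Euclidean direction. -/
theorem gaugeSpeed_smul (c k : ℝ) {a : ℝ} (ha : 0 < a) (y : Space n) (r : ℝ) (q : Space n)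
    (B : Space n →L[ℝ] Space n) :
    gaugeSpeed c k (a • y) (Real.log a + r) (a⁻¹ • q) (opForm ((a⁻¹ * a⁻¹) • B))
      = gaugeSpeed c k y r q (opForm B) := by
  have h1 : Real.exp (Real.log a + r) = a * Real.exp r := by rw [Real.exp_add, Real.exp_log ha]
  have h2 : ‖a⁻¹ • q‖ = a⁻¹ * ‖q‖ := by
    rw [norm_smul, Real.norm_of_nonneg (by positivity)]
  rcases eq_or_ne q 0 with rfl | hq
  · simp [gaugeSpeed, levelCurv, aniso]
  have h3 : aniso k (a⁻¹ • q) = a⁻¹ * aniso k q := by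
    rw [aniso, aniso, h2]; simp; ring
  have h4 : levelCurv (a⁻¹ • q) (opForm ((a⁻¹ * a⁻¹) • B)) = a⁻¹ * levelCurv q (opForm B) := by
    rw [levelCurv, levelCurv, h2]
    simp only [opForm_apply, smul_apply, map_smul, real_inner_smul_left, smul_eq_mul,
      ← Finset.mul_sum]
    field_simp
  rw [gaugeSpeed, gaugeSpeed, h1, h2, h3, h4]
  simp only [PiLp.smul_apply, smul_eq_mul]
  field_simp

/-- On the sphere the evolution of `log |y| - u` is the one prescribed by the scalar speed. -/
theorem scalarSpeed_eq_neg_gaugeSpeed (c θ : ℝ) {f : Space n → ℝ} {z : Space n}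
    (hf : ContDiffOn ℝ 2 (radialExt f) (cone n)) (hz : ‖z‖ = 1) (hz0 : 0 < z 0)
    (hh : 0 < height c z (f z)) :
    scalarSpeed c θ z (f z) (sphereGrad f z) (sphereHess f z)
      = -gaugeSpeed c (Real.cos θ) z (logGauge f z) (gradient (logGauge f) z)
        (opForm (fderiv ℝ (gradient (logGauge f)) z)) := by
  have hFC : ContDiffAt ℝ 2 (radialExt f) z := hf.contDiffAt (cone_mem_nhds hz0)
  have hgrad := sphereGrad_eq hz hz0 (hFC.differentiableAt (by simp))
  have hqz := inner_gradient_logGauge_self hz0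
    ((contDiffAt_logGauge hf hz0).differentiableAt (by simp))
  have hBz := fderiv_gradient_logGauge_self hz0 hf
  have hself := fderiv_gradient_selfAdjoint (contDiffAt_logGauge hf hz0)
  have hzne := ne_zero_of_pos_first hz0
  -- At |z| = 1 the Hessian of log|y| is the identity minus 2 z ⊗ z.
  have hHess : ∀ X Y, extDeriv2 f z X Y = inner ℝ X Y - 2 * inner ℝ z X * inner ℝ z Y
      - inner ℝ (fderiv ℝ (gradient (logGauge f)) z X) Y := by
    intro X Y
    rw [extDeriv2_eq hz0, ← inner_fderiv_gradient hFC]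
    have hlog : ∀ᶠ w in 𝓝 z, gradient (radialExt f) w
        = (‖w‖ ^ 2)⁻¹ • w - gradient (logGauge f) w := by
      filter_upwards [isOpen_pos_first.mem_nhds hz0] with w hw
      rw [gradient_logGauge (ne_zero_of_pos_first hw)
        ((hf.contDiffAt (cone_mem_nhds hw)).differentiableAt (by simp))]
      abel
    have h1 : HasFDerivAt (fun w : Space n => ‖w‖ ^ 2) (2 • innerSL ℝ z) z :=
      (hasStrictFDerivAt_norm_sq z).hasFDerivAt
    have h2 := ((hasDerivAt_inv (by simpa using hzne : ‖z‖ ^ 2 ≠ 0)).comp_hasFDerivAt z h1).smul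
      (hasFDerivAt_id z)
    have h3 := h2.sub ((contDiffAt_gradient (m := 1)
      (contDiffAt_logGauge hf hz0)).differentiableAt (by simp)).hasFDerivAt
    rw [(h3.congr_of_eventuallyEq hlog).fderiv, sub_apply, inner_sub_left]
    simp [hz, inner_add_left, real_inner_smul_left]
    ring
  set q := gradient (logGauge f) z with hq
  set B := fderiv ℝ (gradient (logGauge f)) z with hB
  have hq0 : q ≠ 0 := by intro h; rw [h] at hqz; simp at hqz
  have hzp : inner ℝ z (z - q) = 0 := by
    rw [inner_sub_right, real_inner_self_eq_norm_sq, hz, real_inner_comm, hqz]; norm_num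
  have hpn : ‖z - q‖ ^ 2 = ‖q‖ ^ 2 - 1 := by
    rw [norm_sub_sq_real, hz, real_inner_comm, hqz]; ring
  have hslope : slope (z - q) = ‖q‖ := by
    rw [slope, hpn, add_sub_cancel, Real.sqrt_sq (norm_nonneg _)]
  have htr : contractedHess (z - q) (sphereHess f z) = n - ‖q‖ * levelCurv q (opForm B) := by
    have hpp : tangentProj z (z - q) = z - q := by rw [tangentProj, hzp, zero_smul, sub_zero]
    have hsum := sum_perp (extDeriv2 f z) hz
    have h1 : ∑ i : Fin (n + 1), sphereHess f z (EuclideanSpace.single i 1)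
        (EuclideanSpace.single i 1) = n - 1 - ∑ i : Fin (n + 1),
          opForm B (EuclideanSpace.single i 1) (EuclideanSpace.single i 1) := by
      refine Eq.trans hsum ?_
      have h2 : ∑ i : Fin (n + 1), inner ℝ z (EuclideanSpace.single i 1)
          * inner ℝ z (EuclideanSpace.single i 1) = (1 : ℝ) := by
        have := sum_inner_sq_eq (EuclideanSpace.basisFun (Fin (n + 1)) ℝ) z
        rw [hz, one_pow] at this
        simpa only [EuclideanSpace.basisFun_apply, sq] using this
      simp only [hHess, Finset.sum_sub_distrib, mul_assoc, ← Finset.mul_sum, h2, opForm_apply, hBz,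
        inner_neg_left, hqz, real_inner_self_eq_norm_sq, hz]
      simp
      ring
    have h2 : sphereHess f z (z - q) (z - q) = -‖q‖ ^ 2 - opForm B q q := by
      have hBq : inner ℝ (B q) z = -‖q‖ ^ 2 := by
        rw [hself, hBz, inner_neg_right, real_inner_self_eq_norm_sq]
      rw [sphereHess, hpp, hHess, hzp, real_inner_self_eq_norm_sq, hpn, map_sub, hBz, opForm_apply]
      simp only [inner_sub_left, inner_sub_right, inner_neg_left, hqz, hBq,
        real_inner_self_eq_norm_sq]
      ring
    rw [contractedHess, h1, h2, hslope, levelCurv]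
    field_simp
    ring
  have hht : height c z (f z) = c + Real.exp (f z) * z (Fin.last n) := by
    simp [height, position, eLast]
  rw [hgrad, scalarSpeed_eq c θ z (f z) (z - q) _ hz hzp hh, htr, hslope, hpn,
    logGauge_of_norm_eq_one f hz, gaugeSpeed, Real.exp_neg, aniso, hht]
  have hexp := Real.exp_pos (f z)
  simp only [PiLp.sub_apply]
  field_simp
  ring

/-! ### One-sided calculus on the cone -/

/-- The disjunction treats interior points, with arbitrary directions, and boundary points, with
directions not pointing outwards, at the same time. -/
theorem eventually_ray_mem_cone {z X : Space n} (hz : z ∈ cone n) (hX : 0 < z 0 ∨ 0 ≤ X 0) :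
    ∀ᶠ s : ℝ in 𝓝[≥] 0, z + s • X ∈ cone n := by
  rcases hX with h | h
  · exact nhdsWithin_le_nhds ((tendsto_line z X).eventually (cone_mem_nhds h))
  · have h1 : ∀ᶠ s : ℝ in 𝓝[≥] 0, z + s • X ≠ 0 :=
      nhdsWithin_le_nhds ((tendsto_line z X).eventually (eventually_ne_nhds hz.2))
    filter_upwards [h1, self_mem_nhdsWithin] with s hs hs0
    refine ⟨?_, hs⟩
    have : 0 ≤ s * X 0 := mul_nonneg hs0 h
    simpa using add_nonneg hz.1 this

theorem hasDerivWithinAt_ray {G : Type*} [NormedAddCommGroup G] [NormedSpace ℝ G] {F : Space n → G}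
    {F' : Space n →L[ℝ] G} {z X : Space n} (hF : HasFDerivWithinAt F F' (cone n) z)
    (hz : z ∈ cone n) (hX : 0 < z 0 ∨ 0 ≤ X 0) :
    HasDerivWithinAt (fun s : ℝ => F (z + s • X)) (F' X) (Set.Ici 0) 0 := by
  have h : HasDerivAt (fun s : ℝ => z + s • X) X 0 := by
    simpa using ((hasDerivAt_id (0 : ℝ)).smul_const X).const_add z
  have h1 : HasDerivWithinAt (fun s : ℝ => F (z + s • X)) (F' X)
      {s : ℝ | z + s • X ∈ cone n} 0 :=
    HasFDerivWithinAt.comp_hasDerivWithinAt (f := fun s : ℝ => z + s • X) (t := cone n) 0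
      (by simpa using hF) h.hasDerivWithinAt fun s hs => hs
  exact h1.mono_of_mem_nhdsWithin (eventually_ray_mem_cone hz hX)

theorem deriv_nonpos_of_le_right {g : ℝ → ℝ} {g' : ℝ} (h : HasDerivWithinAt g g' (Set.Ici 0) 0)
    (hle : ∀ᶠ s in 𝓝[≥] (0 : ℝ), g s ≤ g 0) : g' ≤ 0 := by
  have h1 := (hasDerivWithinAt_iff_tendsto_slope' (by simp)).1 h.Ioi_of_Ici
  refine le_of_tendsto h1 ?_
  filter_upwards [nhdsWithin_mono 0 Set.Ioi_subset_Ici_self hle, self_mem_nhdsWithin] with s hs hs0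
  rw [slope_def_field, sub_zero]
  exact div_nonpos_of_nonpos_of_nonneg (by linarith) (le_of_lt hs0)

theorem deriv_nonneg_of_le_left {g : ℝ → ℝ} {g' t : ℝ} (ht : 0 < t) (h : HasDerivAt g g' t)
    (hle : ∀ s ∈ Set.Icc 0 t, g s ≤ g t) : 0 ≤ g' := by
  have h1 : HasDerivAt (fun s : ℝ => g (t - s)) (-g') 0 := by
    have h2 : HasDerivAt (fun s : ℝ => t - s) (-1) 0 := by
      simpa using (hasDerivAt_id (0 : ℝ)).const_sub t
    have h3 := HasDerivAt.comp (h₂ := g) (h := fun s : ℝ => t - s) 0 (by simpa using h) h2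
    simpa [Function.comp_def] using h3
  have h2 := deriv_nonpos_of_le_right h1.hasDerivWithinAt ?_
  · linarith
  · filter_upwards [self_mem_nhdsWithin, nhdsWithin_le_nhds (eventually_lt_nhds ht)] with s h3 h4
    simpa using hle (t - s) ⟨by linarith, by have : (0 : ℝ) ≤ s := h3; linarith⟩

theorem isCompact_closedHemisphere : IsCompact (closedHemisphere n) := by
  have h : closedHemisphere n = Metric.sphere 0 1 ∩ {z | 0 ≤ z 0} := by
    ext z; simp [closedHemisphere]
  rw [h]
  exact (isCompact_sphere 0 1).inter_right (isClosed_le continuous_const (by fun_prop))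

/-- If a continuous function which is initially negative becomes nonnegative, there is a first
time at which it vanishes. -/
theorem exists_first_touching {α : Type*} [TopologicalSpace α] [T2Space α] {K : Set α} (hK : IsCompact K)
    {f : ℝ → α → ℝ} {T : ℝ} (hf : ContinuousOn (fun p : ℝ × α => f p.1 p.2) (Set.Icc 0 T ×ˢ K))
    (h0 : ∀ z ∈ K, f 0 z < 0) {t₀ : ℝ} (ht₀ : t₀ ∈ Set.Icc 0 T) {z₀ : α} (hz₀ : z₀ ∈ K)
    (hfz : 0 ≤ f t₀ z₀) :
    ∃ t ∈ Set.Ioc 0 T, ∃ z ∈ K, f t z = 0 ∧ ∀ s ∈ Set.Icc 0 t, ∀ w ∈ K, f s w ≤ 0 := by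
  have hS : IsCompact ((Set.Icc 0 T ×ˢ K) ∩ (fun p : ℝ × α => f p.1 p.2) ⁻¹' Set.Ici 0) := by
    have hc : IsCompact (Set.Icc 0 T ×ˢ K) := isCompact_Icc.prod hK
    exact hc.of_isClosed_subset (hf.preimage_isClosed_of_isClosed hc.isClosed isClosed_Ici)
      Set.inter_subset_left
  -- The first touching point minimises time on the compact set where f ≥ 0.
  obtain ⟨⟨t, z⟩, ⟨⟨ht, hz⟩, hfz1⟩, hmin⟩ := hS.exists_isMinOn ⟨(t₀, z₀), ⟨ht₀, hz₀⟩, hfz⟩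
    continuous_fst.continuousOn
  have hbefore : ∀ s ∈ Set.Ico 0 t, ∀ w ∈ K, f s w < 0 := by
    intro s hs w hw
    by_contra! hcon
    have := hmin (a := (s, w)) ⟨⟨⟨hs.1, hs.2.le.trans ht.2⟩, hw⟩, hcon⟩
    exact absurd hs.2 (not_lt.2 this)
  have htpos : 0 < t := by
    rcases ht.1.eq_or_lt with h | h
    · have h1 : 0 ≤ f t z := hfz1
      have h2 : t = 0 := h.symm
      rw [h2] at h1
      exact absurd (h0 z hz) (not_lt.2 h1)
    · exact h
  have hle : ∀ s ∈ Set.Icc 0 t, ∀ w ∈ K, f s w ≤ 0 := by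
    intro s hs w hw
    rcases hs.2.eq_or_lt with rfl | h
    · have hc : ContinuousWithinAt (fun r => f r w) (Set.Ico 0 s) s := by
        have h1 : ContinuousOn (fun r => f r w) (Set.Icc 0 T) :=
          hf.comp (f := fun r => (r, w)) (by fun_prop) fun r hr => ⟨hr, hw⟩
        exact (h1 s ht).mono fun r hr => ⟨hr.1, hr.2.le.trans ht.2⟩
      have hne : (𝓝[Set.Ico 0 s] s).NeBot := by
        rw [← mem_closure_iff_nhdsWithin_neBot, closure_Ico htpos.ne]
        exact ⟨htpos.le, le_rfl⟩
      exact le_of_tendsto hc (eventually_mem_nhdsWithin.mono fun r hr => (hbefore r hr w hw).le)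
    · exact (hbefore s ⟨hs.1, h⟩ w hw).le
  exact ⟨t, ⟨htpos, ht.2⟩, z, hz, le_antisymm (hle t ⟨htpos.le, le_rfl⟩ z hz) hfz1, hle⟩

/-! ### First order data of the flow on the closed hemisphere -/

theorem hasFDerivWithinAt_radialExt {f : Space n → ℝ} {m : WithTop ℕ∞} (hm : m ≠ 0)
    (hf : ContDiffOn ℝ m (radialExt f) (cone n)) {y : Space n} (hy : y ∈ cone n) :
    HasFDerivWithinAt (radialExt f) (extDeriv f y) (cone n) y :=
  ((hf y hy).differentiableWithinAt hm).hasFDerivWithinAt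

theorem extDeriv_self {f : Space n → ℝ} {m : WithTop ℕ∞} (hm : m ≠ 0)
    (hf : ContDiffOn ℝ m (radialExt f) (cone n)) {y : Space n} (hy : y ∈ cone n) :
    extDeriv f y y = 0 := by
  have h1 := hasDerivWithinAt_ray (hasFDerivWithinAt_radialExt hm hf hy) hy (Or.inr hy.1)
  have h2 : HasDerivWithinAt (fun s : ℝ => radialExt f (y + s • y)) 0 (Set.Ici 0) 0 := by
    refine (hasDerivWithinAt_const 0 (Set.Ici 0) (radialExt f y)).congr (fun s hs => ?_) (by simp)
    have hs : (0 : ℝ) ≤ s := hs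
    rw [← radialExt_smul f (show 0 < 1 + s by linarith) y, add_smul, one_smul]
  exact (uniqueDiffWithinAt_Ici 0).eq_deriv _ h1 h2

theorem hasFDerivWithinAt_logGauge {f : Space n → ℝ} {m : WithTop ℕ∞} (hm : m ≠ 0)
    (hf : ContDiffOn ℝ m (radialExt f) (cone n)) {z : Space n} (hz : z ∈ closedHemisphere n) :
    HasFDerivWithinAt (logGauge f) (innerSL ℝ (z - sphereGrad f z)) (cone n) z := by
  have hzc := mem_cone_of_mem_closedHemisphere hz
  refine ((hasFDerivAt_log_norm hzc.2).hasFDerivWithinAt.sub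
    (hasFDerivWithinAt_radialExt hm hf hzc)).congr_fderiv ?_
  ext X
  simp [hz.1, sphereGrad]

theorem inner_sphereGrad_self {f : Space n → ℝ} {m : WithTop ℕ∞} (hm : m ≠ 0)
    (hf : ContDiffOn ℝ m (radialExt f) (cone n)) {z : Space n} (hz : z ∈ closedHemisphere n) :
    inner ℝ z (sphereGrad f z) = 0 := by
  rw [real_inner_comm, sphereGrad, InnerProductSpace.toDual_symm_apply,
    extDeriv_self hm hf (mem_cone_of_mem_closedHemisphere hz)]

/-- On the sphere v is the length of the gradient z - ∇u of the homogeneous extension, so bounds for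
that gradient are gradient bounds for u. -/
theorem slope_eq_norm_sub {z p : Space n} (hz : ‖z‖ = 1) (hzp : inner ℝ z p = 0) :
    slope p = ‖z - p‖ := by
  have h : ‖z - p‖ ^ 2 = 1 + ‖p‖ ^ 2 := by rw [norm_sub_sq_real, hz, hzp]; ring
  rw [slope, ← h, Real.sqrt_sq (norm_nonneg _)]

section Flow

variable {c θ : ℝ} {u₀ : Space n → ℝ} {Tstar : EReal} {u : ℝ → Space n → ℝ}

/-- The capillary boundary condition for the normal direction `z - ∇u`. -/
theorem IsScalarFlow.boundary_normal (hu : IsScalarFlow c θ u₀ Tstar u) {t : ℝ}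
    (ht : t ∈ timeInterval Tstar) {z : Space n} (hz : z ∈ hemisphereBoundary n) :
    (z - sphereGrad (u t) z) 0 = Real.cos θ * ‖z - sphereGrad (u t) z‖ := by
  have hzc : z ∈ closedHemisphere n := ⟨hz.1, hz.2.ge⟩
  have h := hu.boundary t ht z hz
  rw [slope_eq_norm_sub hz.1 (inner_sphereGrad_self two_ne_zero (hu.contDiff_two t ht) hzc),
    inner_neg_right, real_inner_comm, inner_eFirst] at h
  rw [PiLp.sub_apply, hz.2]
  linarith

/-- The evolution of `log |y| - u` in the open cone. -/
theorem IsScalarFlow.hasDerivAt_logGauge (hu : IsScalarFlow c θ u₀ Tstar u) {t : ℝ} (ht0 : 0 < t)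
    (ht : (t : EReal) < Tstar) {y : Space n} (hy : 0 < y 0) :
    HasDerivAt (fun s => logGauge (u s) y)
      (gaugeSpeed c (Real.cos θ) y (logGauge (u t) y) (gradient (logGauge (u t)) y)
        (opForm (fderiv ℝ (gradient (logGauge (u t))) y))) t := by
  have hyne := ne_zero_of_pos_first hy
  have hyn : 0 < ‖y‖ := norm_pos_iff.2 hyne
  have htI : t ∈ timeInterval Tstar := ⟨ht0.le, ht⟩
  have hC := hu.contDiff_two t htI
  set z := ‖y‖⁻¹ • y with hz
  have hz1 : ‖z‖ = 1 := norm_smul_inv_self hyne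
  have hz0 : 0 < z 0 := by simpa [hz] using mul_pos (inv_pos.2 hyn) hy
  have hyz : y = ‖y‖ • z := by rw [hz, smul_inv_smul₀ hyn.ne']
  have hnhds : timeInterval Tstar ∈ 𝓝 t := by
    have h1 : ∀ᶠ s : ℝ in 𝓝 t, (s : EReal) < Tstar :=
      continuous_coe_real_ereal.continuousAt.eventually (eventually_lt_nhds ht)
    filter_upwards [eventually_gt_nhds ht0, h1] with s h2 h3 using ⟨h2.le, h3⟩
  have h1 := (hu.evolution t htI z ⟨hz1, hz0⟩).hasDerivAt hnhds
  rw [scalarSpeed_eq_neg_gaugeSpeed c θ hC hz1 hz0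
    (hu.height_pos t htI z ⟨hz1, hz0.le⟩)] at h1
  have h2 := h1.const_sub (Real.log ‖y‖)
  rw [neg_neg, ← gaugeSpeed_smul c _ hyn, ← logGauge_smul _ hyn (ne_zero_of_pos_first hz0),
    ← gradient_logGauge_smul _ hyn hz0 hC, ← fderiv_gradient_logGauge_smul _ hyn hz0 hC, ← hyz]
    at h2
  exact h2

end Flow

/-! ### Comparison of the flow with moving spheres. -/

/-- First order condition where the radial graph of `e^f` touches a sphere from inside. -/
theorem inner_le_of_touching {f : Space n → ℝ} {m : WithTop ℕ∞} (hm : m ≠ 0)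
    (hf : ContDiffOn ℝ m (radialExt f) (cone n)) {z b X : Space n} {s : ℝ}
    (hz : z ∈ closedHemisphere n)
    (hle : ∀ y ∈ cone n, ‖Real.exp (-logGauge f y) • y - b‖ ^ 2 ≤ s ^ 2)
    (heq : ‖Real.exp (-logGauge f z) • z - b‖ ^ 2 = s ^ 2) (hX : 0 < z 0 ∨ 0 ≤ X 0) :
    Real.exp (-logGauge f z) * inner ℝ (Real.exp (-logGauge f z) • z - b) X
      ≤ inner ℝ (Real.exp (-logGauge f z) • z - b) (Real.exp (-logGauge f z) • z)
        * inner ℝ (z - sphereGrad f z) X := by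
  have hzc := mem_cone_of_mem_closedHemisphere hz
  have h1 := hasDerivWithinAt_ray (hasFDerivWithinAt_logGauge hm hf hz) hzc hX
  have h2 : HasDerivWithinAt (fun s : ℝ => z + s • X) X (Set.Ici 0) 0 := by
    have : HasDerivAt (fun s : ℝ => z + s • X) X 0 := by
      simpa using ((hasDerivAt_id (0 : ℝ)).smul_const X).const_add z
    exact this.hasDerivWithinAt
  have h3 := ((h1.neg.exp.smul h2).sub_const b).norm_sq
  have h4 := deriv_nonpos_of_le_right h3 ?_
  · simp only [Pi.neg_apply, Pi.smul_apply', zero_smul, add_zero, coe_innerSL_apply, inner_add_right,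
      real_inner_smul_right] at h4
    rw [real_inner_smul_right]
    nlinarith
  · filter_upwards [eventually_ray_mem_cone hzc hX] with r hr
    have := hle _ hr
    simpa [heq] using this

/-- At an interior touching point, the mean curvature of the radial graph is at least the one of
the sphere. -/
theorem levelCurv_ge_of_touching {f : Space n → ℝ}
    (hf : ContDiffOn ℝ 2 (radialExt f) (cone n)) {z b : Space n} {s : ℝ} (hs : 0 < s)
    (hz0 : 0 < z 0)
    (hle : ∀ y ∈ cone n, ‖Real.exp (-logGauge f y) • y - b‖ ^ 2 ≤ s ^ 2)
    (heq : ‖Real.exp (-logGauge f z) • z - b‖ ^ 2 = s ^ 2)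
    (hq : inner ℝ (Real.exp (-logGauge f z) • z - b) (Real.exp (-logGauge f z) • z)
      * ‖gradient (logGauge f) z‖ = Real.exp (-logGauge f z) * s) :
    n * Real.exp (-logGauge f z) ≤ s * levelCurv (gradient (logGauge f) z)
        (opForm (fderiv ℝ (gradient (logGauge f)) z)) := by
  have hC := contDiffAt_logGauge hf hz0
  have hd : DifferentiableAt ℝ (gradient (logGauge f)) z :=
    (contDiffAt_gradient (m := 1) hC).differentiableAt (by simp)
  set V := logGauge f with hV
  set q := gradient V z with hqd
  set B := fderiv ℝ (gradient V) z with hB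
  set e := Real.exp (-V z) with he
  have he0 : 0 < e := Real.exp_pos _
  set lam := inner ℝ (e • z - b) (e • z) with hlam
  have hq0 : q ≠ 0 := by
    intro h; rw [h, norm_zero, mul_zero] at hq; exact (mul_pos he0 hs).ne hq
  have hw1 : ‖‖q‖⁻¹ • q‖ = 1 := norm_smul_inv_self hq0
  -- The second derivative test for the squared distance to the centre. On directions orthogonal to
  -- `q` the first derivative of the radius function vanishes, so only its second derivative enters.
  have key : ∀ X, inner ℝ q X = 0 → e ^ 2 * ‖X‖ ^ 2 ≤ lam * inner ℝ (B X) X := by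
    intro X hX
    have hline : ∀ᶠ r : ℝ in 𝓝 0, HasDerivAt
        (fun r : ℝ => ‖Real.exp (-V (z + r • X)) • (z + r • X) - b‖ ^ 2)
        (2 * inner ℝ (Real.exp (-V (z + r • X)) • (z + r • X) - b)
          (Real.exp (-V (z + r • X)) • X + (Real.exp (-V (z + r • X))
            * -inner ℝ (gradient V (z + r • X)) X) • (z + r • X))) r := by
      filter_upwards [(tendsto_line z X).eventually (isOpen_pos_first.mem_nhds hz0)] with r hr
      have h1 := hasDerivAt_line (X := X) (s := r) (y := z) (F := V)
        ((contDiffAt_logGauge hf hr).differentiableAt (by simp))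
      rw [← inner_gradient] at h1
      have h2 : HasDerivAt (fun s : ℝ => z + s • X) X r := by
        simpa using ((hasDerivAt_id r).smul_const X).const_add z
      exact ((h1.neg.exp.smul h2).sub_const b).norm_sq
    have hV1 : HasDerivAt (fun r : ℝ => V (z + r • X)) 0 0 := by
      have h1 := hasDerivAt_line (X := X) (s := 0) (y := z) (F := V)
        (by simpa using hC.differentiableAt (by simp))
      rw [← inner_gradient, zero_smul, add_zero, hX] at h1
      exact h1
    have hV2 : HasDerivAt (fun r : ℝ => inner ℝ (gradient V (z + r • X)) X)
        (inner ℝ (B X) X) 0 := by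
      have h1 := hasDerivAt_line (X := X) (s := 0) (y := z) (F := gradient V) (by simpa using hd)
      have h2 := h1.inner ℝ (hasDerivAt_const (0 : ℝ) X)
      simpa using h2
    have h2 : HasDerivAt (fun s : ℝ => z + s • X) X 0 := by
      simpa using ((hasDerivAt_id (0 : ℝ)).smul_const X).const_add z
    have hE := hV1.neg.exp
    have hsec := ((hE.smul h2).sub_const b).inner ℝ
      ((hE.smul (hasDerivAt_const (0 : ℝ) X)).add ((hE.mul hV2.neg).smul h2))
    have hsec2 := hsec.const_mul 2
    have hmax : IsLocalMax
        (fun r : ℝ => ‖Real.exp (-V (z + r • X)) • (z + r • X) - b‖ ^ 2) 0 := by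
      filter_upwards [(tendsto_line z X).eventually (cone_mem_nhds hz0)] with r hr
      have := hle _ hr
      simpa [← he, heq] using this
    have h4 := second_deriv_nonpos_of_isLocalMax hmax hline hsec2
    simp only [Pi.neg_apply, Pi.smul_apply', Pi.mul_apply, Pi.add_apply, zero_smul, add_zero,
      ← hqd, hX, ← he] at h4
    simp only [neg_zero, mul_zero, zero_smul, add_zero, zero_add, smul_zero,
      real_inner_smul_right, real_inner_self_eq_norm_sq] at h4
    rw [norm_smul, mul_pow, Real.norm_of_nonneg he0.le] at h4
    rw [hlam, real_inner_smul_right]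
    nlinarith
  have hsum : n * e ^ 2 ≤ lam * (‖q‖ * levelCurv q (opForm B)) := by
    rw [levelCurv_eq_sum_perp hq0, mul_inv_cancel_left₀ (norm_ne_zero_iff.2 hq0), Finset.mul_sum,
      mul_comm, ← sum_norm_sq_perp hw1, Finset.mul_sum]
    refine Finset.sum_le_sum fun i _ => key _ ?_
    have := inner_perp_self hw1 (EuclideanSpace.single i 1)
    rw [real_inner_smul_left] at this
    exact (mul_eq_zero.1 this).resolve_left (inv_ne_zero (norm_ne_zero_iff.2 hq0))
  rw [← mul_assoc, hq] at hsum
  have : e * (n * e) ≤ e * (s * levelCurv q (opForm B)) := by nlinarith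
  exact le_of_mul_le_mul_left this he0

/-- The direction of the gradient where the radial graph touches a sphere whose contact angle is
smaller than the one of the radial graph: the touching point is interior, and the gradient is
normal to the sphere. -/
theorem gradient_of_touching {f : Space n → ℝ} {k k' : ℝ} (hkk : k < k')
    (hf : ContDiffOn ℝ 2 (radialExt f) (cone n)) {z b : Space n} {s : ℝ} (hs : 0 < s)
    (hz : z ∈ closedHemisphere n)
    (hle : ∀ y ∈ cone n, ‖Real.exp (-logGauge f y) • y - b‖ ^ 2 ≤ s ^ 2)
    (heq : ‖Real.exp (-logGauge f z) • z - b‖ ^ 2 = s ^ 2)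
    (hlam : 0 < inner ℝ (Real.exp (-logGauge f z) • z - b) (Real.exp (-logGauge f z) • z))
    (hb0 : b 0 = -(s * k'))
    (hbd : z 0 = 0 → (z - sphereGrad f z) 0 = k * ‖z - sphereGrad f z‖) :
    0 < z 0 ∧ inner ℝ (Real.exp (-logGauge f z) • z - b) (Real.exp (-logGauge f z) • z)
      • (z - sphereGrad f z) = Real.exp (-logGauge f z) • (Real.exp (-logGauge f z) • z - b) := by
  have hfirst := fun X => inner_le_of_touching (X := X) two_ne_zero hf hz hle heq
  set e := Real.exp (-logGauge f z) with he
  have he0 : 0 < e := Real.exp_pos _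
  set D := e • z - b with hD
  set lam := inner ℝ D (e • z) with hl
  set q := z - sphereGrad f z with hq
  have hDn : ‖D‖ = s := by
    rw [← Real.sqrt_sq (norm_nonneg D), heq, Real.sqrt_sq hs.le]
  have hqz : inner ℝ q z = 1 := by
    rw [hq, inner_sub_left, real_inner_self_eq_norm_sq, hz.1,
      real_inner_comm, inner_sphereGrad_self two_ne_zero hf hz]
    norm_num
  have hq0 : q ≠ 0 := by intro h; rw [h] at hqz; simp at hqz
  have hv : 0 < ‖q‖ := norm_pos_iff.2 hq0
  have hz0 : 0 < z 0 := by
    rcases hz.2.eq_or_lt with h | h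
    · exfalso
      have hD0 : D 0 = s * k' := by rw [hD]; simp [← h, hb0]
      -- At a boundary point this test vector has first component |q| s (k' - k) > 0, so it is
      -- admissible. The first order condition then forces equality in Cauchy–Schwarz, so D and q
      -- are parallel; comparing first components gives k' = k, a contradiction.
      have hX := hfirst (‖q‖ • D - s • q) (Or.inr (by
        simp only [PiLp.sub_apply, PiLp.smul_apply, smul_eq_mul, hD0, hbd h.symm]
        nlinarith [mul_pos hv hs]))
      simp only [inner_sub_right, real_inner_smul_right, real_inner_self_eq_norm_sq, hDn] at hX
      have hcs : inner ℝ D q ≤ s * ‖q‖ := by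
        rw [← hDn]; exact real_inner_le_norm D q
      rw [real_inner_comm D q] at hX
      have h5 : inner ℝ D q = ‖D‖ * ‖q‖ := by
        rw [hDn]
        refine le_antisymm hcs ?_
        by_contra! hlt
        have h6 : 0 < s * ‖q‖ - inner ℝ D q := by linarith
        nlinarith [mul_pos (mul_pos he0 hs) h6, mul_pos (mul_pos hlam hv) h6]
      have h7 := inner_eq_norm_mul_iff_real.1 h5
      have h8 := congrArg (fun x : Space n => x 0) h7
      simp only [PiLp.smul_apply, smul_eq_mul, hD0, hbd h.symm, hDn] at h8
      have : ‖q‖ * s * (k' - k) = 0 := by linarith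
      nlinarith [mul_pos (mul_pos hv hs) (sub_pos.2 hkk)]
    · exact h
  refine ⟨hz0, ?_⟩
  refine ext_inner_right ℝ fun X => ?_
  rw [real_inner_smul_left, real_inner_smul_left]
  have h1 := hfirst X (Or.inl hz0)
  have h2 := hfirst (-X) (Or.inl hz0)
  simp only [inner_neg_right] at h2
  linarith

/-- The vector is the point of the graph, relative to c E_{n+1}, on the ray through y. Conditions on
the hemisphere thus become conditions on the cone. -/
theorem exp_neg_logGauge_smul (f : Space n → ℝ) {y : Space n} (hy : y ≠ 0) :
    Real.exp (-logGauge f y) • y = Real.exp (f (‖y‖⁻¹ • y)) • (‖y‖⁻¹ • y) := by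
  have h : Real.exp (-logGauge f y) = Real.exp (f (‖y‖⁻¹ • y)) * ‖y‖⁻¹ := by
    rw [logGauge, radialExt, neg_sub, Real.exp_sub, Real.exp_log (norm_pos_iff.2 hy),
      div_eq_mul_inv]
  rw [h, smul_smul]

theorem normalize_mem_closedHemisphere {y : Space n} (hy : y ∈ cone n) :
    ‖y‖⁻¹ • y ∈ closedHemisphere n :=
  ⟨norm_smul_inv_self hy.2, by simpa using mul_nonneg (inv_nonneg.2 (norm_nonneg y)) hy.1⟩

theorem eFirst_last (hn : 1 ≤ n) : eFirst n (Fin.last n) = 0 := by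
  have : Fin.last n ≠ 0 := by
    intro h; have := congrArg Fin.val h; simp at this; omega
  simp [eFirst, this]

theorem eLast_first (hn : 1 ≤ n) : eLast n 0 = 0 := by
  have : (0 : Fin (n + 1)) ≠ Fin.last n := by
    intro h; have := congrArg Fin.val h; simp at this; omega
  simp [eLast, this]

/-- The speed of the radial graph at a point where it touches a sphere from inside. -/
theorem gaugeSpeed_ge_of_touching {z q D : Space n} {b : Space n →L[ℝ] Space n →L[ℝ] ℝ}
    {c k r s lam : ℝ} (hs : 0 < s) (hlam : 0 < lam)
    (hheight : 0 < c + Real.exp (-r) * z (Fin.last n)) (hvec : lam • q = Real.exp (-r) • D)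
    (hnorm : lam * ‖q‖ = Real.exp (-r) * s)
    (hDl : D (Fin.last n) = Real.exp (-r) * z (Fin.last n))
    (hH : n * Real.exp (-r) ≤ s * levelCurv q b) :
    -(n * c * (s - k * D 0)) + n * c * (lam / s) ≤ lam * gaugeSpeed c k z r q b := by
  have hE : Real.exp r = (Real.exp (-r))⁻¹ := by rw [Real.exp_neg, inv_inv]
  have he0 := Real.exp_pos (-r)
  rw [gaugeSpeed, hE]
  set e := Real.exp (-r)
  have hcoord : ∀ i, lam * q i = e * D i := fun i => by
    have := congrArg (fun x : Space n => x i) hvec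
    simpa using this
  have h1 : lam * aniso k q = e * (s - k * D 0) := by
    rw [aniso, mul_sub, hnorm]; linear_combination -k * hcoord 0
  have hqpos : 0 < ‖q‖ := by
    have : 0 < lam * ‖q‖ := by rw [hnorm]; positivity
    exact pos_of_mul_pos_right this hlam.le
  have h2 : q (Fin.last n) / ‖q‖ = e * z (Fin.last n) / s := by
    rw [div_eq_div_iff hqpos.ne' hs.ne']
    have h3 := hcoord (Fin.last n)
    rw [hDl] at h3
    have h4 : lam * (q (Fin.last n) * s) = lam * (e * z (Fin.last n) * ‖q‖) := by
      linear_combination s * h3 - e * z (Fin.last n) * hnorm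
    exact mul_left_cancel₀ hlam.ne' h4
  set H := levelCurv q b
  have h5 : lam * (-(n * c * e⁻¹ * aniso k q) + (c * e⁻¹ + z (Fin.last n)) * H
      - n * (q (Fin.last n) / ‖q‖)) = -(n * c * (s - k * D 0))
      + lam / s * (e⁻¹ * ((c + e * z (Fin.last n)) * (s * H)) - n * (e * z (Fin.last n))) := by
    rw [h2]
    have : lam * (n * c * e⁻¹ * aniso k q) = n * c * (s - k * D 0) := by
      rw [show lam * (n * c * e⁻¹ * aniso k q) = n * c * e⁻¹ * (lam * aniso k q) by ring, h1]
      field_simp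
    rw [mul_sub, mul_add, mul_neg, this]
    field_simp
    ring
  rw [h5]
  -- With this bound the terms in z_{n+1} in `h5` cancel and exactly nc remains.
  have h6 : n * (c + e * z (Fin.last n)) ≤ e⁻¹ * ((c + e * z (Fin.last n)) * (s * H)) := by
    calc n * (c + e * z (Fin.last n)) = e⁻¹ * ((c + e * z (Fin.last n)) * (n * e)) := by
          field_simp
      _ ≤ _ := by gcongr
  have h8 : 0 < lam / s := by positivity
  nlinarith

/-- Admissible parameters for a slightly larger cap with a slightly smaller contact angle. -/
theorem cap_parameters {R k ε η : ℝ} (hR : 0 < R) (hk : |k| < 1) (hε : 0 < ε) (hεR : ε ≤ R / 2)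
    (hη : R * η = (1 - k ^ 2) / 8) :
    0 < η * ε ∧ η * ε ≤ (1 - |k|) / 8 ∧ |k + η * ε| ≤ |k| + η * ε ∧
      ∀ s ≥ R + ε, R ^ 2 * (1 - k ^ 2) ≤ s ^ 2 * (1 - (k + η * ε) ^ 2) := by
  have hd0 : 0 < 1 - k ^ 2 := by nlinarith [sq_abs k, abs_nonneg k]
  have hd2 : 1 - k ^ 2 ≤ 2 * (1 - |k|) := by nlinarith [sq_abs k, abs_nonneg k]
  have hη0 : 0 < η := by
    have : 0 < R * η := by rw [hη]; positivity
    exact pos_of_mul_pos_right this hR.le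
  have hηε0 : 0 < η * ε := by positivity
  have h0 : η * ε ≤ (1 - k ^ 2) / 16 := by
    have : η * ε ≤ η * (R / 2) := by gcongr
    linarith
  have hk' : |k + η * ε| ≤ |k| + η * ε := (abs_add_le _ _).trans_eq (by rw [abs_of_pos hηε0])
  refine ⟨hηε0, by linarith, hk', fun s hs => ?_⟩
  set k' := k + η * ε
  set d := 1 - k ^ 2 with hd
  have h3 : d - 2 * (η * ε) ≤ 1 - k' ^ 2 := by
    have h31 : k' ^ 2 ≤ (|k| + η * ε) ^ 2 := by
      rw [← sq_abs k']; gcongr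
    nlinarith [sq_abs k, abs_nonneg k]
  have h4 : 0 ≤ d - 2 * (η * ε) := by linarith
  -- Enlarging the radius gains 2Rdε to first order, while the change of angle costs 2R²ηε = Rdε/4.
  have h5 : R ^ 2 * d ≤ (R + ε) ^ 2 * (d - 2 * (η * ε)) := by
    have e3 : 0 ≤ 2 * R * d + ε * d - 2 * (R * η) * R - 4 * (R * η) * ε - 2 * (η * ε) * ε := by
      rw [hη]
      nlinarith [mul_pos hR hd0, mul_pos hε hd0]
    nlinarith [mul_nonneg hε.le e3]
  calc R ^ 2 * d ≤ (R + ε) ^ 2 * (d - 2 * (η * ε)) := h5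
    _ ≤ s ^ 2 * (1 - k' ^ 2) := by gcongr

/-- The moving caps are strict barriers. -/
theorem cap_strict {R k ε η m σ C p x : ℝ} (hR : 0 < R) (hk : |k| < 1) (hε : 0 < ε)
    (hεR : ε ≤ R / 2) (hη : R * η = (1 - k ^ 2) / 8) (hm : 0 < m)
    (hC : C * (1 - |k|) = 4 * (m / R + m * η)) (hσ : ε ≤ σ) (hp : |p| ≤ R) (hx : |x| ≤ 1) :
    m * (-p + (R + σ) * (k + η * ε - k) * x) - (R + σ) * (-(m / R) * p)
      - (R + σ) * (σ * C) * (1 - (k + η * ε) * x) < 0 := by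
  obtain ⟨hηε0, hηε, hk', -⟩ := cap_parameters hR hk hε hεR hη
  have hη0 : 0 < η := pos_of_mul_pos_left hηε0 hε.le
  have hσ0 : 0 < σ := by linarith
  have hk1 : 0 < 1 - |k| := by linarith
  have hC0 : 0 < C := by
    have : 0 < C * (1 - |k|) := by rw [hC]; positivity
    exact pos_of_mul_pos_left this hk1.le
  have h3 : (k + η * ε - k) * x ≤ η * σ := by
    rw [add_sub_cancel_left]
    calc η * ε * x ≤ η * ε * 1 := by gcongr; exact (abs_le.1 hx).2
      _ ≤ η * σ := by rw [mul_one]; gcongr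
  set k' := k + η * ε
  have h4 : (1 - |k|) / 2 ≤ 1 - k' * x := by
    have : k' * x ≤ |k'| * 1 := (le_abs_self _).trans (by rw [abs_mul]; gcongr)
    linarith
  have h5 : m / R * σ * p ≤ m / R * σ * (R + σ) := by
    gcongr
    linarith [le_abs_self p]
  have h6 : (R + σ) * (σ * C) * ((1 - |k|) / 2) ≤ (R + σ) * (σ * C) * (1 - k' * x) := by gcongr
  have h7 : (R + σ) * (σ * C) * ((1 - |k|) / 2) = 2 * (R + σ) * σ * (m / R + m * η) := by
    linear_combination (R + σ) * σ / 2 * hC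
  have h8 : m * ((R + σ) * ((k' - k) * x)) ≤ m * ((R + σ) * (η * σ)) := by gcongr
  have h9 : 0 < (R + σ) * σ * (m / R + m * η) := by positivity
  have h10 : m / R * R = m := by field_simp
  -- For the unperturbed cap the two terms in p cancel. What the perturbation leaves is at most (R +
  -- σ)σ(m/R + mη), half of what `h7` provides through the growth rate C.
  have h11 : m * (-p + (R + σ) * (k' - k) * x) - (R + σ) * (-(m / R) * p)
      = m * ((R + σ) * ((k' - k) * x)) + m / R * σ * p := by
    linear_combination p * h10
  linarith

/-! ### Confinement of the flow to contracting caps. -/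

section Flow

variable {c θ : ℝ} {u₀ : Space n → ℝ} {Tstar : EReal} {u : ℝ → Space n → ℝ}

theorem IsScalarFlow.continuousOn_hemisphere (hu : IsScalarFlow c θ u₀ Tstar u) {T : ℝ}
    (hT : (T : EReal) < Tstar) :
    ContinuousOn (fun p : ℝ × Space n => u p.1 p.2) (Set.Icc 0 T ×ˢ closedHemisphere n) := by
  have hsub : Set.Icc 0 T ×ˢ closedHemisphere n ⊆ timeInterval Tstar ×ˢ cone n := fun p hp =>
    ⟨⟨hp.1.1, lt_of_le_of_lt (by exact_mod_cast hp.1.2) hT⟩,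
      mem_cone_of_mem_closedHemisphere hp.2⟩
  refine (hu.continuousOn_value.mono hsub).congr fun p hp => ?_
  exact (radialExt_of_norm_eq_one _ hp.2.1).symm

/-- Moving spheres with a slightly smaller contact angle are barriers for the flow. -/
theorem IsScalarFlow.norm_lt_of_barrier (hn : 1 ≤ n) (hu : IsScalarFlow c θ u₀ Tstar u) {T : ℝ}
    (hT : (T : EReal) < Tstar) {a a' : ℝ → Space n} {s s' : ℝ → ℝ} {k' : ℝ}
    (hk : Real.cos θ < k') (ha : ∀ t, HasDerivAt a (a' t) t) (hs : ∀ t, HasDerivAt s (s' t) t)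
    (ha0 : ∀ t, a t 0 = 0) (hal : ∀ t, a t (Fin.last n) = 0) (hs0 : ∀ t ≥ 0, 0 < s t)
    (hab : ∀ t ≥ 0, ‖a t‖ ^ 2 + (s t * k') ^ 2 ≤ s t ^ 2)
    (hstrict : ∀ t ≥ 0, ∀ w : Space n, ‖w‖ = 1 →
      n * c * (-inner ℝ (a t) w + s t * (k' - Real.cos θ) * w 0) - s t * inner ℝ (a' t) w
        - s t * s' t * (1 - k' * w 0) < 0)
    (hinit : ∀ z ∈ closedHemisphere n,
      ‖Real.exp (u 0 z) • z - (a 0 - (s 0 * k') • eFirst n)‖ < s 0) :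
    ∀ t ∈ Set.Icc 0 T, ∀ z ∈ closedHemisphere n,
      ‖Real.exp (u t z) • z - (a t - (s t * k') • eFirst n)‖ < s t := by
  intro t₀ ht₀ z₀ hz₀
  by_contra! hcon
  set b : ℝ → Space n := fun t => a t - (s t * k') • eFirst n with hb
  have hbd : ∀ t, HasDerivAt b (a' t - (s' t * k') • eFirst n) t := fun t =>
    (ha t).sub (((hs t).mul_const k').smul_const (eFirst n))
  have hcont : ContinuousOn (fun p : ℝ × Space n =>
      ‖Real.exp (u p.1 p.2) • p.2 - b p.1‖ ^ 2 - s p.1 ^ 2) (Set.Icc 0 T ×ˢ closedHemisphere n) := by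
    have h1 : Continuous b := continuous_iff_continuousAt.2 fun t => (hbd t).continuousAt
    have h2 : Continuous s := continuous_iff_continuousAt.2 fun t => (hs t).continuousAt
    have h3 := hu.continuousOn_hemisphere hT
    fun_prop
  obtain ⟨t, ht, z, hz, hfz, hle⟩ := exists_first_touching isCompact_closedHemisphere
    (f := fun t z => ‖Real.exp (u t z) • z - b t‖ ^ 2 - s t ^ 2) hcont
    (fun z hz => by
      have := hinit z hz
      have h1 := hs0 0 le_rfl
      have h2 := norm_nonneg (Real.exp (u 0 z) • z - b 0)
      nlinarith) ht₀ hz₀ (by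
      have h1 := hs0 t₀ ht₀.1
      nlinarith)
  have htpos : 0 < t := ht.1
  have htS : (t : EReal) < Tstar := lt_of_le_of_lt (by exact_mod_cast ht.2) hT
  have htI : t ∈ timeInterval Tstar := ⟨htpos.le, htS⟩
  have hC := hu.contDiff_two t htI
  have hst := hs0 t htpos.le
  have hzc := mem_cone_of_mem_closedHemisphere hz
  have hle' : ∀ r ∈ Set.Icc 0 t, ∀ y ∈ cone n,
      ‖Real.exp (-logGauge (u r) y) • y - b r‖ ^ 2 ≤ s r ^ 2 := by
    intro r hr y hy
    rw [exp_neg_logGauge_smul _ hy.2]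
    linarith [hle r hr _ (normalize_mem_closedHemisphere hy)]
  have heq : ‖Real.exp (-logGauge (u t) z) • z - b t‖ ^ 2 = s t ^ 2 := by
    rw [logGauge_of_norm_eq_one _ hz.1, neg_neg]; linarith
  have hexp : Real.exp (u t z) = Real.exp (-logGauge (u t) z) := by
    rw [logGauge_of_norm_eq_one _ hz.1, neg_neg]
  have hheight : 0 < c + Real.exp (-logGauge (u t) z) * z (Fin.last n) := by
    have := hu.height_pos t htI z hz
    rw [height, position, hexp] at this
    simpa [eLast] using this
  set e := Real.exp (-logGauge (u t) z) with he
  have he0 : 0 < e := Real.exp_pos _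
  set D := e • z - b t with hD
  have hDn : ‖D‖ = s t := by
    rw [← Real.sqrt_sq (norm_nonneg D), heq, Real.sqrt_sq hst.le]
  have hb0 : b t 0 = -(s t * k') := by simp [hb, ha0, eFirst]
  have hbl : b t (Fin.last n) = 0 := by simp [hb, hal, eFirst_last hn]
  have hbn : ‖b t‖ ^ 2 = ‖a t‖ ^ 2 + (s t * k') ^ 2 := by
    rw [hb]
    simp only []
    rw [norm_sub_sq_real, real_inner_smul_right, real_inner_comm, inner_eFirst, ha0, norm_smul,
      norm_eFirst, mul_one, Real.norm_eq_abs, sq_abs]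
    ring
  set lam := inner ℝ D (e • z) with hlamd
  -- By `hab` the centre of the radial graph lies in the ball, and a ball is star-shaped about each
  -- of its points.
  have hlam : 0 < lam := by
    have h1 : ‖b t‖ ^ 2 = ‖e • z‖ ^ 2 - 2 * inner ℝ (e • z) D + ‖D‖ ^ 2 := by
      rw [← norm_sub_sq_real, hD, sub_sub_cancel]
    have h2 : ‖e • z‖ ^ 2 = e ^ 2 := by
      rw [norm_smul, hz.1, mul_one, Real.norm_of_nonneg he0.le]
    rw [real_inner_comm, ← hlamd, h2, hDn, hbn] at h1
    have h3 : 0 < e ^ 2 := by positivity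
    linarith [hab t htpos.le]
  obtain ⟨hz0, hvec⟩ := gradient_of_touching hk hC hst hz (hle' t ⟨htpos.le, le_rfl⟩) heq hlam hb0
    (fun h => hu.boundary_normal htI ⟨hz.1, h⟩)
  rw [sphereGrad_eq hz.1 hz0 ((hC.contDiffAt (cone_mem_nhds hz0)).differentiableAt (by simp)),
    sub_sub_cancel, ← he] at hvec
  change lam • gradient (logGauge (u t)) z = e • D at hvec
  have hG := hu.hasDerivAt_logGauge htpos htS hz0
  have hnorm : lam * ‖gradient (logGauge (u t)) z‖ = e * s t := by
    have := congrArg norm hvec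
    rwa [norm_smul, norm_smul, Real.norm_of_nonneg hlam.le, Real.norm_of_nonneg he0.le, hDn]
      at this
  have hH := levelCurv_ge_of_touching hC hst hz0 (hle' t ⟨htpos.le, le_rfl⟩) heq hnorm
  rw [← he] at hH
  set q := gradient (logGauge (u t)) z with hq
  set G := gaugeSpeed c (Real.cos θ) z (logGauge (u t) z) q
    (opForm (fderiv ℝ (gradient (logGauge (u t))) z)) with hGd
  have hDl : D (Fin.last n) = e * z (Fin.last n) := by simp [hD, hbl]
  have hlamG : -(n * c * (s t - Real.cos θ * D 0)) + n * c * (lam / s t) ≤ lam * G :=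
    gaugeSpeed_ge_of_touching hst hlam hheight hvec hnorm hDl hH
  have hder := ((((hG.neg.exp.smul_const z).sub (hbd t)).norm_sq).sub ((hs t).pow 2))
  -- At the first touching time the squared distance minus s² rises to 0, so its time derivative is
  -- nonnegative there; evaluated with the outer unit normal w = D/s of the sphere, this contradicts
  -- `hstrict`.
  have hnn := deriv_nonneg_of_le_left htpos hder (fun r hr => by
    have h1 := hle' r hr z hzc
    simp only [Pi.sub_apply, Pi.neg_apply, Pi.pow_apply]
    rw [heq]; linarith)
  simp only [Pi.sub_apply, Pi.neg_apply, ← he, ← hD] at hnn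
  have hinner : inner ℝ D ((e * -G) • z - (a' t - (s' t * k') • eFirst n))
      = -(lam * G) - inner ℝ D (a' t) + s' t * k' * D 0 := by
    rw [inner_sub_right, inner_sub_right, real_inner_smul_right, real_inner_smul_right,
      real_inner_comm (eFirst n) D, inner_eFirst, hlamd, real_inner_smul_right]
    ring
  have hlam2 : lam = s t ^ 2 + inner ℝ D (a t) - s t * k' * D 0 := by
    have h1 : e • z = D + b t := by rw [hD, sub_add_cancel]
    rw [hlamd, h1, inner_add_right, real_inner_self_eq_norm_sq, hDn, hb]
    simp only []
    rw [inner_sub_right, real_inner_smul_right, real_inner_comm (eFirst n) D, inner_eFirst]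
    ring
  have hw := hstrict t htpos.le ((s t)⁻¹ • D) (by rw [← hDn]; exact norm_smul_inv_self (by
    intro h; rw [h, norm_zero] at hDn; exact hst.ne hDn))
  simp only [real_inner_smul_right, PiLp.smul_apply, smul_eq_mul] at hw
  rw [hinner] at hnn
  have hw2 : n * c * (-(inner ℝ D (a t) / s t) + (k' - Real.cos θ) * D 0) - inner ℝ D (a' t)
      - s' t * (s t - k' * D 0) < 0 := by
    refine lt_of_eq_of_lt ?_ hw
    rw [real_inner_comm D (a t), real_inner_comm D (a' t)]
    field_simp
  have hlam3 : lam / s t = s t + inner ℝ D (a t) / s t - k' * D 0 := by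
    rw [hlam2]; field_simp
  rw [hlam3] at hlamG
  simp only [Nat.cast_ofNat, Nat.add_one_sub_one, pow_one] at hnn
  nlinarith

/-- Contracting caps are barriers: a flow starting in a cap stays in moving caps of the same radius
and contact angle. -/
theorem IsScalarFlow.norm_le_of_cap (hn : 1 ≤ n) (hc : 0 < c) {R : ℝ} (hR : 0 < R)
    (hk : |Real.cos θ| < 1) (hu : IsScalarFlow c θ u₀ Tstar u) {a : Space n} (ha0 : a 0 = 0)
    (hal : a (Fin.last n) = 0) (han : ‖a‖ ^ 2 + (R * Real.cos θ) ^ 2 ≤ R ^ 2)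
    (hinit : ∀ z ∈ closedHemisphere n,
      ‖Real.exp (u 0 z) • z - (a - (R * Real.cos θ) • eFirst n)‖ ≤ R)
    {t : ℝ} (ht : 0 ≤ t) (htS : (t : EReal) < Tstar) {z : Space n} (hz : z ∈ closedHemisphere n) :
    ‖Real.exp (u t z) • z - (Real.exp (-(n * c / R) * t) • a - (R * Real.cos θ) • eFirst n)‖
      ≤ R := by
  set k := Real.cos θ with hkd
  have hkl := abs_lt.1 hk
  set d := 1 - k ^ 2 with hd
  have hd0 : 0 < d := by nlinarith
  have hd2 : d ≤ 2 * (1 - |k|) := by nlinarith [sq_abs k, abs_nonneg k]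
  set η := d / (8 * R) with hη
  have hηR : R * η = d / 8 := by rw [hη]; field_simp
  set C := 4 * (n * c / R + n * c * η) / (1 - |k|) with hCd
  have hk1 : 0 < 1 - |k| := by linarith
  have hCk : C * (1 - |k|) = 4 * (n * c / R + n * c * η) := by rw [hCd]; field_simp
  have haR : ‖a‖ ≤ R := by nlinarith [norm_nonneg a, sq_nonneg (R * k)]
  have hcontr : ∀ r ≥ 0, ‖Real.exp (-(n * c / R) * r) • a‖ ≤ ‖a‖ := by
    intro r hr
    rw [norm_smul, Real.norm_of_nonneg (Real.exp_pos _).le]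
    refine mul_le_of_le_one_left (norm_nonneg a) (Real.exp_le_one_iff.2 ?_)
    have : 0 ≤ n * c / R * r := by positivity
    linarith
  -- The barrier has radius R + ε exp(Ct) and angle parameter k + ηε. Undoing both perturbations
  -- costs O(ε) at fixed t, which is then sent to zero.
  have key : ∀ ε : ℝ, 0 < ε → ε ≤ R / 2 →
      ‖Real.exp (u t z) • z - (Real.exp (-(n * c / R) * t) • a - (R * k) • eFirst n)‖
        ≤ R + ε * (2 * Real.exp (C * t) + R * η) := by
    intro ε hε hεR
    obtain ⟨hηε0, hηε, hk'a, hpar⟩ := cap_parameters hR hk hε hεR hηR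
    set k' := k + η * ε with hk'
    have hσ : ∀ r ≥ 0, ε ≤ ε * Real.exp (C * r) := fun r hr =>
      le_mul_of_one_le_right hε.le (Real.one_le_exp (by positivity))
    have hmain := hu.norm_lt_of_barrier hn htS (a := fun r => Real.exp (-(n * c / R) * r) • a)
      (a' := fun r => (Real.exp (-(n * c / R) * r) * -(n * c / R)) • a)
      (s := fun r => R + ε * Real.exp (C * r)) (s' := fun r => ε * (Real.exp (C * r) * C))
      (k' := k') (by rw [hk']; linarith) (fun r => by
        have := (((hasDerivAt_id r).const_mul (-(n * c / R))).exp).smul_const a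
        simpa using this) (fun r => by
        have := ((((hasDerivAt_id r).const_mul C).exp).const_mul ε).const_add R
        simpa using this) (fun r => by simp [ha0]) (fun r => by simp [hal])
      (fun r hr => by positivity) (fun r hr => ?_) (fun r hr w hw => ?_) (fun w hw => ?_) t
      ⟨ht, le_rfl⟩ z hz
    · set σ := ε * Real.exp (C * t)
      have h1 : |(R + σ) * k' - R * k| ≤ σ + R * (η * ε) := by
        have : (R + σ) * k' - R * k = σ * k' + R * (η * ε) := by rw [hk']; ring
        rw [this]
        refine (abs_add_le _ _).trans ?_
        have h2 : 0 < σ := by positivity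
        rw [abs_mul, abs_of_pos h2, abs_of_pos (by positivity : 0 < R * (η * ε))]
        nlinarith
      have h3 : Real.exp (u t z) • z - (Real.exp (-(n * c / R) * t) • a - (R * k) • eFirst n)
          = (Real.exp (u t z) • z - (Real.exp (-(n * c / R) * t) • a - ((R + σ) * k') • eFirst n))
            - ((R + σ) * k' - R * k) • eFirst n := by module
      rw [h3]
      refine (norm_sub_le _ _).trans ?_
      rw [norm_smul ((R + σ) * k' - R * k), norm_eFirst, mul_one, Real.norm_eq_abs]
      have h4 : ε * (2 * Real.exp (C * t) + R * η) = σ + (σ + R * (η * ε)) := by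
        simp only [σ]; ring
      rw [h4]
      linarith
    · have h2 := hpar (R + ε * Real.exp (C * r)) (by linarith [hσ r hr])
      have h1 := pow_le_pow_left₀ (norm_nonneg _) (hcontr r hr) 2
      nlinarith
    · refine lt_of_eq_of_lt ?_ (cap_strict (m := n * c) (σ := ε * Real.exp (C * r)) (C := C)
        (p := inner ℝ (Real.exp (-(n * c / R) * r) • a) w) (x := w 0) hR hk hε hεR hηR
        (by positivity) hCk (hσ r hr) ?_ ?_)
      · rw [real_inner_smul_left, real_inner_smul_left]; ring
      · refine (abs_real_inner_le_norm _ _).trans ?_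
        rw [hw, mul_one]
        exact (hcontr r hr).trans haR
      · rw [← hw]; exact abs_apply_le_norm w 0
    · have h0 := hinit w hw
      have h3 : Real.exp (u 0 w) • w - (Real.exp (-(n * c / R) * 0) • a
          - ((R + ε * Real.exp (C * 0)) * k') • eFirst n)
          = (Real.exp (u 0 w) • w - (a - (R * k) • eFirst n))
            + ((R + ε) * k' - R * k) • eFirst n := by
        simp only [mul_zero, Real.exp_zero, one_smul, mul_one]
        module
      rw [h3]
      refine (norm_add_le _ _).trans_lt ?_
      rw [norm_smul ((R + ε) * k' - R * k), norm_eFirst, mul_one, Real.norm_eq_abs, mul_zero,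
        Real.exp_zero, mul_one]
      have h1 : |(R + ε) * k' - R * k| ≤ ε * |k'| + R * (η * ε) := by
        have : (R + ε) * k' - R * k = ε * k' + R * (η * ε) := by rw [hk']; ring
        rw [this]
        refine (abs_add_le _ _).trans ?_
        rw [abs_mul, abs_of_pos hε, abs_of_pos (by positivity : 0 < R * (η * ε))]
      nlinarith
  by_contra! hcon
  set N := ‖Real.exp (u t z) • z - (Real.exp (-(n * c / R) * t) • a - (R * k) • eFirst n)‖
  set P := 2 * Real.exp (C * t) + R * η with hP
  have hP0 : 0 < P := by positivity
  have h1 := key (min (R / 2) ((N - R) / (2 * P)))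
    (lt_min (by positivity) (div_pos (by linarith) (by positivity))) (min_le_left _ _)
  have h2 : min (R / 2) ((N - R) / (2 * P)) * P ≤ (N - R) / (2 * P) * P := by
    gcongr; exact min_le_right _ _
  have h3 : (N - R) / (2 * P) * P = (N - R) / 2 := by field_simp
  linarith

end Flow

/-! ### The gradient up to the boundary and the boundary maximum. -/

theorem uniqueDiffOn_cone : UniqueDiffOn ℝ (cone n) := by
  have hconv : Convex ℝ {y : Space n | 0 ≤ y 0} := by
    intro x hx y hy a b ha hb _
    have hx : 0 ≤ x 0 := hx
    have hy : 0 ≤ y 0 := hy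
    have : 0 ≤ a * x 0 + b * y 0 := by positivity
    simpa using this
  have hint : (interior {y : Space n | 0 ≤ y 0}).Nonempty :=
    ⟨eFirst n, mem_interior_iff_mem_nhds.2 (Filter.mem_of_superset
      (isOpen_pos_first.mem_nhds (by simp [eFirst])) fun y (hy : 0 < y 0) => hy.le)⟩
  exact (uniqueDiffOn_convex hconv hint).inter isOpen_compl_singleton

/-- Needed for the symmetry of the one-sided second derivative at boundary points. -/
theorem mem_closure_interior_cone {y : Space n} (hy : y ∈ cone n) :
    y ∈ closure (interior (cone n)) := by
  have h1 : Tendsto (fun s : ℝ => y + s • eFirst n) (𝓝[>] 0) (𝓝 y) :=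
    (tendsto_line y (eFirst n)).mono_left nhdsWithin_le_nhds
  refine mem_closure_of_tendsto h1 ?_
  filter_upwards [self_mem_nhdsWithin] with s hs
  have hs : 0 < s := hs
  refine mem_interior_iff_mem_nhds.2 (cone_mem_nhds ?_)
  simpa [eFirst] using add_pos_of_nonneg_of_pos hy.1 hs

theorem smul_mem_cone {a : ℝ} (ha : 0 < a) {y : Space n} (hy : y ∈ cone n) : a • y ∈ cone n :=
  ⟨by simpa using mul_nonneg ha.le hy.1, smul_ne_zero ha.ne' hy.2⟩

theorem extDeriv_smul {f : Space n → ℝ} {m : WithTop ℕ∞} (hm : m ≠ 0)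
    (hf : ContDiffOn ℝ m (radialExt f) (cone n)) {a : ℝ} (ha : 0 < a) {y : Space n}
    (hy : y ∈ cone n) : extDeriv f (a • y) = a⁻¹ • extDeriv f y := by
  have h1 : HasFDerivWithinAt (fun z : Space n => a • z) (a • ContinuousLinearMap.id ℝ (Space n))
      (cone n) y := ((hasFDerivAt_id y).const_smul a).hasFDerivWithinAt
  have h2 : HasFDerivWithinAt (radialExt f ∘ fun z : Space n => a • z) _ (cone n) y :=
    (hasFDerivWithinAt_radialExt hm hf (smul_mem_cone ha hy)).comp y h1
      fun z hz => smul_mem_cone ha hz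
  have h3 : (radialExt f ∘ fun z : Space n => a • z) = radialExt f :=
    funext fun z => radialExt_smul f ha z
  rw [h3] at h2
  have h4 := (uniqueDiffOn_cone y hy).eq h2 (hasFDerivWithinAt_radialExt hm hf hy)
  rw [← h4]
  ext X
  simp [ha.ne']

/-- The gradient of `log |y| - f(y / |y|)`, one-sided at the boundary of the cone. -/
def coneGrad (f : Space n → ℝ) (y : Space n) : Space n :=
  (‖y‖ ^ 2)⁻¹ • y - (InnerProductSpace.toDual ℝ (Space n)).symm (extDeriv f y)

theorem coneGrad_of_norm_eq_one (f : Space n → ℝ) {z : Space n} (hz : ‖z‖ = 1) :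
    coneGrad f z = z - sphereGrad f z := by simp [coneGrad, sphereGrad, hz]

theorem coneGrad_eq_gradient {f : Space n → ℝ} {m : WithTop ℕ∞} (hm : m ≠ 0)
    (hf : ContDiffOn ℝ m (radialExt f) (cone n)) {y : Space n} (hy : 0 < y 0) :
    coneGrad f y = gradient (logGauge f) y := by
  rw [gradient_logGauge (ne_zero_of_pos_first hy)
    ((hf.contDiffAt (cone_mem_nhds hy)).differentiableAt hm), coneGrad, extDeriv_eq hy]
  rfl

theorem coneGrad_smul {f : Space n → ℝ} {m : WithTop ℕ∞} (hm : m ≠ 0)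
    (hf : ContDiffOn ℝ m (radialExt f) (cone n)) {a : ℝ} (ha : 0 < a) {y : Space n}
    (hy : y ∈ cone n) : coneGrad f (a • y) = a⁻¹ • coneGrad f y := by
  rw [coneGrad, coneGrad, extDeriv_smul hm hf ha hy, map_smul, smul_sub, norm_smul,
    Real.norm_of_nonneg ha.le, smul_smul, smul_smul]
  congr 2
  field_simp

theorem exists_hasFDerivAt_inv_norm_sq_smul {z : Space n} (hz : ‖z‖ = 1) :
    ∃ A : Space n →L[ℝ] Space n, HasFDerivAt (fun w : Space n => (‖w‖ ^ 2)⁻¹ • w) A z ∧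
      ∀ X, A X = X - (2 * inner ℝ z X) • z := by
  have h1 : HasFDerivAt (fun w : Space n => ‖w‖ ^ 2) (2 • innerSL ℝ z) z :=
    (hasStrictFDerivAt_norm_sq z).hasFDerivAt
  have hne : ‖z‖ ^ 2 ≠ 0 := by simp [hz]
  refine ⟨_, ((hasDerivAt_inv hne).comp_hasFDerivAt z h1).smul (hasFDerivAt_id z), fun X => ?_⟩
  simp [hz, sub_eq_add_neg]

/-- The one-sided derivative of `coneGrad` exists and is self-adjoint. -/
theorem exists_hasFDerivWithinAt_coneGrad {f : Space n → ℝ}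
    (hf : ContDiffOn ℝ 2 (radialExt f) (cone n)) {z : Space n} (hz : z ∈ closedHemisphere n) :
    ∃ B : Space n →L[ℝ] Space n, HasFDerivWithinAt (coneGrad f) B (cone n) z ∧
      ∀ X Y, inner ℝ (B X) Y = inner ℝ X (B Y) := by
  have hzc := mem_cone_of_mem_closedHemisphere hz
  have hd : DifferentiableWithinAt ℝ (extDeriv f) (cone n) z :=
    (hf.fderivWithin (m := 1) uniqueDiffOn_cone (by norm_num)).differentiableOn (by simp) z hzc
  have hsymm := ((hf z hzc).isSymmSndFDerivWithinAt (by simp) uniqueDiffOn_cone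
    (mem_closure_interior_cone hzc) hzc).eq
  obtain ⟨A, hA, hAX⟩ := exists_hasFDerivAt_inv_norm_sq_smul hz.1
  set J : (Space n →L[ℝ] ℝ) →L[ℝ] Space n :=
    (InnerProductSpace.toDual ℝ (Space n)).symm.toContinuousLinearEquiv.toContinuousLinearMap
  have h1 : HasFDerivWithinAt (fun y => J (extDeriv f y))
      (J.comp (fderivWithin ℝ (extDeriv f) (cone n) z)) (cone n) z :=
    J.hasFDerivAt.comp_hasFDerivWithinAt z hd.hasFDerivWithinAt
  refine ⟨_, hA.hasFDerivWithinAt.sub h1, fun X Y => ?_⟩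
  have e : ∀ X Y, inner ℝ ((A - J.comp (fderivWithin ℝ (extDeriv f) (cone n) z)) X) Y
      = inner ℝ X Y - 2 * (inner ℝ z X * inner ℝ z Y) - extDeriv2 f z X Y := by
    intro X Y
    have hJ : inner ℝ (J (extDeriv2 f z X)) Y = extDeriv2 f z X Y :=
      InnerProductSpace.toDual_symm_apply
    rw [← hJ, sub_apply, inner_sub_left, hAX, inner_sub_left, real_inner_smul_left, mul_assoc]
    rfl
  have h2 : extDeriv2 f z X Y = extDeriv2 f z Y X := hsymm X Y
  refine (e X Y).trans (Eq.trans ?_ ((real_inner_comm _ _).trans (e Y X)).symm)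
  rw [h2, real_inner_comm X Y]
  ring

theorem hasFDerivAt_aniso (k : ℝ) {q : Space n} (hq : q ≠ 0) :
    HasFDerivAt (aniso k) (innerSL ℝ (anisoGrad k q)) q := by
  have h1 : DifferentiableAt ℝ (aniso k) q := by
    have : DifferentiableAt ℝ (fun q : Space n => ‖q‖) q :=
      (contDiffAt_norm ℝ (n := 1) hq).differentiableAt (by simp)
    unfold aniso
    fun_prop
  refine h1.hasFDerivAt.congr_fderiv ?_
  ext X
  have h2 := hasDerivAt_line (X := X) (s := 0) (y := q) (F := aniso k) (by simpa using h1)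
  have h3 : HasDerivAt (fun s : ℝ => q + s • X) X 0 := by
    simpa using ((hasDerivAt_id (0 : ℝ)).smul_const X).const_add q
  have h4 := hasDerivAt_aniso k h3 (by simpa using hq)
  simpa using h2.unique h4

theorem aniso_smul (k : ℝ) {a : ℝ} (ha : 0 < a) (q : Space n) :
    aniso k (a • q) = a * aniso k q := by
  rw [aniso, aniso, norm_smul, Real.norm_of_nonneg ha.le]
  simp; ring

/-- At a boundary maximum of the weighted capillary gauge the gradient is bounded. -/
theorem norm_coneGrad_le_of_boundary_max {f : Space n → ℝ} {k : ℝ}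
    (hf : ContDiffOn ℝ 2 (radialExt f) (cone n)) {z : Space n} (hz : z ∈ hemisphereBoundary n)
    (hk : |k| < 1)
    (hbd : ∀ w ∈ hemisphereBoundary n, (w - sphereGrad f w) 0 = k * ‖w - sphereGrad f w‖)
    (hmax : ∀ y ∈ cone n, aniso (-1) y * aniso k (coneGrad f y)
      ≤ aniso (-1) z * aniso k (coneGrad f z)) :
    (1 - k ^ 2) * ‖coneGrad f z‖ ≤ 1 := by
  have hzh : z ∈ closedHemisphere n := ⟨hz.1, hz.2.ge⟩
  have hzc := mem_cone_of_mem_closedHemisphere hzh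
  obtain ⟨B, hB, hself⟩ := exists_hasFDerivWithinAt_coneGrad hf hzh
  have hcone : ∀ y ∈ cone n, y 0 = 0 → coneGrad f y 0 = k * ‖coneGrad f y‖ := by
    intro y hy hy0
    have hyn : 0 < ‖y‖ := norm_pos_iff.2 hy.2
    have hw1 : ‖‖y‖⁻¹ • y‖ = 1 := norm_smul_inv_self hy.2
    have h1 := hbd (‖y‖⁻¹ • y) ⟨hw1, by simp [hy0]⟩
    rw [← coneGrad_of_norm_eq_one f hw1, coneGrad_smul two_ne_zero hf (inv_pos.2 hyn) hy, inv_inv,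
      norm_smul, norm_norm] at h1
    have h2 : ‖y‖ * coneGrad f y 0 = ‖y‖ * (k * ‖coneGrad f y‖) := by
      have : ‖y‖ * coneGrad f y 0 = k * (‖y‖ * ‖coneGrad f y‖) := by simpa using h1
      linarith
    exact mul_left_cancel₀ hyn.ne' h2
  have hqz : inner ℝ z (coneGrad f z) = 1 := by
    rw [coneGrad_of_norm_eq_one f hz.1, inner_sub_right, real_inner_self_eq_norm_sq, hz.1,
      inner_sphereGrad_self two_ne_zero hf hzh]
    norm_num
  set q := coneGrad f z with hq
  have hq0 : q ≠ 0 := by intro h; rw [h] at hqz; simp at hqz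
  have hv : 0 < ‖q‖ := norm_pos_iff.2 hq0
  have hqk : q 0 = k * ‖q‖ := hcone z hzc hz.2
  set ξ := anisoGrad k q with hξ
  -- The capillary condition says exactly that ξ is tangent to the boundary, so that condition may
  -- be differentiated along ξ.
  have hξ0 : ξ 0 = 0 := by
    have : ξ 0 = ‖q‖⁻¹ * q 0 - k := by simp [hξ, anisoGrad, eFirst]
    rw [this, hqk]; field_simp; ring
  -- `X` is |q| times the derivative of q_1 - k|q| in q. Differentiating the boundary condition
  -- along ξ therefore gives ⟨Bξ, X⟩ = 0, and by self-adjointness φ is stationary in the inward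
  -- direction `X`.
  set X := ‖q‖ • eFirst n - k • q with hX
  have hX0 : X 0 = ‖q‖ * (1 - k ^ 2) := by
    have : X 0 = ‖q‖ - k * q 0 := by simp [hX, eFirst]
    rw [this, hqk]; ring
  have hd : 0 < 1 - k ^ 2 := by nlinarith [sq_abs k, abs_nonneg k]
  have hBξ : inner ℝ (B ξ) X = 0 := by
    have h1 := hasDerivWithinAt_ray (X := ξ) hB hzc (Or.inr hξ0.ge)
    have h2 := ((hasFDerivAt_aniso 0 hq0).hasFDerivWithinAt (s := Set.univ)).comp_hasDerivWithinAt_of_eq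
      0 h1 (Set.mapsTo_univ _ _) (by simp [hq])
    have h3 := (hasDerivWithinAt_const (0 : ℝ) (Set.Ici 0) (eFirst n)).inner ℝ h1
    have h4 := h3.sub (h2.const_mul k)
    have h5 := h4.congr_of_eventuallyEq (f₁ := fun _ => (0 : ℝ)) (by
      filter_upwards [eventually_ray_mem_cone hzc (Or.inr hξ0.ge)] with s hs
      have := hcone _ hs (by simp [hz.2, hξ0])
      simp [inner_eFirst, aniso, this]) (by simp [inner_eFirst, aniso, ← hq, hqk])
    have h6 := (uniqueDiffWithinAt_Ici (0 : ℝ)).eq_deriv _ h5 (hasDerivWithinAt_const 0 _ (0 : ℝ))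
    simp only [inner_zero_left, add_zero, coe_innerSL_apply, inner_anisoGrad, zero_mul, sub_zero,
      inner_eFirst] at h6
    rw [hX, inner_sub_right, real_inner_smul_right, real_inner_smul_right, real_inner_comm,
      inner_eFirst, real_inner_comm q]
    field_simp at h6
    linarith
  have hray := hasDerivWithinAt_ray (X := X) hB hzc (Or.inr (by rw [hX0]; positivity))
  have hXr : 0 < z 0 ∨ 0 ≤ X 0 := Or.inr (by rw [hX0]; positivity)
  have hid : HasDerivWithinAt (fun s : ℝ => z + s • X) X (Set.Ici 0) 0 := by
    have : HasDerivAt (fun s : ℝ => z + s • X) X 0 := by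
      simpa using ((hasDerivAt_id (0 : ℝ)).smul_const X).const_add z
    exact this.hasDerivWithinAt
  have g1 := ((hasFDerivAt_aniso (-1) hzc.2).hasFDerivWithinAt
    (s := Set.univ)).comp_hasDerivWithinAt_of_eq 0 hid (Set.mapsTo_univ _ _) (by simp)
  have g2 := ((hasFDerivAt_aniso k hq0).hasFDerivWithinAt
    (s := Set.univ)).comp_hasDerivWithinAt_of_eq 0 hray (Set.mapsTo_univ _ _) (by simp [hq])
  have g3 := deriv_nonpos_of_le_right (g1.mul g2) (by
    filter_upwards [eventually_ray_mem_cone hzc hXr] with s hs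
    simpa using hmax _ hs)
  have hBX : inner ℝ ξ (B X) = 0 := by rw [← hself, hBξ]
  simp only [coe_innerSL_apply, Function.comp_apply, zero_smul, add_zero, ← hq, ← hξ, hBX,
    mul_zero] at g3
  have hφ : 0 < aniso k q := lt_of_lt_of_le (mul_pos (by linarith) hv) (aniso_ge k q)
  have g4 := nonpos_of_mul_nonpos_left g3 hφ
  -- Only the weight varies along `X`; its derivative is (1 - k²)|q| - k, which must be nonpositive
  -- at a maximum.
  rw [inner_anisoGrad, hz.1, hX0, hX, inner_sub_right, real_inner_smul_right,
    real_inner_smul_right, hqz, real_inner_comm, inner_eFirst, hz.2] at g4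
  have := (abs_lt.1 hk).2
  linarith

/-! ### Geometry of caps. -/

theorem sq_add_sq_le_norm_sq (hn : 1 ≤ n) (X : Space n) :
    X 0 ^ 2 + X (Fin.last n) ^ 2 ≤ ‖X‖ ^ 2 := by
  have h0 : (0 : Fin (n + 1)) ≠ Fin.last n := by
    intro h; have := congrArg Fin.val h; simp at this; omega
  rw [EuclideanSpace.real_norm_sq_eq, ← Finset.sum_pair (f := fun i => X i ^ 2) h0]
  exact Finset.sum_le_sum_of_subset_of_nonneg (Finset.subset_univ _) fun i _ _ => sq_nonneg _

/-- The height in a cap is at least `K_0`. -/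
theorem capConst_le_of_norm_le (hn : 1 ≤ n) {c R θ : ℝ} (hR : 0 < R) (hθ : θ ∈ Set.Icc 0 Real.pi)
    {x a : Space n} (ha0 : a 0 = 0) (hal : a (Fin.last n) = 0) (hx : 0 ≤ x 0)
    (h : ‖x - (a - (R * Real.cos θ) • eFirst n)‖ ≤ R) :
    capConst c R θ ≤ c + x (Fin.last n) := by
  set D := x - (a - (R * Real.cos θ) • eFirst n) with hD
  have hD0 : D 0 = x 0 + R * Real.cos θ := by simp [hD, ha0, eFirst]
  have hDl : D (Fin.last n) = x (Fin.last n) := by simp [hD, hal, eFirst_last hn]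
  have hsq := sq_add_sq_le_norm_sq hn D
  rw [hD0, hDl] at hsq
  have hDR : ‖D‖ ^ 2 ≤ R ^ 2 := by gcongr
  rw [capConst]
  split_ifs with h1
  · have hcos : 0 ≤ Real.cos θ := Real.cos_nonneg_of_mem_Icc ⟨by linarith [hθ.1, Real.pi_pos], h1⟩
    have hsin : 0 ≤ Real.sin θ := Real.sin_nonneg_of_mem_Icc hθ
    have h2 : x (Fin.last n) ^ 2 ≤ (R * Real.sin θ) ^ 2 := by
      have := Real.sin_sq_add_cos_sq θ
      -- For cos θ ≥ 0 the wall x_1 ≥ 0 cuts the ball beyond its centre, which improves the radius R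
      -- to R sin θ.
      have h3 : 0 ≤ x 0 * (R * Real.cos θ) := by positivity
      nlinarith [sq_nonneg (x 0)]
    have := abs_le_of_sq_le_sq' h2 (by positivity)
    linarith
  · have h2 : x (Fin.last n) ^ 2 ≤ R ^ 2 := by nlinarith [sq_nonneg (x 0 + R * Real.cos θ)]
    have := abs_le_of_sq_le_sq' h2 hR.le
    linarith

/-- If a radial graph over the hemisphere lies in a cap, then its centre lies in the ball. -/
theorem center_mem_of_subset_cap (hn : 1 ≤ n) {R k : ℝ} {a : Space n} {f : Space n → ℝ}
    (ha0 : a 0 = 0)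
    (h : ∀ z ∈ closedHemisphere n, ‖Real.exp (f z) • z - (a - (R * k) • eFirst n)‖ ≤ R) :
    ‖a‖ ^ 2 + (R * k) ^ 2 ≤ R ^ 2 := by
  -- Both poles ±E_{n+1} belong to the closed hemisphere, so the origin is a convex combination of
  -- two points of the ball.
  have hm1 : eLast n ∈ closedHemisphere n := ⟨norm_eLast, (eLast_first hn).ge⟩
  have hm2 : -eLast n ∈ closedHemisphere n :=
    ⟨by rw [norm_neg, norm_eLast], by simp [eLast_first hn]⟩
  have h1 := h _ hm1
  have h2 := h _ hm2
  set p := Real.exp (f (eLast n))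
  set m := Real.exp (f (-eLast n))
  have hp : 0 < p := Real.exp_pos _
  have hm : 0 < m := Real.exp_pos _
  set b := a - (R * k) • eFirst n with hb
  have h3 : (p + m) * ‖b‖ ≤ (p + m) * R := by
    have e : (p + m) • b = -(m • (p • eLast n - b) + p • (m • -eLast n - b)) := by module
    calc (p + m) * ‖b‖ = ‖(p + m) • b‖ := by rw [norm_smul, Real.norm_of_nonneg (by positivity)]
      _ ≤ ‖m • (p • eLast n - b)‖ + ‖p • (m • -eLast n - b)‖ := by
          rw [e, norm_neg]; exact norm_add_le _ _
      _ ≤ m * R + p * R := by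
          rw [norm_smul, norm_smul, Real.norm_of_nonneg hm.le, Real.norm_of_nonneg hp.le]
          gcongr
      _ = _ := by ring
  have h4 : ‖b‖ ≤ R := le_of_mul_le_mul_left h3 (by positivity)
  have h5 : ‖b‖ ^ 2 = ‖a‖ ^ 2 + (R * k) ^ 2 := by
    rw [hb, norm_sub_sq_real, real_inner_smul_right, real_inner_comm, inner_eFirst, ha0, norm_smul,
      norm_eFirst, mul_one, Real.norm_eq_abs, sq_abs]
    ring
  rw [← h5]
  gcongr

/-! ### The maximum principle for the weighted gauge. -/

section Flow

variable {c θ : ℝ} {u₀ : Space n → ℝ} {Tstar : EReal} {u : ℝ → Space n → ℝ}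

theorem IsScalarFlow.continuousOn_coneGrad (hu : IsScalarFlow c θ u₀ Tstar u) {T : ℝ}
    (hT : (T : EReal) < Tstar) :
    ContinuousOn (fun p : ℝ × Space n => aniso (-1) p.2 * aniso (Real.cos θ) (coneGrad (u p.1) p.2))
      (Set.Icc 0 T ×ˢ closedHemisphere n) := by
  have hsub : Set.Icc 0 T ×ˢ closedHemisphere n ⊆ timeInterval Tstar ×ˢ cone n := fun p hp =>
    ⟨⟨hp.1.1, lt_of_le_of_lt (by exact_mod_cast hp.1.2) hT⟩,
      mem_cone_of_mem_closedHemisphere hp.2⟩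
  have h1 := hu.continuousOn_deriv.mono hsub
  have h2 : ContinuousOn (fun p : ℝ × Space n => (‖p.2‖ ^ 2)⁻¹ • p.2)
      (Set.Icc 0 T ×ˢ closedHemisphere n) := by
    have h : ContinuousOn (fun p : ℝ × Space n => ‖p.2‖ ^ 2)
        (Set.Icc 0 T ×ˢ closedHemisphere n) := by fun_prop
    exact (h.inv₀ fun p hp => by simp [hp.2.1]).smul continuous_snd.continuousOn
  have h3 : ContinuousOn (fun p : ℝ × Space n => coneGrad (u p.1) p.2)
      (Set.Icc 0 T ×ˢ closedHemisphere n) :=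
    h2.sub ((InnerProductSpace.toDual ℝ (Space n)).symm.continuous.comp_continuousOn h1)
  have h4 : ∀ k : ℝ, Continuous (aniso (n := n) k) := fun k => by unfold aniso; fun_prop
  exact ((h4 (-1)).comp continuous_snd).continuousOn.mul ((h4 _).comp_continuousOn h3)

theorem IsScalarFlow.contDiffAt_logGauge (hu : IsScalarFlow c θ u₀ Tstar u) {t : ℝ} (ht0 : 0 < t)
    (ht : (t : EReal) < Tstar) {y : Space n} (hy : 0 < y 0) :
    ContDiffAt ℝ 3 (fun p : ℝ × Space n => logGauge (u p.1) p.2) (t, y) := by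
  have h1 : ∀ᶠ s : ℝ in 𝓝 t, (s : EReal) < Tstar :=
    continuous_coe_real_ereal.continuousAt.eventually (eventually_lt_nhds ht)
  have hnhds : {t : ℝ | 0 < t ∧ (t : EReal) < Tstar} ∈ 𝓝 t := by
    filter_upwards [eventually_gt_nhds ht0, h1] with s h2 h3 using ⟨h2, h3⟩
  have h2 := (hu.smooth.contDiffAt (x := (t, y)) (prod_mem_nhds hnhds (cone_mem_nhds hy))).of_le
    (m := 3) (WithTop.coe_le_coe.2 (le_top : (3 : ℕ∞) ≤ ⊤))
  have h3 : ContDiffAt ℝ 3 (fun p : ℝ × Space n => Real.log ‖p.2‖) (t, y) :=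
    (contDiffAt_log_norm (ne_zero_of_pos_first hy)).comp (t, y) contDiffAt_snd
  exact h3.sub h2

/-- The weighted capillary gauge of the flow is bounded in terms of its threshold, once the flow
stays in a compact region whose height is bounded below. -/
theorem IsScalarFlow.aniso_le (hu : IsScalarFlow c θ u₀ Tstar u) {T K ρm hm Φ L : ℝ}
    (hT : (T : EReal) < Tstar) (hk : |Real.cos θ| < 1)
    (hΦ : ∀ (W : ℝ → Space n → ℝ) (t : ℝ) (y : Space n),
      ContDiffAt ℝ 3 (fun p : ℝ × Space n => W p.1 p.2) (t, y) →
      (∀ᶠ z in 𝓝 y, HasDerivAt (fun s => W s z)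
        (gaugeSpeed c (Real.cos θ) z (W t z) (gradient (W t) z)
          (opForm (fderiv ℝ (gradient (W t)) z))) t) →
      ‖y‖ = 1 → 0 ≤ y 0 → inner ℝ (gradient (W t) y) y = 1 →
      fderiv ℝ (gradient (W t)) y y = -gradient (W t) y →
      Real.exp (-W t y) ≤ ρm → K ≤ c + Real.exp (-W t y) * y (Fin.last n) →
      c + Real.exp (-W t y) * y (Fin.last n) ≤ hm →
      IsLocalMax (fun z => aniso (-1) z * aniso (Real.cos θ) (gradient (W t) z)) y →
      Φ ≤ aniso (Real.cos θ) (gradient (W t) y) →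
      ∃ d < 0, HasDerivAt (fun s => aniso (Real.cos θ) (gradient (W s) y)) d t)
    (hρ : ∀ t ∈ Set.Icc 0 T, ∀ z ∈ closedHemisphere n, Real.exp (u t z) ≤ ρm ∧
      K ≤ c + Real.exp (u t z) * z (Fin.last n) ∧ c + Real.exp (u t z) * z (Fin.last n) ≤ hm)
    (hLΦ : 2 * Φ ≤ L) (hLk : 4 / (1 - Real.cos θ ^ 2) ≤ L)
    (hL0 : ∀ z ∈ closedHemisphere n,
      aniso (-1) z * aniso (Real.cos θ) (coneGrad (u 0) z) ≤ L) :
    ∀ t ∈ Set.Icc 0 T, ∀ z ∈ closedHemisphere n,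
      aniso (-1) z * aniso (Real.cos θ) (coneGrad (u t) z) ≤ L := by
  intro t₀ ht₀ z₀ hz₀
  by_contra! hcon
  set k := Real.cos θ
  have hd : 0 < 1 - k ^ 2 := by nlinarith [sq_abs k, abs_nonneg k]
  obtain ⟨⟨t, z⟩, ⟨ht, hz⟩, hmax⟩ := (isCompact_Icc.prod isCompact_closedHemisphere).exists_isMaxOn
    ⟨(t₀, z₀), ht₀, hz₀⟩ (hu.continuousOn_coneGrad hT)
  have hmax' : ∀ s ∈ Set.Icc 0 T, ∀ w ∈ closedHemisphere n,
      aniso (-1) w * aniso k (coneGrad (u s) w) ≤ aniso (-1) z * aniso k (coneGrad (u t) z) :=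
    fun s hs w hw => hmax (a := (s, w)) ⟨hs, hw⟩
  have ht : t ∈ Set.Icc 0 T := ht
  have hz : z ∈ closedHemisphere n := hz
  have hLlt : L < aniso (-1) z * aniso k (coneGrad (u t) z) :=
    lt_of_lt_of_le hcon (hmax' t₀ ht₀ z₀ hz₀)
  have htpos : 0 < t := by
    rcases ht.1.eq_or_lt with h | h
    · rw [← h] at hLlt; exact absurd (hL0 z hz) (not_le.2 hLlt)
    · exact h
  have htS : (t : EReal) < Tstar := lt_of_le_of_lt (by exact_mod_cast ht.2) hT
  have htI : t ∈ timeInterval Tstar := ⟨htpos.le, htS⟩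
  have hC := hu.contDiff_two t htI
  -- The weighted gauge has degree zero, so a maximum over the hemisphere is a maximum over the
  -- whole cone, and all Euclidean directions are available.
  have hconemax : ∀ y ∈ cone n, aniso (-1) y * aniso k (coneGrad (u t) y)
      ≤ aniso (-1) z * aniso k (coneGrad (u t) z) := by
    intro y hy
    have hyn : 0 < ‖y‖ := norm_pos_iff.2 hy.2
    have h1 := hmax' t ht _ (normalize_mem_closedHemisphere hy)
    rw [coneGrad_smul two_ne_zero hC (inv_pos.2 hyn) hy, inv_inv, aniso_smul k hyn,
      aniso_smul (-1) (inv_pos.2 hyn)] at h1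
    refine le_of_eq_of_le ?_ h1
    field_simp
  have hS1 : 1 ≤ aniso (-1) z := by rw [aniso, hz.1]; linarith [hz.2]
  have hS2 : aniso (-1) z ≤ 2 := by
    have := CapillaryFlow.aniso_le (k := -1) (by simp) z
    rwa [hz.1, mul_one] at this
  have hL0' : 0 < L := lt_of_lt_of_le (by positivity) hLk
  -- The weight lies between 1 and 2 on the hemisphere.
  have hφ : L / 2 < aniso k (coneGrad (u t) z) := by
    have h0 : 0 < aniso k (coneGrad (u t) z) :=
      pos_of_mul_pos_right (lt_trans hL0' hLlt) (by linarith)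
    nlinarith
  rcases hz.2.eq_or_lt with h0 | h0
  · have h1 := norm_coneGrad_le_of_boundary_max hC ⟨hz.1, h0.symm⟩ hk
      (fun w hw => hu.boundary_normal htI hw) hconemax
    have h2 := CapillaryFlow.aniso_le hk.le (coneGrad (u t) z)
    rw [div_le_iff₀ hd] at hLk
    -- The boundary bound gives φ ≤ 2|q| ≤ 2/(1 - k²) ≤ L/2, contradicting `hφ`.
    nlinarith
  · have hgrad : ∀ {y : Space n}, 0 < y 0 → ∀ s ∈ timeInterval Tstar,
        coneGrad (u s) y = gradient (logGauge (u s)) y := fun hy s hs =>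
      coneGrad_eq_gradient two_ne_zero (hu.contDiff_two s hs) hy
    obtain ⟨hρ1, hρ2, hρ3⟩ := hρ t ht z hz
    have hexp : Real.exp (u t z) = Real.exp (-logGauge (u t) z) := by
      rw [logGauge_of_norm_eq_one _ hz.1, neg_neg]
    rw [hexp] at hρ1 hρ2 hρ3
    obtain ⟨d, hdneg, hder⟩ := hΦ (fun s y => logGauge (u s) y) t z
      (hu.contDiffAt_logGauge htpos htS h0)
      (by filter_upwards [isOpen_pos_first.mem_nhds h0] with y hy
          exact hu.hasDerivAt_logGauge htpos htS hy) hz.1 h0.le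
      (inner_gradient_logGauge_self h0
        ((CapillaryFlow.contDiffAt_logGauge hC h0).differentiableAt (by simp)))
      (fderiv_gradient_logGauge_self h0 hC) hρ1 hρ2 hρ3
      (by filter_upwards [isOpen_pos_first.mem_nhds h0] with y hy
          have := hconemax y (mem_cone_of_pos hy)
          rwa [hgrad hy t htI, hgrad h0 t htI] at this)
      (by rw [← hgrad h0 t htI]; linarith)
    have hnn := deriv_nonneg_of_le_left htpos hder (fun s hs => by
      have hsT : s ∈ Set.Icc 0 T := ⟨hs.1, hs.2.trans ht.2⟩
      have hsI : s ∈ timeInterval Tstar :=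
        ⟨hs.1, lt_of_le_of_lt (by exact_mod_cast hs.2) htS⟩
      have := hmax' s hsT z hz
      rw [hgrad h0 s hsI, hgrad h0 t htI] at this
      exact le_of_mul_le_mul_left this (by linarith))
    linarith

end Flow

end CapillaryFlow

end

/-! ### Conclusion. -/

theorem mainTheorem4 (n : ℕ) (hn : 1 ≤ n) (c R θ : ℝ) (hR : 0 < R)
    (hθ : θ ∈ Set.Icc 0 Real.pi)
    (hK : c * ((n : ℝ) - 1) / (4 * n) < capConst c R θ)
    (hangle : |Real.cos θ| <
      (4 * n * capConst c R θ - c * ((n : ℝ) - 1)) / (4 * n * capConst c R θ + c * ((n : ℝ) - 1)))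
    (M : ℝ) :
    ∃ C : ℝ, ∀ (a : Space n) (u₀ : Space n → ℝ),
      a 0 = 0 → a (Fin.last n) = 0 →
      (∀ z ∈ closedHemisphere n, position c z (u₀ z) ∈ cap c R θ a) →
      (∀ z ∈ closedHemisphere n, |u₀ z| ≤ M) →
      (∀ z ∈ closedHemisphere n, ‖sphereGrad u₀ z‖ ≤ M) →
      (∀ z ∈ closedHemisphere n, ∀ X Y : Space n, |sphereHess u₀ z X Y| ≤ M * ‖X‖ * ‖Y‖) →
      ∀ (Tstar : EReal) (u : ℝ → Space n → ℝ), 0 < Tstar → IsScalarFlow c θ u₀ Tstar u →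
        ∀ T : ℝ, (T : EReal) < Tstar →
          ∀ t ∈ Set.Icc 0 T, ∀ z ∈ closedHemisphere n, ‖sphereGrad (u t) z‖ ≤ C := by
  have hn' : (1 : ℝ) ≤ n := by exact_mod_cast hn
  set K := capConst c R θ with hKd
  have hcK : c * ((n : ℝ) - 1) < 4 * n * K := by
    rw [div_lt_iff₀ (by positivity)] at hK; linarith
  have hKc : K ≤ c := by
    rw [hKd, capConst]
    have := mul_nonneg hR.le (Real.sin_nonneg_of_mem_Icc hθ)
    split_ifs <;> linarith
  -- From c(n - 1) < 4nK ≤ 4nc one gets c(3n + 1) > 0.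
  have hc : 0 < c := by nlinarith
  have hK0 : 0 < K := by
    have h1 : 0 ≤ c * ((n : ℝ) - 1) := mul_nonneg hc.le (by linarith)
    nlinarith
  -- The quotient in the angle condition is at most 1; strict inclination |cos θ| < 1 is what makes
  -- φ comparable to |q|.
  have hk : |Real.cos θ| < 1 := by
    refine hangle.trans_le ?_
    have h1 : 0 ≤ c * ((n : ℝ) - 1) := mul_nonneg hc.le (by linarith)
    rw [div_le_one (by positivity)]
    linarith
  set k := Real.cos θ with hkd
  have hk1 : 0 < 1 - |k| := by linarith
  -- Points of the cap have distance at most R from its centre, and the centre has distance at most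
  -- |a| + R|k| ≤ 2R from the origin.
  obtain ⟨Φ, hΦ⟩ := exists_gauge_decay hn hc hK0 hcK hk (3 * R) (c + 3 * R)
  -- The three entries exclude a larger value at an interior maximum, at a boundary maximum and at
  -- the initial time.
  set L := max (2 * Φ) (max (4 / (1 - k ^ 2)) (4 * Real.sqrt (1 + M ^ 2))) with hL
  -- On the sphere (1 - |k|)|∇u| ≤ (1 - |k|)|q| ≤ φ, and the weight is at least 1.
  refine ⟨L / (1 - |k|), ?_⟩
  intro a u₀ ha0 hal hcap _ hgrad _ Tstar u hTs hu T hT t ht z hz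
  have h0I : (0 : ℝ) ∈ timeInterval Tstar := ⟨le_rfl, by exact_mod_cast hTs⟩
  have htS : (t : EReal) < Tstar := lt_of_le_of_lt (by exact_mod_cast ht.2) hT
  have hinit : ∀ z ∈ closedHemisphere n,
      ‖Real.exp (u 0 z) • z - (a - (R * k) • eFirst n)‖ ≤ R := by
    intro z hz
    have h1 := (hcap z hz).2.2
    rw [hu.initial z hz]
    refine le_of_eq_of_le ?_ h1
    rw [position]
    congr 1
    module
  have han := center_mem_of_subset_cap hn ha0 hinit
  have haR : ‖a‖ ≤ R := by nlinarith [norm_nonneg a, sq_nonneg (R * k)]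
  have hregion : ∀ s ∈ Set.Icc 0 T, ∀ z ∈ closedHemisphere n, Real.exp (u s z) ≤ 3 * R ∧
      K ≤ c + Real.exp (u s z) * z (Fin.last n) ∧
      c + Real.exp (u s z) * z (Fin.last n) ≤ c + 3 * R := by
    intro s hs z hz
    have hsS : (s : EReal) < Tstar := lt_of_le_of_lt (by exact_mod_cast hs.2) hT
    have h1 := hu.norm_le_of_cap hn hc hR hk ha0 hal han hinit hs.1 hsS hz
    set e := Real.exp (-(n * c / R) * s)
    have he : e ≤ 1 := by
      refine Real.exp_le_one_iff.2 ?_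
      have : 0 ≤ n * c / R * s := mul_nonneg (by positivity) hs.1
      linarith
    have he0 : 0 < e := Real.exp_pos _
    have h2 : Real.exp (u s z) ≤ 3 * R := by
      have h3 : ‖Real.exp (u s z) • z‖ = Real.exp (u s z) := by
        rw [norm_smul, hz.1, mul_one, Real.norm_of_nonneg (Real.exp_pos _).le]
      have h4 : ‖e • a - (R * k) • eFirst n‖ ≤ R + R := by
        refine (norm_sub_le _ _).trans (add_le_add ?_ ?_)
        · rw [norm_smul, Real.norm_of_nonneg he0.le]
          nlinarith [norm_nonneg a]
        · rw [norm_smul, norm_eFirst, mul_one, Real.norm_eq_abs, abs_mul, abs_of_pos hR]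
          nlinarith
      have h5 := norm_sub_norm_le (Real.exp (u s z) • z) (e • a - (R * k) • eFirst n)
      linarith
    refine ⟨h2, ?_, ?_⟩
    · have h3 := capConst_le_of_norm_le (c := c) hn hR hθ (x := Real.exp (u s z) • z) (a := e • a)
        (by simp [ha0]) (by simp [hal])
        (by simpa using mul_nonneg (Real.exp_pos _).le hz.2) h1
      simpa using h3
    · have h3 : z (Fin.last n) ≤ 1 := by
        rw [← hz.1]; exact (le_abs_self _).trans (abs_apply_le_norm z _)
      have := Real.exp_pos (u s z)
      nlinarith
  have hstart : ∀ z ∈ closedHemisphere n, aniso (-1) z * aniso k (coneGrad (u 0) z) ≤ L := by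
    intro z hz
    have hsg : sphereGrad (u 0) z = sphereGrad u₀ z := by
      have h1 : Set.EqOn (radialExt (u 0)) (radialExt u₀) (cone n) := fun y hy =>
        hu.initial _ (normalize_mem_closedHemisphere hy)
      unfold sphereGrad CapillaryFlow.extDeriv
      rw [fderivWithin_congr h1 (h1 (mem_cone_of_mem_closedHemisphere hz))]
    have h1 : ‖coneGrad (u 0) z‖ ≤ Real.sqrt (1 + M ^ 2) := by
      rw [coneGrad_of_norm_eq_one _ hz.1, ← slope_eq_norm_sub hz.1
        (inner_sphereGrad_self two_ne_zero (hu.contDiff_two 0 h0I) hz), hsg, CapillaryFlow.slope]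
      have := hgrad z hz
      gcongr
    have h2 := aniso_le hk.le (coneGrad (u 0) z)
    have h3 := aniso_le (k := -1) (by simp) z
    have h4 : 0 ≤ aniso k (coneGrad (u 0) z) :=
      le_trans (mul_nonneg hk1.le (norm_nonneg _)) (aniso_ge k _)
    rw [hz.1] at h3
    calc aniso (-1) z * aniso k (coneGrad (u 0) z) ≤ 2 * (2 * Real.sqrt (1 + M ^ 2)) := by
          gcongr
          · linarith
          · linarith
      _ = 4 * Real.sqrt (1 + M ^ 2) := by ring
      _ ≤ L := (le_max_right _ _).trans (le_max_right _ _)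
  have hmain := hu.aniso_le hT hk hΦ hregion (le_max_left _ _)
    ((le_max_left _ _).trans (le_max_right _ _)) hstart t ht z hz
  rw [coneGrad_of_norm_eq_one _ hz.1] at hmain
  have hinner := inner_sphereGrad_self two_ne_zero (hu.contDiff_two t ⟨ht.1, htS⟩) hz
  have h1 := aniso_ge k (z - sphereGrad (u t) z)
  have h2 : 1 ≤ aniso (-1) z := by rw [aniso, hz.1]; linarith [hz.2]
  have h3 : ‖sphereGrad (u t) z‖ ≤ ‖z - sphereGrad (u t) z‖ := by
    rw [← slope_eq_norm_sub hz.1 hinner, CapillaryFlow.slope]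
    exact Real.le_sqrt_of_sq_le (by linarith)
  rw [le_div_iff₀ hk1]
  have h4 : 0 ≤ (1 - |k|) * ‖z - sphereGrad (u t) z‖ := mul_nonneg hk1.le (norm_nonneg _)
  nlinarith
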